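/- Let $d\ge 0$ be an integer, $p,q\in(1,\infty)$, $\alpha,\beta>0$, and let $\Omega\subset\mathbb R^d$ be closed and convex. Let $W_p(\Omega)$ be the set of Borel probability measures on $\Omega$ with finite $p$-th moment, with the Wasserstein distance $W_p$. For $\mu_0\ne\mu_1$ in $W_p(\Omega)$ let $\Gamma(\mu_0,\mu_1)$ be the set of curves $\mu:[0,1]\to W_p(\Omega)$ that are Lipschitz with respect to $W_p$ and join $\mu_0$ to $\mu_1$. A velocity field of $\mu\in\Gamma(\mu_0,\mu_1)$ is a Borel map $v:[0,1]\times\mathbb R^d\to\mathbb R^d$ with $v_t\in L^p(\mu_t)$ for a.e. $t$ such that, for all $\phi\in C^1_c(\mathbb R^d)$, the function $s\mapsto\int\nabla\phi\cdot v_s\,d\mu_s$ is integrable on $[0,1]$ and $\int\phi\,d\mu_{t_2}-\int\phi\,d\mu_{t_1}=\int_{t_1}^{t_2}\int\nabla\phi\cdot v_s\,d\mu_s\,ds$ for all $0\le t_1<t_2\le1$. It is the tangent field of $\mu$ if, for every velocity field $w$ of $\mu$, $\|v_t\|_{L^p(\mu_t)}\le\|w_t\|_{L^p(\mu_t)}$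 for a.e. $t$. Put $V(\mu,t)=\int|v_t|^p\,d\mu_t$ with $v$ the tangent field of $\mu$, put $L_q(\nu)=\int_\Omega u^q\,dx$ if $\nu=u\,\mathcal L^d$ and $L_q(\nu)=+\infty$ if $\nu$ is not absolutely continuous, and (with $0\cdot\infty=0$) $$\mathfrak F(\mu)=\int_0^1L_q(\mu_t)^\alpha\,V(\mu,t)^\beta\,dt .$$ Let $\mu$ minimize $\mathfrak F$ on $\Gamma(\mu_0,\mu_1)$, with $\mathfrak F(\mu)<\infty$, let $v$ be its tangent field, and suppose that $V(\mu,\cdot)$ is locally bounded away from zero on $]0,1[$: for all $0<a<b<1$ there is $V_0>0$ with $V(\mu,t)\ge V_0$ for a.e. $t\in[a,b]$. Then $\mu_t=u(t,\cdot)\mathcal L^d$ for a.e. $t$, for some Borel function $u\ge0$ on $[0,1]\times\mathbb R^d$, and for every such $u$ the pair $(u,v)$ is a distributional solution of $$\begin{cases}H(t)\nabla u^q+K(t)\nabla\cdot\big(u|v|^{p-2}v\otimes v\big)+\partial_t\big(K(t)u|v|^{p-2}v\big)=0&\text{in }]0,1[\times\Omega,\\ \partial_tu+\nabla\cdot(uv)=0&\text{in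 }]0,1[\times\Omega,\\ uv\cdot n=0&\text{on }\partial\Omega,\\ \lim_{t\downarrow0}u(t,\cdot)\mathcal L^d=\mu_0,\qquad\lim_{t\uparrow1}u(t,\cdot)\mathcal L^d=\mu_1,\end{cases}$$ where $H(t)=\alpha(1-q)F(t)^{\alpha-1}V(t)^\beta$, $K(t)=p\beta F(t)^\alpha V(t)^{\beta-1}$, $F(t)=L_q(\mu_t)$ and $V(t)=V(\mu,t)$. Precisely: 1. $Hu^q$, $Ku|v|^{p-2}v_iv_j$ $(1\le i,j\le d)$ and $Ku|v|^{p-2}v$ are locally integrable on $]0,1[\times\operatorname{int}\Omega$, and for all $\xi\in C^\infty_c(]0,1[\times\operatorname{int}\Omega;\mathbb R^d)$ $$\int_0^1\!\int_\Omega\Big(Hu^q\,\nabla\cdot\xi+Ku|v|^{p-2}\big(\nabla\xi\, v+\partial_t\xi\big)\cdot v\Big)\,dx\,dt=0 .$$ 2. $u$ and $uv$ are locally integrable on $]0,1[\times\Omega$, and $\int_0^1\int_\Omega u(\partial_t\phi+\nabla\phi\cdot v)\,dx\,dt=0$ for all $\phi\in C^\infty_c(]0,1[\times\operatorname{int}\Omega)$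 (continuity equation) and, more generally, for all $\phi\in C^\infty_c(]0,1[\times\mathbb R^d)$ (this is the weak form of the no-flux condition on $\partial\Omega$). 3. The two limits hold in the distance $W_p$, for $t$ in a set of full measure in $[0,1]$. -/

import Mathlib

open MeasureTheory Set Filter Topology
open scoped ENNReal NNReal ContDiff

namespace WeightedWasserstein

/-- The Euclidean space `ℝ^d`. -/
abbrev Sp (d : ℕ) : Type := EuclideanSpace ℝ (Fin d)

variable {d : ℕ}

/-- Transport plans between `μ` and `ν`. -/
def couplings (μ ν : Measure (Sp d)) : Set (Measure (Sp d × Sp d)) :=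
  {π | π.map Prod.fst = μ ∧ π.map Prod.snd = ν}

/-- The Wasserstein distance of order `p`. -/
noncomputable def wDist (p : ℝ) (μ ν : Measure (Sp d)) : ℝ≥0∞ :=
  (⨅ π ∈ couplings μ ν, ∫⁻ z, edist z.1 z.2 ^ p ∂π) ^ (1 / p)

/-- `W_p(Ω)`: the probability measures on `Ω` with finite `p`-th moment, seen as measures on `ℝ^d`
that are concentrated on `Ω`. -/
def wSpace (p : ℝ) (Ω : Set (Sp d)) : Set (Measure (Sp d)) :=
  {ν | IsProbabilityMeasure ν ∧ ν Ωᶜ = 0 ∧ ∫⁻ x, ‖x‖ₑ ^ p ∂ν < ⊤}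

/-- `Γ(μ₀, μ₁)`: the Lipschitz curves `[0,1] → W_p(Ω)` from `μ₀` to `μ₁`. A curve is a function on
`ℝ` of which only the values on `[0,1]` matter. -/
structure IsLipschitzCurve (p : ℝ) (Ω : Set (Sp d)) (μ₀ μ₁ : Measure (Sp d))
    (μ : ℝ → Measure (Sp d)) : Prop where
  mem : ∀ t ∈ Icc (0 : ℝ) 1, μ t ∈ wSpace p Ω
  lipschitz : ∃ C : ℝ≥0, ∀ s ∈ Icc (0 : ℝ) 1, ∀ t ∈ Icc (0 : ℝ) 1,
    wDist p (μ s) (μ t) ≤ C * edist s t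
  left : μ 0 = μ₀
  right : μ 1 = μ₁

/-- `∫ |v_t|^p dμ_t`, the `p`-th power of the `L^p(μ_t)` norm of `v_t`. -/
noncomputable def energy (p : ℝ) (μ : ℝ → Measure (Sp d)) (v : ℝ → Sp d → Sp d) (t : ℝ) : ℝ≥0∞ :=
  ∫⁻ x, ‖v t x‖ₑ ^ p ∂(μ t)

/-- `v` is a velocity field of the curve `μ`: for a.e. `t` one has `v_t ∈ L^p(μ_t)`, and the
continuity equation holds against every `φ ∈ C^1_c`. The test functions are restrictions to the
closed set that carries `μ` of functions in `C^1_c(ℝ^d)`; they need not vanish on its boundary. -/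
structure IsVelocityField (p : ℝ) (μ : ℝ → Measure (Sp d)) (v : ℝ → Sp d → Sp d) : Prop where
  measurable : Measurable (Function.uncurry v)
  finite : ∀ᵐ t ∂(volume.restrict (Icc (0 : ℝ) 1)), energy p μ v t < ⊤
  continuity : ∀ φ : Sp d → ℝ, ContDiff ℝ 1 φ → HasCompactSupport φ →
    IntervalIntegrable (fun s => ∫ x, fderiv ℝ φ x (v s x) ∂(μ s)) volume 0 1 ∧
    ∀ t₁ ∈ Icc (0 : ℝ) 1, ∀ t₂ ∈ Icc (0 : ℝ) 1, t₁ < t₂ →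
      ∫ x, φ x ∂(μ t₂) - ∫ x, φ x ∂(μ t₁) = ∫ s in t₁..t₂, ∫ x, fderiv ℝ φ x (v s x) ∂(μ s)

/-- `v` is the tangent field of the curve `μ`: a velocity field whose `L^p(μ_t)` norm is, for
a.e. `t`, minimal among all velocity fields. -/
structure IsTangentField (p : ℝ) (μ : ℝ → Measure (Sp d)) (v : ℝ → Sp d → Sp d) : Prop where
  velocity : IsVelocityField p μ v
  minimal : ∀ w : ℝ → Sp d → Sp d, IsVelocityField p μ w →
    ∀ᵐ t ∂(volume.restrict (Icc (0 : ℝ) 1)), energy p μ v t ≤ energy p μ w t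

open Classical in
/-- `L_q(ν) = ∫_Ω u^q dx` if `ν = u dx`, and `+∞` if `ν` is not absolutely continuous. -/
noncomputable def Lq (q : ℝ) (Ω : Set (Sp d)) (ν : Measure (Sp d)) : ℝ≥0∞ :=
  if ν ≪ volume then ∫⁻ x in Ω, ν.rnDeriv volume x ^ q else ⊤

/-- The functional `𝔉(μ) = ∫_0^1 L_q(μ_t)^α V(μ,t)^β dt`, where `V(μ,t) = ∫ |v_t|^p dμ_t` for the
tangent field `v` of `μ`. All tangent fields give the same value, see `action_eq`, so that the
infimum only serves to name this value. -/
noncomputable def action (p q α β : ℝ) (Ω : Set (Sp d)) (μ : ℝ → Measure (Sp d)) : ℝ≥0∞ :=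
  ⨅ (v : ℝ → Sp d → Sp d) (_ : IsTangentField p μ v),
    ∫⁻ t in Icc (0 : ℝ) 1, Lq q Ω (μ t) ^ α * energy p μ v t ^ β

theorem action_eq (p q α β : ℝ) (Ω : Set (Sp d)) (μ : ℝ → Measure (Sp d))
    (v : ℝ → Sp d → Sp d) (hv : IsTangentField p μ v) :
    action p q α β Ω μ = ∫⁻ t in Icc (0 : ℝ) 1, Lq q Ω (μ t) ^ α * energy p μ v t ^ β := by
  refine le_antisymm (iInf₂_le v hv) (le_iInf₂ fun w hw => le_of_eq (lintegral_congr_ae ?_))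
  filter_upwards [hv.minimal w hw.velocity, hw.minimal v hv.velocity] with t h1 h2
  rw [le_antisymm h1 h2]

/-- `H(t) = α (1 - q) F(t)^(α-1) V(t)^β`. -/
noncomputable def coeffH (q α β : ℝ) (F V : ℝ → ℝ) (t : ℝ) : ℝ :=
  α * (1 - q) * F t ^ (α - 1) * V t ^ β

/-- `K(t) = p β F(t)^α V(t)^(β-1)`. -/
noncomputable def coeffK (p α β : ℝ) (F V : ℝ → ℝ) (t : ℝ) : ℝ :=
  p * β * F t ^ α * V t ^ (β - 1)

/-- The measure `u dx`. -/
noncomputable def densMeasure (u : Sp d → ℝ) : Measure (Sp d) :=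
  volume.withDensity fun x => ENNReal.ofReal (u x)

/-- `u(t, ·)` is the density of `μ_t`, for a.e. `t ∈ [0,1]`. -/
structure IsDensity (μ : ℝ → Measure (Sp d)) (u : ℝ → Sp d → ℝ) : Prop where
  measurable : Measurable (Function.uncurry u)
  nonneg : ∀ t x, 0 ≤ u t x
  eq : ∀ᵐ t ∂(volume.restrict (Icc (0 : ℝ) 1)), μ t = densMeasure (u t)

/-- The spatial divergence of a time dependent vector field. -/
noncomputable def spaceDiv (ξ : ℝ × Sp d → Sp d) (z : ℝ × Sp d) : ℝ :=
  ∑ i : Fin d, (fderiv ℝ ξ z (0, EuclideanSpace.single i 1)) i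

/-- `(u, v)` is a distributional solution of
`H ∇u^q + K ∇·(u|v|^(p-2) v ⊗ v) + ∂_t (K u|v|^(p-2) v) = 0` in `]0,1[ × Ω`,
`∂_t u + ∇·(u v) = 0` in `]0,1[ × Ω`, `u v · n = 0` on `∂Ω`, with boundary values `μ₀` and `μ₁`
at the times `0` and `1`. -/
structure IsWeakSolution (p q : ℝ) (Ω : Set (Sp d)) (H K : ℝ → ℝ) (μ₀ μ₁ : Measure (Sp d))
    (u : ℝ → Sp d → ℝ) (v : ℝ → Sp d → Sp d) : Prop where
  /-- the quantities under the derivatives are distributions -/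
  pressure_loc : LocallyIntegrableOn (fun z : ℝ × Sp d => H z.1 * u z.1 z.2 ^ q)
    (Ioo (0 : ℝ) 1 ×ˢ interior Ω)
  flux_loc : ∀ i j : Fin d, LocallyIntegrableOn
    (fun z : ℝ × Sp d =>
      K z.1 * u z.1 z.2 * ‖v z.1 z.2‖ ^ (p - 2) * (v z.1 z.2 i * v z.1 z.2 j))
    (Ioo (0 : ℝ) 1 ×ˢ interior Ω)
  momentum_loc : LocallyIntegrableOn
    (fun z : ℝ × Sp d => (K z.1 * u z.1 z.2 * ‖v z.1 z.2‖ ^ (p - 2)) • v z.1 z.2)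
    (Ioo (0 : ℝ) 1 ×ˢ interior Ω)
  density_loc : LocallyIntegrableOn (fun z : ℝ × Sp d => u z.1 z.2) (Ioo (0 : ℝ) 1 ×ˢ Ω)
  current_loc : LocallyIntegrableOn (fun z : ℝ × Sp d => u z.1 z.2 • v z.1 z.2)
    (Ioo (0 : ℝ) 1 ×ˢ Ω)
  /-- the momentum equation, tested against `ξ ∈ C^∞_c(]0,1[ × int Ω; ℝ^d)` -/
  momentum : ∀ ξ : ℝ × Sp d → Sp d, ContDiff ℝ ∞ ξ → HasCompactSupport ξ →
    tsupport ξ ⊆ Ioo (0 : ℝ) 1 ×ˢ interior Ω →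
    ∫ z in Ioo (0 : ℝ) 1 ×ˢ interior Ω,
      (H z.1 * u z.1 z.2 ^ q * spaceDiv ξ z
        + K z.1 * u z.1 z.2 * ‖v z.1 z.2‖ ^ (p - 2)
          * inner ℝ (fderiv ℝ ξ z (0, v z.1 z.2)) (v z.1 z.2)
        + K z.1 * u z.1 z.2 * ‖v z.1 z.2‖ ^ (p - 2)
          * inner ℝ (fderiv ℝ ξ z (1, 0)) (v z.1 z.2)) = 0
  /-- the continuity equation in the interior -/
  continuity : ∀ φ : ℝ × Sp d → ℝ, ContDiff ℝ ∞ φ → HasCompactSupport φ →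
    tsupport φ ⊆ Ioo (0 : ℝ) 1 ×ˢ interior Ω →
    ∫ z in Ioo (0 : ℝ) 1 ×ˢ interior Ω,
      u z.1 z.2 * (fderiv ℝ φ z (1, 0) + fderiv ℝ φ z (0, v z.1 z.2)) = 0
  /-- the weak form of `u v · n = 0` on `∂Ω`: the same identity for test functions that need not
  vanish on `∂Ω` -/
  noFlux : ∀ φ : ℝ × Sp d → ℝ, ContDiff ℝ ∞ φ → HasCompactSupport φ →
    tsupport φ ⊆ Ioo (0 : ℝ) 1 ×ˢ univ →
    ∫ z in Ioo (0 : ℝ) 1 ×ˢ Ω,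
      u z.1 z.2 * (fderiv ℝ φ z (1, 0) + fderiv ℝ φ z (0, v z.1 z.2)) = 0
  /-- the limits at the end points, in `W_p`; as `u(t, ·)` is given for a.e. `t` only, they are
  limits along a set of times of full measure -/
  initial : Tendsto (fun t => wDist p (densMeasure (u t)) μ₀) (𝓝[>] 0 ⊓ ae volume) (𝓝 0)
  terminal : Tendsto (fun t => wDist p (densMeasure (u t)) μ₁) (𝓝[<] 1 ⊓ ae volume) (𝓝 0)

end WeightedWasserstein

open WeightedWasserstein

/-! The momentum equation is the Euler-Lagrange equation of the functional under inner variations.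
Let `ξ` be smooth with compact support in ]0,1[ × int Ω. For small ε the maps X_t(x) = x + ε ξ(t, x)
are injective, send Ω into Ω and are the identity for t near 0 and 1, so the image curve μ^ε_t =
(X_t)_# μ_t is again admissible. A particle at x with velocity v_t(x) is carried to X_t(x) with
velocity v + ε (∂_t ξ + ∇ξ v). This transported field is a velocity field of μ^ε
(`IsVelocityField.exists_perturbed`). It need not be tangent, but its energy W_ε(t) dominates that
of the tangent field. The change of variables formula bounds L_q(μ^ε_t) by A_ε(t) = ∫ u^q |det(1 +
ε∇ξ)|^(1-q) dx (`Lq_map_le`). Hence 𝔉(μ) ≤ 𝔉(μ^ε) ≤ G(ε) := ∫ A_ε^α W_ε^β dt, with equality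
throughout at ε = 0, so G'(0) = 0. Writing out G'(0) gives the momentum equation.

Differentiation under the time integral needs a majorant. The relative errors of A_ε with respect to
F and of W_ε with respect to V are O(ε) uniformly in time, so the integrand moves by at most c F^α
V^β |ε| (`exists_variation_bound`), which is integrable because 𝔉(μ) is finite. The term ∂_t ξ
contributes an absolute error to W_ε, and the lower bound on V over the time support of ξ makes that
error relative.

Two facts about velocity fields support this. One is that V is at most C^p for a Lipschitz-type
constant C of the curve (`IsTangentField.ae_energy_le`), whereas the definition of a velocity field
only provides finiteness at almost every time. By minimality of v, the dual field |v|^(p-2) v is an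
L^{p'} limit in space-time of gradients of test functions, and pairings of gradients with v are
controlled by transport plans between nearby times. This bound allows test functions that depend on
time (`IsVelocityField.integral_sub_eq`). The other is that a curve with a velocity field in L^p of
space-time has a tangent field (`IsVelocityField.exists_isTangentField`). Without one the action of
a competitor would be an infimum over the empty set, that is +∞. Both facts rest on elements of
least norm in closed convex subsets of L^r.

The continuity equation and the no-flux condition are the time-dependent form of the defining
equation of v, and the limits at the end points come from the Lipschitz bound. -/

namespace WeightedWasserstein

variable {d : ℕ}

/-! ### A quantitative strict convexity of the r-th power of a Euclidean norm. -/

section UniformConvexity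

variable {E : Type*} [NormedAddCommGroup E] [InnerProductSpace ℝ E]

theorem norm_midpoint_rpow_le {r : ℝ} (hr : 1 < r) (a b : E) :
    ‖(1 / 2 : ℝ) • (a + b)‖ ^ r ≤ (‖a‖ ^ r + ‖b‖ ^ r) / 2 := by
  have h1 : ‖(1 / 2 : ℝ) • (a + b)‖ ≤ (1 / 2) * ‖a‖ + (1 / 2) * ‖b‖ := by
    rw [norm_smul]; norm_num; linarith [norm_add_le a b]
  have h2 := (convexOn_rpow hr.le).2 (mem_Ici.2 (norm_nonneg a)) (mem_Ici.2 (norm_nonneg b))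
    (by norm_num : (0 : ℝ) ≤ 1 / 2) (by norm_num : (0 : ℝ) ≤ 1 / 2) (by norm_num)
  simp only [smul_eq_mul] at h2
  have h3 := Real.rpow_le_rpow (norm_nonneg _) h1 (by linarith : 0 ≤ r)
  linarith

/-- Strictness has two sources: the triangle inequality when the norms agree, since distinct vectors
of equal norm are not on one ray, and the strict convexity of x ↦ x^r when they differ. -/
theorem norm_midpoint_rpow_lt {r : ℝ} (hr : 1 < r) {a b : E} (hab : a ≠ b) :
    ‖(1 / 2 : ℝ) • (a + b)‖ ^ r < (‖a‖ ^ r + ‖b‖ ^ r) / 2 := by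
  have h1 : ‖(1 / 2 : ℝ) • (a + b)‖ ≤ (1 / 2) * ‖a‖ + (1 / 2) * ‖b‖ := by
    rw [norm_smul]; norm_num; linarith [norm_add_le a b]
  by_cases hn : ‖a‖ = ‖b‖
  · have hs : ‖a + b‖ < ‖a‖ + ‖b‖ :=
      not_sameRay_iff_norm_add_lt.1 fun h => hab (h.norm_eq_iff.1 hn)
    have : ‖(1 / 2 : ℝ) • (a + b)‖ < ‖a‖ := by
      rw [norm_smul]; norm_num; linarith
    have := Real.rpow_lt_rpow (norm_nonneg _) this (by linarith : 0 < r)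
    rw [← hn]; linarith
  · have h2 := (strictConvexOn_rpow hr).2 (mem_Ici.2 (norm_nonneg a)) (mem_Ici.2 (norm_nonneg b)) hn
      (by norm_num : (0 : ℝ) < 1 / 2) (by norm_num : (0 : ℝ) < 1 / 2) (by norm_num)
    simp only [smul_eq_mul] at h2
    have h3 := Real.rpow_le_rpow (norm_nonneg _) h1 (by linarith : 0 ≤ r)
    linarith

/-- Both sides are homogeneous of degree r, so the unit sphere of E × E suffices. There the pairs
with ‖a - b‖^r ≥ ε form a compact set on which the midpoint defect is continuous and positive, hence
bounded below. Being pointwise and additive, the estimate can be integrated; it plays the role of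
uniform convexity of L^r. -/
theorem exists_norm_sub_rpow_le [FiniteDimensional ℝ E] {r : ℝ} (hr : 1 < r) {ε : ℝ} (hε : 0 < ε) :
    ∃ C : ℝ, 0 ≤ C ∧ ∀ a b : E, ‖a - b‖ ^ r ≤ ε * (‖a‖ ^ r + ‖b‖ ^ r) +
      C * ((‖a‖ ^ r + ‖b‖ ^ r) / 2 - ‖(1 / 2 : ℝ) • (a + b)‖ ^ r) := by
  have hr0 : 0 < r := by linarith
  have : ProperSpace E := FiniteDimensional.proper_real E
  set δ : E × E → ℝ := fun z => (‖z.1‖ ^ r + ‖z.2‖ ^ r) / 2 - ‖(1 / 2 : ℝ) • (z.1 + z.2)‖ ^ r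
  have hδ0 : ∀ z, 0 ≤ δ z := fun z => sub_nonneg.2 (norm_midpoint_rpow_le hr z.1 z.2)
  have hc : ∀ f : E × E → E, Continuous f → Continuous fun z => ‖f z‖ ^ r := fun f hf =>
    hf.norm.rpow_const fun _ => Or.inr hr0.le
  have hδc : Continuous δ :=
    (((hc _ continuous_fst).add (hc _ continuous_snd)).div_const _).sub (hc _ (by fun_prop))
  set K : Set (E × E) := Metric.sphere 0 1 ∩ {z | ε ≤ ‖z.1 - z.2‖ ^ r}
  have hK : IsCompact K := (isCompact_sphere _ _).inter_right
    (isClosed_le continuous_const (hc _ (by fun_prop)))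
  obtain ⟨c, hc0, hcK⟩ : ∃ c > 0, ∀ z ∈ K, c ≤ δ z := by
    rcases K.eq_empty_or_nonempty with h | h
    · exact ⟨1, one_pos, by simp [h]⟩
    · obtain ⟨z, hz, hmin⟩ := hK.exists_isMinOn h hδc.continuousOn
      refine ⟨δ z, ?_, fun w hw => hmin hw⟩
      have hne : z.1 ≠ z.2 := by
        intro h
        have := hz.2
        simp only [mem_ofPred_eq, h, sub_self, norm_zero, Real.zero_rpow hr0.ne'] at this
        linarith
      exact sub_pos.2 (norm_midpoint_rpow_lt hr hne)
  -- On the unit sphere ‖a - b‖ ≤ 2, and the defect is at least c where the term with ε does not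
  -- suffice.
  refine ⟨2 ^ r / c, by positivity, fun a b => ?_⟩
  have unit : ∀ z ∈ Metric.sphere (0 : E × E) 1,
      ‖z.1 - z.2‖ ^ r ≤ ε * (‖z.1‖ ^ r + ‖z.2‖ ^ r) + 2 ^ r / c * δ z := by
    intro z hz
    have hz1 : ‖z‖ = 1 := by simpa using hz
    by_cases hzK : z ∈ K
    · have h1 : ‖z.1 - z.2‖ ≤ 2 := by
        have := norm_sub_le z.1 z.2
        linarith [norm_fst_le z, norm_snd_le z]
      have h2 := Real.rpow_le_rpow (norm_nonneg _) h1 hr0.le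
      have h3 : (2 : ℝ) ^ r ≤ 2 ^ r / c * δ z := by
        rw [div_mul_eq_mul_div, le_div_iff₀ hc0]
        exact mul_le_mul_of_nonneg_left (hcK z hzK) (by positivity)
      have : 0 ≤ ε * (‖z.1‖ ^ r + ‖z.2‖ ^ r) := by positivity
      linarith
    · have h1 : ‖z.1 - z.2‖ ^ r < ε := by
        by_contra h
        exact hzK ⟨hz, not_lt.1 h⟩
      have h2 : 1 ≤ ‖z.1‖ ^ r + ‖z.2‖ ^ r := by
        have h01 : 0 ≤ ‖z.1‖ ^ r := by positivity
        have h02 : 0 ≤ ‖z.2‖ ^ r := by positivity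
        rw [Prod.norm_def] at hz1
        rcases max_choice ‖z.1‖ ‖z.2‖ with h | h <;> rw [h] at hz1 <;> rw [hz1, Real.one_rpow] <;>
          linarith
      have h3 : 0 ≤ 2 ^ r / c * δ z := mul_nonneg (by positivity) (hδ0 z)
      nlinarith
  set l : ℝ := ‖(a, b)‖
  rcases (norm_nonneg (a, b)).eq_or_lt with hl | hl
  · obtain ⟨rfl, rfl⟩ : a = 0 ∧ b = 0 := Prod.mk_eq_zero.1 (norm_eq_zero.1 hl.symm)
    simp [Real.zero_rpow hr0.ne']
  · have h := unit (l⁻¹ • (a, b)) (by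
      rw [mem_sphere_zero_iff_norm, norm_smul, norm_inv, norm_norm]
      exact inv_mul_cancel₀ hl.ne')
    have hs : ∀ x : E, ‖l⁻¹ • x‖ ^ r = (l ^ r)⁻¹ * ‖x‖ ^ r := fun x => by
      rw [norm_smul, Real.mul_rpow (norm_nonneg _) (norm_nonneg _), norm_inv, norm_norm,
        Real.inv_rpow hl.le]
    simp only [δ, Prod.smul_mk, ← smul_sub, ← smul_add, smul_comm (1 / 2 : ℝ) l⁻¹, hs] at h
    have hl' : 0 < (l ^ r) := by positivity
    have e := mul_le_mul_of_nonneg_left h hl'.le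
    have e1 : ∀ x : ℝ, l ^ r * ((l ^ r)⁻¹ * x) = x := fun x => mul_inv_cancel_left₀ hl'.ne' x
    calc ‖a - b‖ ^ r = l ^ r * ((l ^ r)⁻¹ * ‖a - b‖ ^ r) := (e1 _).symm
      _ ≤ _ := e
      _ = l ^ r * ((l ^ r)⁻¹ * (ε * (‖a‖ ^ r + ‖b‖ ^ r) +
      2 ^ r / c * ((‖a‖ ^ r + ‖b‖ ^ r) / 2 - ‖(1 / 2 : ℝ) • (a + b)‖ ^ r))) := by ring
      _ = _ := e1 _

end UniformConvexity

/-! ### Elements of least norm in closed convex subsets of L^r. -/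

section LpMinimum

variable {E : Type*} [NormedAddCommGroup E] {X : Type*} [MeasurableSpace X] {M : Measure X}

theorem integrable_norm_rpow_of_memLp {r : ℝ} (hr : 0 < r) {f : X → E}
    (hf : MemLp f (ENNReal.ofReal r) M) : Integrable (fun x => ‖f x‖ ^ r) M := by
  simpa [ENNReal.toReal_ofReal hr.le] using hf.integrable_norm_rpow (by simpa using hr) (by simp)

theorem norm_Lp_rpow {r : ℝ} (hr : 0 < r) (f : Lp E (ENNReal.ofReal r) M) :
    ‖f‖ ^ r = ∫ x, ‖f x‖ ^ r ∂M := by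
  have h0 : 0 ≤ ∫ x, ‖f x‖ ^ r ∂M := integral_nonneg fun x => by positivity
  rw [Lp.norm_def, (Lp.memLp f).eLpNorm_eq_integral_rpow_norm (by simpa using hr) (by simp),
    ENNReal.toReal_ofReal hr.le, ENNReal.toReal_ofReal (by positivity),
    ← Real.rpow_mul h0, inv_mul_cancel₀ hr.ne', Real.rpow_one]

/-- A minimising sequence is Cauchy: midpoints stay in `S`, so their norms are at least the infimum
m, and the integrated convexity estimate bounds ‖g - h‖^r by a small multiple of the norms plus C
times a defect that tends to 0 as both norms tend to m. -/
theorem exists_norm_le_of_convex [InnerProductSpace ℝ E] [FiniteDimensional ℝ E] {r : ℝ} (hr : 1 < r)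
    [Fact (1 ≤ ENNReal.ofReal r)] {S : Set (Lp E (ENNReal.ofReal r) M)} (hS : IsClosed S)
    (hS' : Convex ℝ S) (hne : S.Nonempty) : ∃ f ∈ S, ∀ g ∈ S, ‖f‖ ≤ ‖g‖ := by
  have hr0 : 0 < r := by linarith
  set m : ℝ := sInf ((fun f => ‖f‖) '' S)
  have hbdd : BddBelow ((fun f : Lp E (ENNReal.ofReal r) M => ‖f‖) '' S) :=
    ⟨0, by rintro _ ⟨f, -, rfl⟩; exact norm_nonneg f⟩
  have hm : ∀ f ∈ S, m ≤ ‖f‖ := fun f hf => csInf_le hbdd ⟨f, hf, rfl⟩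
  have hm0 : 0 ≤ m := le_csInf (hne.image _) (by rintro _ ⟨f, -, rfl⟩; exact norm_nonneg f)
  have hex : ∀ n : ℕ, ∃ f ∈ S, ‖f‖ < m + 1 / ((n : ℝ) + 1) := by
    intro n
    obtain ⟨_, ⟨f, hf, rfl⟩, h⟩ := exists_lt_of_csInf_lt (hne.image _)
      (lt_add_of_pos_right m (by positivity : (0 : ℝ) < 1 / ((n : ℝ) + 1)))
    exact ⟨f, hf, h⟩
  choose f hfS hf using hex
  have hlim : Tendsto (fun n => ‖f n‖) atTop (𝓝 m) :=
    tendsto_of_tendsto_of_tendsto_of_le_of_le tendsto_const_nhds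
      (by simpa using tendsto_const_nhds.add (tendsto_one_div_add_atTop_nhds_zero_nat (𝕜 := ℝ)))
      (fun n => hm _ (hfS n)) fun n => (hf n).le
  have hlimr : Tendsto (fun n => ‖f n‖ ^ r) atTop (𝓝 (m ^ r)) :=
    hlim.rpow_const (Or.inr hr0.le)
  have key : ∀ ε > 0, ∃ C : ℝ, 0 ≤ C ∧ ∀ g ∈ S, ∀ h ∈ S, ‖g - h‖ ^ r ≤
      ε * (‖g‖ ^ r + ‖h‖ ^ r) + C * ((‖g‖ ^ r + ‖h‖ ^ r) / 2 - m ^ r) := by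
    intro ε hε
    obtain ⟨C, hC, H⟩ := exists_norm_sub_rpow_le (E := E) hr hε
    refine ⟨C, hC, fun g hg h hh => ?_⟩
    have hmid : m ^ r ≤ ‖(1 / 2 : ℝ) • (g + h)‖ ^ r := by
      refine Real.rpow_le_rpow hm0 (hm _ ?_) hr0.le
      rw [smul_add]
      exact hS' hg hh (by norm_num) (by norm_num) (by norm_num)
    have ig := integrable_norm_rpow_of_memLp hr0 (Lp.memLp g)
    have ih := integrable_norm_rpow_of_memLp hr0 (Lp.memLp h)
    have im := integrable_norm_rpow_of_memLp hr0 (Lp.memLp ((1 / 2 : ℝ) • (g + h)))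
    have : ‖g - h‖ ^ r ≤ ε * (‖g‖ ^ r + ‖h‖ ^ r) +
        C * ((‖g‖ ^ r + ‖h‖ ^ r) / 2 - ‖(1 / 2 : ℝ) • (g + h)‖ ^ r) := by
      have i1 : Integrable (fun x => ‖g x‖ ^ r + ‖h x‖ ^ r) M := ig.add ih
      have i2 : Integrable (fun x => (‖g x‖ ^ r + ‖h x‖ ^ r) / 2 -
        ‖((1 / 2 : ℝ) • (g + h) : Lp E (ENNReal.ofReal r) M) x‖ ^ r) M := (i1.div_const 2).sub im
      simp only [norm_Lp_rpow hr0]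
      rw [← integral_add ig ih, ← integral_const_mul, ← integral_div, ← integral_sub
        (i1.div_const 2) im, ← integral_const_mul, ← integral_add (i1.const_mul ε)
        (i2.const_mul C)]
      refine integral_mono_ae (integrable_norm_rpow_of_memLp hr0 (Lp.memLp _))
        ((i1.const_mul ε).add (i2.const_mul C)) ?_
      filter_upwards [Lp.coeFn_sub g h, Lp.coeFn_smul (1 / 2 : ℝ) (g + h), Lp.coeFn_add g h]
        with x h1 h2 h3
      have := H (g x) (h x)
      simp only [h1, h2, h3, Pi.sub_apply, Pi.smul_apply, Pi.add_apply]
      exact this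
    have h2 := mul_le_mul_of_nonneg_left hmid hC
    linarith
  have hcauchy : CauchySeq f := by
    rw [Metric.cauchySeq_iff]
    intro η hη
    -- With both r-th powers of norms below m^r + 1 this makes the first term at most η^r / 2; the
    -- threshold on the norms makes the second at most η^r / 4.
    set ε : ℝ := η ^ r / (4 * (m ^ r + 1))
    have hmr : 0 ≤ m ^ r := by positivity
    have hηr : 0 < η ^ r := by positivity
    have hε : 0 < ε := by positivity
    obtain ⟨C, hC, H⟩ := key ε hε
    have hτ : 0 < min 1 (η ^ r / (4 * (C + 1))) := by positivity
    have hev : ∀ᶠ n in atTop, ‖f n‖ ^ r < m ^ r + min 1 (η ^ r / (4 * (C + 1))) :=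
      hlimr.eventually (gt_mem_nhds (by linarith))
    obtain ⟨N, hN⟩ := eventually_atTop.1 hev
    refine ⟨N, fun i hi j hj => ?_⟩
    rw [dist_eq_norm]
    refine lt_of_not_ge fun hge => ?_
    have h0 := Real.rpow_le_rpow hη.le hge hr0.le
    have h1 := H _ (hfS i) _ (hfS j)
    have h2 := hN i hi
    have h3 := hN j hj
    have a1 := min_le_left 1 (η ^ r / (4 * (C + 1)))
    have a2 := min_le_right 1 (η ^ r / (4 * (C + 1)))
    have b1 : ε * (‖f i‖ ^ r + ‖f j‖ ^ r) ≤ η ^ r / 2 := by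
      calc ε * (‖f i‖ ^ r + ‖f j‖ ^ r) ≤ ε * (2 * (m ^ r + 1)) :=
            mul_le_mul_of_nonneg_left (by linarith) hε.le
        _ = η ^ r / 2 := by simp only [ε]; field_simp; ring
    have b2 : C * ((‖f i‖ ^ r + ‖f j‖ ^ r) / 2 - m ^ r) ≤ η ^ r / 4 := by
      calc C * ((‖f i‖ ^ r + ‖f j‖ ^ r) / 2 - m ^ r) ≤ C * (η ^ r / (4 * (C + 1))) :=
            mul_le_mul_of_nonneg_left (by linarith) hC
        _ = η ^ r / 4 * (C / (C + 1)) := by field_simp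
        _ ≤ η ^ r / 4 * 1 := mul_le_mul_of_nonneg_left
            ((div_le_one (by linarith)).2 (by linarith)) (by positivity)
        _ = _ := mul_one _
    linarith
  obtain ⟨g, hg⟩ := cauchySeq_tendsto_of_complete hcauchy
  refine ⟨g, hS.mem_of_tendsto hg (Eventually.of_forall hfS), fun h hh => ?_⟩
  rw [tendsto_nhds_unique hg.norm hlim]
  exact hm h hh

end LpMinimum

/-! ### Differentiation under the integral and the first variation of the L^r norm. -/

section Variation

variable {X : Type*} [MeasurableSpace X] {M : Measure X}

/-- Dominated convergence for the difference quotients at the single point 0, so that nothing has to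
be differentiated at other values of ε. The derivative is measurable as a limit of quotients along a
sequence. -/
theorem hasDerivAt_integral_of_abs_sub_le {F : ℝ → X → ℝ} {F' bound : X → ℝ} {δ : ℝ} (hδ : 0 < δ)
    (hmeas : ∀ ε, |ε| < δ → AEStronglyMeasurable (F ε) M) (hint : Integrable (F 0) M)
    (hb : ∀ᵐ x ∂M, ∀ ε, |ε| < δ → |F ε x - F 0 x| ≤ bound x * |ε|) (hbi : Integrable bound M)
    (hd : ∀ᵐ x ∂M, HasDerivAt (fun ε => F ε x) (F' x) 0) :
    Integrable F' M ∧ HasDerivAt (fun ε => ∫ x, F ε x ∂M) (∫ x, F' x ∂M) 0 := by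
  have hseq : Tendsto (fun n : ℕ => δ / 2 * (1 / ((n : ℝ) + 1))) atTop (𝓝[≠] 0) := by
    refine tendsto_nhdsWithin_iff.2 ⟨?_, Eventually.of_forall fun n => ?_⟩
    · simpa using (tendsto_one_div_add_atTop_nhds_zero_nat (𝕜 := ℝ)).const_mul (δ / 2)
    · have : 0 < δ / 2 * (1 / ((n : ℝ) + 1)) := by positivity
      exact this.ne'
  have hlt : ∀ n : ℕ, |δ / 2 * (1 / ((n : ℝ) + 1))| < δ := fun n => by
    have h1 : 1 / ((n : ℝ) + 1) ≤ 1 := (div_le_one (by positivity)).2 (by linarith [n.cast_nonneg (α := ℝ)])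
    rw [abs_of_pos (by positivity)]
    nlinarith
  have hF' : AEStronglyMeasurable F' M := by
    refine aestronglyMeasurable_of_tendsto_ae atTop
      (f := fun n : ℕ => fun x => (δ / 2 * (1 / ((n : ℝ) + 1)))⁻¹ *
        (F (δ / 2 * (1 / ((n : ℝ) + 1))) x - F 0 x)) (fun n => ?_) ?_
    · exact ((hmeas _ (hlt n)).sub hint.1).const_mul _
    · filter_upwards [hd] with x hx
      have := (hasDerivAt_iff_tendsto_slope.1 hx).comp hseq
      refine this.congr fun n => ?_
      simp [slope, vsub_eq_sub]
  have hδ' : Metric.ball (0 : ℝ) δ ∈ 𝓝 (0 : ℝ) := Metric.ball_mem_nhds _ hδ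
  have := hasFDerivAt_integral_of_dominated_loc_of_lip' (𝕜 := ℝ) (μ := M) (F := F) (x₀ := 0)
    (F' := fun x => ContinuousLinearMap.toSpanSingleton ℝ (F' x)) (bound := bound) hδ'
    (fun ε hε => hmeas ε (by simpa using hε)) hint
    ((ContinuousLinearMap.toSpanSingletonCLE (𝕜 := ℝ) (E := ℝ)).continuous.comp_aestronglyMeasurable
      hF') (by
      filter_upwards [hb] with x hx ε hε
      simpa using hx ε (by simpa using hε)) hbi (by
      filter_upwards [hd] with x hx using hx.hasFDerivAt)
  have hi : Integrable F' M := by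
    have := this.1.apply_continuousLinearMap (1 : ℝ)
    simpa using this
  refine ⟨hi, ?_⟩
  have h2 := this.2.hasDerivAt
  rwa [ContinuousLinearMap.integral_apply this.1, integral_congr_ae (g := F')
    (Eventually.of_forall fun x => by simp)] at h2

variable {E : Type*} [NormedAddCommGroup E]

theorem abs_rpow_sub_rpow_le {r R s t : ℝ} (hr : 1 ≤ r) (hs : 0 ≤ s) (ht : 0 ≤ t) (hsR : s ≤ R)
    (htR : t ≤ R) : |s ^ r - t ^ r| ≤ r * R ^ (r - 1) * |s - t| := by
  refine Convex.norm_image_sub_le_of_norm_hasDerivWithin_le (s := Icc 0 R)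
    (f := fun x : ℝ => x ^ r) (f' := fun x => r * x ^ (r - 1)) (fun x _ =>
      (Real.hasDerivAt_rpow_const (Or.inr hr)).hasDerivWithinAt) (fun x hx => ?_) (convex_Icc 0 R)
    ⟨ht, htR⟩ ⟨hs, hsR⟩
  rw [Real.norm_of_nonneg (by have := hx.1; positivity)]
  exact mul_le_mul_of_nonneg_left (Real.rpow_le_rpow hx.1 hx.2 (by linarith)) (by linarith)

/-- The mean value inequality for x ↦ x^r on [0, ‖a‖ + ‖z‖]; the factor ‖z‖ of the increment is
absorbed into the power, which leaves an integrable majorant for a, z in L^r. -/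
theorem abs_norm_add_smul_rpow_sub_le [NormedSpace ℝ E] {r : ℝ} (hr : 1 ≤ r) (a z : E) {ε : ℝ}
    (hε : |ε| ≤ 1) :
    |‖a + ε • z‖ ^ r - ‖a‖ ^ r| ≤ r * (‖a‖ + ‖z‖) ^ r * |ε| := by
  have h1 : ‖ε • z‖ ≤ |ε| * ‖z‖ := by rw [norm_smul, Real.norm_eq_abs]
  have h2 : |ε| * ‖z‖ ≤ ‖z‖ := mul_le_of_le_one_left (norm_nonneg _) hε
  have h3 := abs_rpow_sub_rpow_le hr (norm_nonneg (a + ε • z)) (norm_nonneg a)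
    (R := ‖a‖ + ‖z‖) (by linarith [norm_add_le a (ε • z)]) (by linarith [norm_nonneg z])
  have h4 : |‖a + ε • z‖ - ‖a‖| ≤ |ε| * ‖z‖ := by
    refine (abs_norm_sub_norm_le _ _).trans ?_
    simpa using h1
  have hR : 0 ≤ ‖a‖ + ‖z‖ := by positivity
  calc |‖a + ε • z‖ ^ r - ‖a‖ ^ r| ≤ r * (‖a‖ + ‖z‖) ^ (r - 1) * (|ε| * ‖z‖) :=
        h3.trans (mul_le_mul_of_nonneg_left h4 (by positivity))
    _ ≤ r * (‖a‖ + ‖z‖) ^ (r - 1) * (|ε| * (‖a‖ + ‖z‖)) := by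
        gcongr; linarith [norm_nonneg a]
    _ = r * ((‖a‖ + ‖z‖) ^ (r - 1) * (‖a‖ + ‖z‖)) * |ε| := by ring
    _ = _ := by
        rw [← Real.rpow_add_one' hR (by linarith)]; simp

theorem hasDerivAt_norm_add_smul_rpow [InnerProductSpace ℝ E] {r : ℝ} (hr : 1 < r) (a z : E) :
    HasDerivAt (fun ε : ℝ => ‖a + ε • z‖ ^ r) (r * (‖a‖ ^ (r - 2) * inner ℝ a z)) 0 := by
  have h1 : HasDerivAt (fun ε : ℝ => a + ε • z) z 0 := by
    simpa using ((hasDerivAt_id (0 : ℝ)).smul_const z).const_add a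
  have h2 := (hasFDerivAt_norm_rpow (a + (0 : ℝ) • z) hr).comp_hasDerivAt (0 : ℝ) h1
  refine (h2.congr_deriv ?_).congr_of_eventuallyEq (Eventually.of_forall fun ε => rfl)
  simp [mul_assoc]

theorem memLp_norm_rpow {r : ℝ} (hr : 0 < r) {f : X → E} (hf : AEStronglyMeasurable f M)
    (hi : Integrable (fun x => ‖f x‖ ^ r) M) : MemLp f (ENNReal.ofReal r) M := by
  rw [← integrable_norm_rpow_iff hf (by simpa using hr) (by simp), ENNReal.toReal_ofReal hr.le]
  exact hi

theorem hasDerivAt_integral_norm_add_smul_rpow [InnerProductSpace ℝ E] {r : ℝ} (hr : 1 < r)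
    {f g : X → E} (hf : MemLp f (ENNReal.ofReal r) M) (hg : MemLp g (ENNReal.ofReal r) M) :
    Integrable (fun x => r * (‖f x‖ ^ (r - 2) * inner ℝ (f x) (g x))) M ∧
    HasDerivAt (fun ε : ℝ => ∫ x, ‖f x + ε • g x‖ ^ r ∂M)
      (∫ x, r * (‖f x‖ ^ (r - 2) * inner ℝ (f x) (g x)) ∂M) 0 := by
  have hr0 : 0 < r := by linarith
  have hb : Integrable (fun x => r * (‖f x‖ + ‖g x‖) ^ r) M := by
    have := (integrable_norm_rpow_of_memLp hr0 (hf.norm.add hg.norm)).const_mul r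
    refine this.congr (Eventually.of_forall fun x => ?_)
    simp only [Pi.add_apply, Real.norm_of_nonneg (add_nonneg (norm_nonneg (f x)) (norm_nonneg (g x)))]
  refine hasDerivAt_integral_of_abs_sub_le one_pos (fun ε _ => ?_) ?_ (bound := fun x => r * (‖f x‖ + ‖g x‖) ^ r) ?_ hb ?_
  · exact (integrable_norm_rpow_of_memLp hr0 (hf.add (hg.const_smul ε))).1
  · simpa using integrable_norm_rpow_of_memLp hr0 hf
  · refine Eventually.of_forall fun x ε hε => ?_
    simpa using abs_norm_add_smul_rpow_sub_le hr.le (f x) (g x) hε.le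
  · exact Eventually.of_forall fun x => hasDerivAt_norm_add_smul_rpow hr (f x) (g x)

/-- The Euler-Lagrange equation for minimisers of the `L^r` norm. -/
theorem integral_norm_rpow_inner_eq_zero [InnerProductSpace ℝ E] {r : ℝ} (hr : 1 < r)
    {f g : X → E} (hf : MemLp f (ENNReal.ofReal r) M) (hg : MemLp g (ENNReal.ofReal r) M)
    (hmin : ∀ ε : ℝ, ∫ x, ‖f x‖ ^ r ∂M ≤ ∫ x, ‖f x + ε • g x‖ ^ r ∂M) :
    ∫ x, ‖f x‖ ^ (r - 2) * inner ℝ (f x) (g x) ∂M = 0 := by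
  have h := (hasDerivAt_integral_norm_add_smul_rpow hr hf hg).2
  have hloc : IsLocalMin (fun ε : ℝ => ∫ x, ‖f x + ε • g x‖ ^ r ∂M) 0 :=
    Eventually.of_forall fun ε => by simpa using hmin ε
  have h0 := hloc.hasDerivAt_eq_zero h
  rw [integral_const_mul] at h0
  exact (mul_eq_zero.1 h0).resolve_left (by linarith)

end Variation

/-! ### First order expansion of Jacobian determinants. -/

section Det

/-- The trace of an endomorphism of `ℝ^d`. -/
noncomputable def traceSp (A : Sp d →L[ℝ] Sp d) : ℝ := ∑ i, A (EuclideanSpace.single i 1) i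

/-- The matrix of an endomorphism of `ℝ^d`. -/
noncomputable def matrixSp (A : Sp d →L[ℝ] Sp d) : Matrix (Fin d) (Fin d) ℝ :=
  Matrix.of fun i j => A (EuclideanSpace.single j 1) i

theorem det_eq_det_matrixSp (A : Sp d →L[ℝ] Sp d) : A.det = (matrixSp A).det := by
  rw [ContinuousLinearMap.det, ← LinearMap.det_toMatrix (EuclideanSpace.basisFun (Fin d) ℝ).toBasis]
  congr 1

theorem matrixSp_one_add_smul (ε : ℝ) (A : Sp d →L[ℝ] Sp d) :
    matrixSp (1 + ε • A) = 1 + ε • matrixSp A := by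
  ext i j
  simp [matrixSp, Matrix.one_apply]

theorem det_one_sp : (1 : Sp d →L[ℝ] Sp d).det = 1 := by
  rw [det_eq_det_matrixSp, show matrixSp (1 : Sp d →L[ℝ] Sp d) = 1 by
    ext i j; simp [matrixSp, Matrix.one_apply], Matrix.det_one]

theorem hasDerivAt_det_one_add_smul (A : Sp d →L[ℝ] Sp d) :
    HasDerivAt (fun ε : ℝ => (1 + ε • A).det) (traceSp A) 0 := by
  have ht : traceSp A = (matrixSp A).trace := by simp [traceSp, matrixSp, Matrix.trace]
  -- The determinant det(1 + εA) equals 1 + ε tr A + ε² P(ε) with a polynomial P, so only the trace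
  -- survives at ε = 0.
  set P := (1 + (Polynomial.X : Polynomial ℝ) •
    (matrixSp A).map Polynomial.C).det.divX.divX
  have h := ((hasDerivAt_id (0 : ℝ)).const_mul (matrixSp A).trace).const_add 1 |>.add
    ((P.hasDerivAt 0).mul ((hasDerivAt_id (0 : ℝ)).pow 2))
  rw [ht]
  refine (h.congr_deriv (by simp)).congr_of_eventuallyEq (Eventually.of_forall fun ε => ?_)
  dsimp only
  rw [det_eq_det_matrixSp, matrixSp_one_add_smul, Matrix.det_one_add_smul]
  rfl

theorem contDiff_det : ContDiff ℝ 1 fun A : Sp d →L[ℝ] Sp d => A.det := by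
  simp only [det_eq_det_matrixSp, Matrix.det_apply]
  refine ContDiff.sum fun σ _ => ContDiff.const_smul _ (contDiff_prod fun i _ => ?_)
  simp only [matrixSp, Matrix.of_apply]
  have : ContDiff ℝ 1 fun A : Sp d →L[ℝ] Sp d => A (EuclideanSpace.single i 1) :=
    contDiff_id.clm_apply contDiff_const
  exact (EuclideanSpace.proj (𝕜 := ℝ) (σ i)).contDiff.comp this

/-- First order expansion of `|det (1 + B)| ^ s` at `B = 0`. -/
theorem exists_abs_det_rpow_sub_one_le (s : ℝ) :
    ∃ r > 0, ∃ L : ℝ, 0 ≤ L ∧ ∀ B : Sp d →L[ℝ] Sp d, ‖B‖ < r →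
      0 < |(1 + B).det| ∧ |(|(1 + B).det| ^ s) - 1| ≤ L * ‖B‖ := by
  have hdiff : DifferentiableAt ℝ (fun B : Sp d →L[ℝ] Sp d => (1 + B).det) 0 :=
    ((contDiff_det.differentiable one_ne_zero).comp (differentiable_id.const_add _)) 0
  have hpos : ∀ᶠ B : Sp d →L[ℝ] Sp d in 𝓝 0, 0 < (1 + B).det :=
    hdiff.continuousAt.eventually (lt_mem_nhds (by simp [det_one_sp]))
  have hdiff' : DifferentiableAt ℝ (fun B : Sp d →L[ℝ] Sp d => (1 + B).det ^ s) 0 :=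
    hdiff.rpow_const (Or.inl (by simp [det_one_sp]))
  obtain ⟨L, hL, hO⟩ := hdiff'.isBigO_sub.exists_pos
  rw [Asymptotics.isBigOWith_iff] at hO
  obtain ⟨r, hr, H⟩ := Metric.eventually_nhds_iff.1 (hO.and hpos)
  refine ⟨r, hr, L, hL.le, fun B hB => ?_⟩
  obtain ⟨h1, h2⟩ := H (y := B) (by simpa using hB)
  rw [abs_of_pos h2]
  refine ⟨h2, ?_⟩
  simpa [det_one_sp] using h1

theorem hasDerivAt_abs_det_rpow (s : ℝ) (A : Sp d →L[ℝ] Sp d) :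
    HasDerivAt (fun ε : ℝ => |(1 + ε • A).det| ^ s) (s * traceSp A) 0 := by
  have h := hasDerivAt_det_one_add_smul A
  have h1 : (1 + (0 : ℝ) • A).det = 1 := by
    have h0 : (0 : ℝ) • A = 0 := by ext x; simp
    rw [h0, add_zero, det_one_sp]
  have h2 := h.rpow_const (p := s) (Or.inl (by rw [h1]; exact one_ne_zero))
  rw [h1] at h2
  have hpos : ∀ᶠ ε : ℝ in 𝓝 0, 0 < (1 + ε • A).det :=
    h.continuousAt.eventually (lt_mem_nhds (one_pos.trans_eq h1.symm))
  refine (h2.congr_of_eventuallyEq ?_).congr_deriv (by simp [mul_comm])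
  filter_upwards [hpos] with ε hε
  rw [abs_of_pos hε]

end Det

/-! ### Transport plans between nearby times, and measurability of the curve. -/

section Coupling

/-- A curve of probability measures, Lipschitz in the sense that `μ s` and `μ t` have a
transport plan of cost at most `(C |s - t|) ^ p`. -/
structure IsCoupled (p C : ℝ) (μ : ℝ → Measure (Sp d)) : Prop where
  pos : 0 < C
  prob : ∀ t ∈ Icc (0 : ℝ) 1, IsProbabilityMeasure (μ t)
  plan : ∀ s ∈ Icc (0 : ℝ) 1, ∀ t ∈ Icc (0 : ℝ) 1, s ≠ t → ∃ π : Measure (Sp d × Sp d),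
    π.map Prod.fst = μ s ∧ π.map Prod.snd = μ t ∧ Integrable (fun z => ‖z.1 - z.2‖ ^ p) π ∧
      ∫ z, ‖z.1 - z.2‖ ^ p ∂π ≤ (C * |s - t|) ^ p

/-- Raising the Lipschitz constant by 1 makes the bound on the infimum over plans strict when s ≠ t,
so some plan satisfies it and no optimal plan is required. -/
theorem IsLipschitzCurve.exists_isCoupled {p : ℝ} (hp : 0 < p) {Ω : Set (Sp d)}
    {μ₀ μ₁ : Measure (Sp d)} {μ : ℝ → Measure (Sp d)} (h : IsLipschitzCurve p Ω μ₀ μ₁ μ) :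
    ∃ C, IsCoupled p C μ := by
  obtain ⟨C, hC⟩ := h.lipschitz
  refine ⟨C + 1, by positivity, fun t ht => (h.mem t ht).1, fun s hs t ht hst => ?_⟩
  have hpos : 0 < |s - t| := abs_pos.2 (sub_ne_zero.2 hst)
  have h1 : wDist p (μ s) (μ t) < ENNReal.ofReal ((C + 1) * |s - t|) := by
    refine (hC s hs t ht).trans_lt ?_
    rw [edist_dist, Real.dist_eq, ENNReal.ofReal_mul (by positivity)]
    have e : (C : ℝ≥0∞) = ENNReal.ofReal (C : ℝ) := by simp
    rw [e]
    rw [← ENNReal.ofReal_mul (by positivity), ← ENNReal.ofReal_mul (by positivity),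
      ENNReal.ofReal_lt_ofReal_iff (by positivity)]
    nlinarith
  have h2 : (⨅ π ∈ couplings (μ s) (μ t), ∫⁻ z, edist z.1 z.2 ^ p ∂π) <
      ENNReal.ofReal ((C + 1) * |s - t|) ^ p := by
    have := ENNReal.rpow_lt_rpow h1 hp
    rwa [wDist, ← ENNReal.rpow_mul, one_div, inv_mul_cancel₀ hp.ne', ENNReal.rpow_one] at this
  obtain ⟨π, ⟨hπ1, hπ2⟩, hπ⟩ : ∃ π ∈ couplings (μ s) (μ t), ∫⁻ z, edist z.1 z.2 ^ p ∂π <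
      ENNReal.ofReal ((C + 1) * |s - t|) ^ p := by
    simpa only [iInf_lt_iff, exists_prop] using h2
  have e : ∀ z : Sp d × Sp d, edist z.1 z.2 ^ p = ENNReal.ofReal (‖z.1 - z.2‖ ^ p) := fun z => by
    rw [edist_dist, dist_eq_norm, ENNReal.ofReal_rpow_of_nonneg (norm_nonneg _) hp.le]
  simp only [e] at hπ
  rw [ENNReal.ofReal_rpow_of_nonneg (by positivity) hp.le] at hπ
  have hm : AEStronglyMeasurable (fun z : Sp d × Sp d => ‖z.1 - z.2‖ ^ p) π := by
    have : Continuous fun z : Sp d × Sp d => ‖z.1 - z.2‖ ^ p :=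
      (continuous_fst.sub continuous_snd).norm.rpow_const fun _ => Or.inr hp.le
    exact this.aestronglyMeasurable
  have hnn : 0 ≤ᵐ[π] fun z : Sp d × Sp d => ‖z.1 - z.2‖ ^ p :=
    Eventually.of_forall fun z => by positivity
  refine ⟨π, hπ1, hπ2, ⟨hm, ?_⟩, ?_⟩
  · rw [hasFiniteIntegral_iff_ofReal hnn]
    exact hπ.trans ENNReal.ofReal_lt_top
  · rw [integral_eq_lintegral_of_nonneg_ae hnn hm]
    exact ENNReal.toReal_le_of_le_ofReal (by positivity) hπ.le

variable {p C : ℝ} {μ : ℝ → Measure (Sp d)}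

theorem isProbabilityMeasure_of_map_fst {X Y : Type*} [MeasurableSpace X] [MeasurableSpace Y]
    {π : Measure (X × Y)} {ν : Measure X} [IsProbabilityMeasure ν] (h : π.map Prod.fst = ν) :
    IsProbabilityMeasure π := by
  constructor
  have := measure_univ (μ := ν)
  rwa [← h, Measure.map_apply measurable_fst MeasurableSet.univ, preimage_univ] at this

theorem integrable_of_map_eq {X Y F : Type*} [MeasurableSpace X] [MeasurableSpace Y]
    [NormedAddCommGroup F] {π : Measure X} {g : X → Y} (hg : Measurable g) {ν : Measure Y}
    (h : π.map g = ν) {f : Y → F} (hf : Integrable f ν) : Integrable (fun z => f (g z)) π := by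
  rw [← h] at hf
  exact hf.comp_measurable hg

theorem integral_eq_of_map_eq {X Y : Type*} [MeasurableSpace X] [MeasurableSpace Y]
    {π : Measure X} {g : X → Y} (hg : Measurable g) {ν : Measure Y}
    (h : π.map g = ν) {f : Y → ℝ} (hf : AEStronglyMeasurable f ν) :
    ∫ x, f x ∂ν = ∫ z, f (g z) ∂π := by
  subst h
  exact integral_map hg.aemeasurable hf

theorem IsCoupled.abs_integral_sub_le (h : IsCoupled p C μ) {f : Sp d → ℝ} (hf : Continuous f)
    {B : ℝ} (hB : ∀ x, |f x| ≤ B) {ε K : ℝ} (hε : 0 ≤ ε) (hK : 0 ≤ K)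
    (hmod : ∀ x y, |f x - f y| ≤ ε + K * ‖x - y‖ ^ p) {s t : ℝ} (hs : s ∈ Icc (0 : ℝ) 1)
    (ht : t ∈ Icc (0 : ℝ) 1) : |∫ x, f x ∂(μ s) - ∫ x, f x ∂(μ t)| ≤ ε + K * (C * |s - t|) ^ p := by
  have hC := h.pos
  rcases eq_or_ne s t with rfl | hst
  · simp only [sub_self, abs_zero]; positivity
  obtain ⟨π, h1, h2, hi, hle⟩ := h.plan s hs t ht hst
  have := h.prob s hs
  have := h.prob t ht
  have := isProbabilityMeasure_of_map_fst h1
  have hfi : ∀ ν : Measure (Sp d), IsProbabilityMeasure ν → Integrable f ν := fun ν _ =>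
    Integrable.of_bound hf.aestronglyMeasurable B (Eventually.of_forall hB)
  rw [integral_eq_of_map_eq measurable_fst h1 hf.aestronglyMeasurable,
    integral_eq_of_map_eq measurable_snd h2 hf.aestronglyMeasurable,
    ← integral_sub (integrable_of_map_eq measurable_fst h1 (hfi _ inferInstance))
      (integrable_of_map_eq measurable_snd h2 (hfi _ inferInstance))]
  calc |∫ z, f z.1 - f z.2 ∂π| ≤ ∫ z, |f z.1 - f z.2| ∂π := abs_integral_le_integral_abs
    _ ≤ ∫ z, (ε + K * ‖z.1 - z.2‖ ^ p) ∂π := integral_mono_of_nonneg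
        (Eventually.of_forall fun _ => abs_nonneg _) ((integrable_const ε).add (hi.const_mul K))
        (Eventually.of_forall fun z => hmod z.1 z.2)
    _ = ε + K * ∫ z, ‖z.1 - z.2‖ ^ p ∂π := by
        rw [integral_add (integrable_const ε) (hi.const_mul K), integral_const_mul]; simp
    _ ≤ _ := by gcongr

/-- Beyond the distance δ of uniform continuity the oscillation is at most 2B, and 2B ≤ (2B / δ^p)
‖x - y‖^p. In this form the modulus integrates against a plan of finite p-cost. -/
theorem exists_modulus (hp : 0 < p) {F : Type*} [NormedAddCommGroup F] {f : Sp d → F}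
    (hf : UniformContinuous f) {B : ℝ} (hB : ∀ x, ‖f x‖ ≤ B) {ε : ℝ} (hε : 0 < ε) :
    ∃ K, 0 ≤ K ∧ ∀ x y, ‖f x - f y‖ ≤ ε + K * ‖x - y‖ ^ p := by
  obtain ⟨δ, hδ, H⟩ := Metric.uniformContinuous_iff.1 hf ε hε
  have hB0 : 0 ≤ B := (norm_nonneg _).trans (hB 0)
  refine ⟨2 * B / δ ^ p, by positivity, fun x y => ?_⟩
  have h0 : 0 ≤ 2 * B / δ ^ p * ‖x - y‖ ^ p := by positivity
  rcases lt_or_ge ‖x - y‖ δ with h | h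
  · have := H (a := x) (b := y) (by rwa [dist_eq_norm])
    rw [dist_eq_norm] at this
    linarith
  · have h1 : ‖f x - f y‖ ≤ 2 * B := by
      have := norm_sub_le (f x) (f y)
      linarith [hB x, hB y]
    have h2 := Real.rpow_le_rpow hδ.le h hp.le
    have h3 : 2 * B ≤ 2 * B / δ ^ p * ‖x - y‖ ^ p := by
      rw [div_mul_eq_mul_div, le_div_iff₀ (by positivity)]
      exact mul_le_mul_of_nonneg_left h2 (by linarith)
    linarith

theorem IsCoupled.continuousOn_integral (hp : 0 < p) (h : IsCoupled p C μ) {f : Sp d → ℝ}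
    (hf : UniformContinuous f) {B : ℝ} (hB : ∀ x, |f x| ≤ B) :
    ContinuousOn (fun t => ∫ x, f x ∂(μ t)) (Icc 0 1) := by
  intro s hs
  rw [Metric.continuousWithinAt_iff']
  intro ε hε
  obtain ⟨K, hK, hmod⟩ := exists_modulus hp hf hB (half_pos hε)
  have hlim : Tendsto (fun t => K * (C * |t - s|) ^ p) (𝓝[Icc 0 1] s) (𝓝 0) := by
    have : Continuous fun t => K * (C * |t - s|) ^ p := by
      refine continuous_const.mul (Continuous.rpow_const (by fun_prop) fun _ => Or.inr hp.le)
    have := this.tendsto s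
    simp only [sub_self, abs_zero, mul_zero, Real.zero_rpow hp.ne'] at this
    exact this.mono_left nhdsWithin_le_nhds
  filter_upwards [hlim.eventually (gt_mem_nhds (half_pos hε)), self_mem_nhdsWithin] with t h1 ht
  rw [Real.dist_eq]
  have := h.abs_integral_sub_le hf.continuous hB (half_pos hε).le hK hmod ht hs
  linarith

/-- Integrals of bounded uniformly continuous functions are continuous in time. The mass of a closed
set is a limit of such integrals, hence measurable in time, and closed sets form a generating
π-system. A kernel is what is needed to form the space-time measure ∫ μ_t dt. -/
theorem IsCoupled.exists_kernel (hp : 0 < p) (h : IsCoupled p C μ) :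
    ∃ κ : ProbabilityTheory.Kernel ℝ (Sp d), ProbabilityTheory.IsMarkovKernel κ ∧
      ∀ t ∈ Icc (0 : ℝ) 1, κ t = μ t := by
  -- Nothing is known of `μ` outside [0,1]; projecting the time onto [0,1] gives probability
  -- measures at all times.
  set ν : ℝ → Measure (Sp d) := fun t => μ (projIcc 0 1 zero_le_one t)
  have hν : ∀ t, IsProbabilityMeasure (ν t) := fun t => h.prob _ (projIcc 0 1 zero_le_one t).2
  have hmeas : Measurable ν := by
    refine Measurable.measure_of_isPiSystem_of_isProbabilityMeasure
      (S := {s | IsClosed s}) ?_ isPiSystem_isClosed fun F hF => ?_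
    · rw [BorelSpace.measurable_eq (α := Sp d), borel_eq_generateFrom_isClosed]
    · have hδ : ∀ n : ℕ, (0 : ℝ) < 1 / ((n : ℝ) + 1) := fun n => by positivity
      have hc : ∀ n : ℕ, Continuous fun t => ∫ x, (thickenedIndicator (hδ n) F x : ℝ) ∂(ν t) := by
        intro n
        have hu : UniformContinuous fun x => (thickenedIndicator (hδ n) F x : ℝ) :=
          NNReal.isUniformEmbedding_coe.uniformContinuous.comp
            (lipschitzWith_thickenedIndicator (hδ n) F).uniformContinuous
        have := h.continuousOn_integral hp hu (B := 1) fun x => by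
          rw [abs_of_nonneg (NNReal.coe_nonneg _)]
          exact_mod_cast thickenedIndicator_le_one (hδ n) F x
        exact this.comp_continuous (continuous_subtype_val.comp continuous_projIcc) fun t =>
          (projIcc 0 1 zero_le_one t).2
      have hlim : Measurable fun t => (ν t).real F :=
        measurable_of_tendsto_metrizable (fun n => (hc n).measurable) (tendsto_pi_nhds.2 fun t =>
          tendsto_integral_thickenedIndicator_of_isClosed (ν t) hF hδ
            tendsto_one_div_add_atTop_nhds_zero_nat)
      have : (fun t => ν t F) = fun t => ENNReal.ofReal ((ν t).real F) := by
        ext t; rw [ofReal_measureReal]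
      rw [this]
      exact hlim.ennreal_ofReal
  refine ⟨⟨ν, hmeas⟩, ⟨hν⟩, fun t ht => ?_⟩
  change μ (projIcc 0 1 zero_le_one t) = μ t
  rw [projIcc_of_mem zero_le_one ht]

end Coupling

/-! ### Pairings of velocity fields with gradients are bounded by the Lipschitz constant. -/

section Derivative

variable {p C : ℝ} {μ : ℝ → Measure (Sp d)}

/-- Mean value inequality near the diagonal, where the derivative varies by less than ε; far from it
the bounded oscillation of `φ` is absorbed into the p-th power of the distance. -/
theorem exists_first_order_bound (hp : 0 < p) {φ : Sp d → ℝ} (hφ : ContDiff ℝ 1 φ)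
    (hc : HasCompactSupport φ) {ε : ℝ} (hε : 0 < ε) :
    ∃ K, 0 ≤ K ∧ ∀ x y, |φ x - φ y| ≤ ‖x - y‖ * (‖fderiv ℝ φ y‖ + ε) + K * ‖x - y‖ ^ p := by
  have hu : UniformContinuous (fderiv ℝ φ) :=
    (hc.fderiv ℝ).uniformContinuous_of_continuous (hφ.continuous_fderiv one_ne_zero)
  obtain ⟨δ, hδ, H⟩ := Metric.uniformContinuous_iff.1 hu ε hε
  obtain ⟨B, hB⟩ := hc.exists_bound_of_continuous hφ.continuous
  have hB0 : 0 ≤ B := (norm_nonneg _).trans (hB 0)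
  refine ⟨2 * B / δ ^ p, by positivity, fun x y => ?_⟩
  have h0 : 0 ≤ 2 * B / δ ^ p * ‖x - y‖ ^ p := by positivity
  rcases lt_or_ge ‖x - y‖ δ with h | h
  · have h1 : ‖φ x - φ y‖ ≤ (‖fderiv ℝ φ y‖ + ε) * ‖x - y‖ := by
      refine Convex.norm_image_sub_le_of_norm_fderiv_le (𝕜 := ℝ) (s := Metric.ball y δ)
        (fun z _ => hφ.differentiable one_ne_zero z) (fun z hz => ?_) (convex_ball y δ)
        (Metric.mem_ball_self hδ) (by rwa [Metric.mem_ball, dist_eq_norm])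
      have := H (Metric.mem_ball.1 hz)
      rw [dist_eq_norm] at this
      have := norm_sub_norm_le (fderiv ℝ φ z) (fderiv ℝ φ y)
      linarith
    rw [Real.norm_eq_abs] at h1
    linarith
  · have h1 : |φ x - φ y| ≤ 2 * B := by
      have := norm_sub_le (φ x) (φ y)
      rw [Real.norm_eq_abs] at this
      linarith [hB x, hB y]
    have h2 := Real.rpow_le_rpow hδ.le h hp.le
    have h3 : 2 * B ≤ 2 * B / δ ^ p * ‖x - y‖ ^ p := by
      rw [div_mul_eq_mul_div, le_div_iff₀ (by positivity)]
      exact mul_le_mul_of_nonneg_left h2 (by linarith)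
    have h4 : 0 ≤ ‖x - y‖ * (‖fderiv ℝ φ y‖ + ε) := by positivity
    linarith

/-- Hölder's inequality on a plan between μ_s and μ_t: the distance has L^p norm at most C|s - t|,
and the derivative is evaluated at the second point, so its norm is taken in L^{p'}(μ_t). -/
theorem IsCoupled.abs_integral_sub_le_fderiv {p' : ℝ} (hpp : p.HolderConjugate p')
    (h : IsCoupled p C μ) {φ : Sp d → ℝ} (hφ : ContDiff ℝ 1 φ)
    (hc : HasCompactSupport φ) {ε K : ℝ} (hε : 0 ≤ ε) (hK : 0 ≤ K)
    (hmod : ∀ x y, |φ x - φ y| ≤ ‖x - y‖ * (‖fderiv ℝ φ y‖ + ε) + K * ‖x - y‖ ^ p) {s t : ℝ}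
    (hs : s ∈ Icc (0 : ℝ) 1) (ht : t ∈ Icc (0 : ℝ) 1) :
    |∫ x, φ x ∂(μ s) - ∫ x, φ x ∂(μ t)| ≤
      C * |s - t| * ((∫ x, ‖fderiv ℝ φ x‖ ^ p' ∂(μ t)) ^ (1 / p') + ε) + K * (C * |s - t|) ^ p := by
  have hC := h.pos
  have hp : 0 < p := hpp.pos
  have hp' : 0 < p' := hpp.symm.pos
  rcases eq_or_ne s t with rfl | hst
  · simp [Real.zero_rpow hp.ne']
  obtain ⟨π, h1, h2, hi, hle⟩ := h.plan s hs t ht hst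
  have := h.prob s hs
  have := h.prob t ht
  have := isProbabilityMeasure_of_map_fst h1
  obtain ⟨B, hB⟩ := hc.exists_bound_of_continuous hφ.continuous
  obtain ⟨B', hB'⟩ := (hc.fderiv ℝ).exists_bound_of_continuous (hφ.continuous_fderiv one_ne_zero)
  have hfi : ∀ ν : Measure (Sp d), IsProbabilityMeasure ν → Integrable φ ν := fun ν _ =>
    Integrable.of_bound hφ.continuous.aestronglyMeasurable B (Eventually.of_forall hB)
  have hcont : Continuous fun z : Sp d × Sp d => ‖z.1 - z.2‖ := by fun_prop
  have hdist : MemLp (fun z : Sp d × Sp d => ‖z.1 - z.2‖) (ENNReal.ofReal p) π :=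
    memLp_norm_rpow hp hcont.aestronglyMeasurable (by simpa using hi)
  have hDc : Continuous fun x => ‖fderiv ℝ φ x‖ := (hφ.continuous_fderiv one_ne_zero).norm
  have hD : MemLp (fun z : Sp d × Sp d => ‖fderiv ℝ φ z.2‖) (ENNReal.ofReal p') π :=
    MemLp.of_bound (hDc.comp continuous_snd).aestronglyMeasurable B'
      (Eventually.of_forall fun z => by simpa using hB' z.2)
  have hε' : MemLp (fun _ : Sp d × Sp d => ε) (ENNReal.ofReal p') π := memLp_const ε
  have nn : ∀ g : Sp d × Sp d → ℝ, (∀ z, 0 ≤ g z) → 0 ≤ᵐ[π] g := fun g hg => Eventually.of_forall hg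
  have H1 := integral_mul_le_Lp_mul_Lq_of_nonneg hpp (nn _ fun z => norm_nonneg _)
    (nn _ fun z => norm_nonneg _) hdist hD
  have H2 := integral_mul_le_Lp_mul_Lq_of_nonneg hpp (nn _ fun z => norm_nonneg _)
    (nn _ fun z => hε) hdist hε'
  have hcost : (∫ z, ‖z.1 - z.2‖ ^ p ∂π) ^ (1 / p) ≤ C * |s - t| := by
    have := Real.rpow_le_rpow (integral_nonneg fun z => by positivity) hle
      (by positivity : 0 ≤ 1 / p)
    rwa [← Real.rpow_mul (by positivity), mul_one_div_cancel hp.ne', Real.rpow_one] at this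
  have e2 : (∫ _, ε ^ p' ∂π) ^ (1 / p') = ε := by
    simp only [integral_const, probReal_univ, one_smul]
    rw [← Real.rpow_mul hε, mul_one_div_cancel hp'.ne', Real.rpow_one]
  have e1 : ∫ z, ‖fderiv ℝ φ z.2‖ ^ p' ∂π = ∫ x, ‖fderiv ℝ φ x‖ ^ p' ∂(μ t) :=
    (integral_eq_of_map_eq measurable_snd h2
      (hDc.rpow_const fun _ => Or.inr hp'.le).aestronglyMeasurable).symm
  rw [e2] at H2
  rw [e1] at H1
  have : Fact (1 ≤ ENNReal.ofReal p) := ⟨by simpa using hpp.lt.le⟩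
  have I1 : Integrable (fun z : Sp d × Sp d => ‖z.1 - z.2‖) π := hdist.integrable Fact.out
  have I2 : Integrable (fun z : Sp d × Sp d => ‖z.1 - z.2‖ * ‖fderiv ℝ φ z.2‖) π :=
    I1.mul_bdd (c := B') (hDc.comp continuous_snd).aestronglyMeasurable
      (Eventually.of_forall fun z => by simpa using hB' z.2)
  have I3 : Integrable (fun z : Sp d × Sp d => ‖z.1 - z.2‖ * ‖fderiv ℝ φ z.2‖ + ‖z.1 - z.2‖ * ε) π :=
    I2.add (I1.mul_const ε)
  rw [integral_eq_of_map_eq measurable_fst h1 hφ.continuous.aestronglyMeasurable,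
    integral_eq_of_map_eq measurable_snd h2 hφ.continuous.aestronglyMeasurable,
    ← integral_sub (integrable_of_map_eq measurable_fst h1 (hfi _ inferInstance))
      (integrable_of_map_eq measurable_snd h2 (hfi _ inferInstance))]
  calc |∫ z, φ z.1 - φ z.2 ∂π| ≤ ∫ z, |φ z.1 - φ z.2| ∂π := abs_integral_le_integral_abs
    _ ≤ ∫ z, (‖z.1 - z.2‖ * ‖fderiv ℝ φ z.2‖ + ‖z.1 - z.2‖ * ε + K * ‖z.1 - z.2‖ ^ p) ∂π := by
        refine integral_mono_of_nonneg (Eventually.of_forall fun _ => abs_nonneg _)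
          (I3.add (hi.const_mul K)) (Eventually.of_forall fun z => ?_)
        simpa [mul_add] using hmod z.1 z.2
    _ = ∫ z, ‖z.1 - z.2‖ * ‖fderiv ℝ φ z.2‖ ∂π + ∫ z, ‖z.1 - z.2‖ * ε ∂π
          + K * ∫ z, ‖z.1 - z.2‖ ^ p ∂π := by
        rw [integral_add I3 (hi.const_mul K), integral_add I2 (I1.mul_const ε), integral_const_mul]
    _ ≤ C * |s - t| * (∫ x, ‖fderiv ℝ φ x‖ ^ p' ∂(μ t)) ^ (1 / p') + C * |s - t| * ε
          + K * (C * |s - t|) ^ p := by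
        refine add_le_add (add_le_add (H1.trans ?_) (H2.trans ?_)) (by gcongr)
        · exact mul_le_mul_of_nonneg_right hcost (Real.rpow_nonneg
            (integral_nonneg fun x => by positivity) _)
        · exact mul_le_mul_of_nonneg_right hcost hε
    _ = _ := by ring

theorem ae_Icc_mem_Ioo : ∀ᵐ t ∂(volume.restrict (Icc (0 : ℝ) 1)), t ∈ Ioo (0 : ℝ) 1 := by
  rw [restrict_Ioo_eq_restrict_Icc.symm]
  exact ae_restrict_mem measurableSet_Ioo

/-- At almost every t the pairing is the derivative of s ↦ ∫ φ dμ_s. The transport estimate bounds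
the difference quotient, and its remainder is of order |s - t|^(p-1), which vanishes in the limit
because p > 1. -/
theorem IsVelocityField.ae_abs_integral_fderiv_le {p' : ℝ} (hpp : p.HolderConjugate p')
    (h : IsCoupled p C μ) {v : ℝ → Sp d → Sp d} (hv : IsVelocityField p μ v) {φ : Sp d → ℝ}
    (hφ : ContDiff ℝ 1 φ) (hc : HasCompactSupport φ) :
    ∀ᵐ t ∂(volume.restrict (Icc (0 : ℝ) 1)), |∫ x, fderiv ℝ φ x (v t x) ∂(μ t)| ≤
      C * (∫ x, ‖fderiv ℝ φ x‖ ^ p' ∂(μ t)) ^ (1 / p') := by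
  have hC := h.pos
  obtain ⟨hint, heq⟩ := hv.continuity φ hφ hc
  have hd := hint.ae_hasDerivAt_integral
  rw [uIcc_of_le zero_le_one] at hd
  filter_upwards [ae_restrict_of_ae hd, ae_Icc_mem_Ioo] with t ht htI
  have htI' : t ∈ Icc (0 : ℝ) 1 := Ioo_subset_Icc_self htI
  have hder := ht htI' 0 (left_mem_Icc.2 zero_le_one)
  have hev : (fun s => ∫ x, φ x ∂(μ s) - ∫ x, φ x ∂(μ 0)) =ᶠ[𝓝 t]
      fun s => ∫ r in (0 : ℝ)..s, ∫ x, fderiv ℝ φ x (v r x) ∂(μ r) := by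
    filter_upwards [Ioo_mem_nhds htI.1 htI.2] with s hs
    exact heq 0 (left_mem_Icc.2 zero_le_one) s (Ioo_subset_Icc_self hs) hs.1
  have hder' := (hder.congr_of_eventuallyEq hev).add_const (∫ x, φ x ∂(μ 0))
  simp only [sub_add_cancel] at hder'
  refine le_of_forall_pos_le_add fun ε hε => ?_
  obtain ⟨K, hK, hmod⟩ := exists_first_order_bound hpp.pos hφ hc (div_pos hε hC)
  set A := (∫ x, ‖fderiv ℝ φ x‖ ^ p' ∂(μ t)) ^ (1 / p')
  have hslope := (hasDerivAt_iff_tendsto_slope.1 hder').abs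
  have hlim : Tendsto (fun s => C * (A + ε / C) + K * C ^ p * |s - t| ^ (p - 1)) (𝓝[≠] t)
      (𝓝 (C * A + ε)) := by
    have hcont : Continuous fun s => C * (A + ε / C) + K * C ^ p * |s - t| ^ (p - 1) :=
      continuous_const.add (continuous_const.mul (Continuous.rpow_const (by fun_prop)
        fun _ => Or.inr hpp.sub_one_pos.le))
    have := hcont.tendsto t
    simp only [sub_self, abs_zero, Real.zero_rpow hpp.sub_one_ne_zero, mul_zero, add_zero,
      mul_add, mul_div_cancel₀ ε hC.ne'] at this
    simp only [mul_add, mul_div_cancel₀ ε hC.ne']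
    exact this.mono_left nhdsWithin_le_nhds
  refine le_of_tendsto_of_tendsto hslope hlim ?_
  filter_upwards [self_mem_nhdsWithin, mem_nhdsWithin_of_mem_nhds (Ioo_mem_nhds htI.1 htI.2)]
    with s hst hs
  have hpos : 0 < |s - t| := abs_pos.2 (sub_ne_zero.2 hst)
  have hb := h.abs_integral_sub_le_fderiv hpp hφ hc (div_pos hε hC).le hK hmod
    (Ioo_subset_Icc_self hs) htI'
  have e : (C * |s - t|) ^ p = |s - t| * (C ^ p * |s - t| ^ (p - 1)) := by
    rw [Real.mul_rpow hC.le hpos.le, Real.rpow_sub_one hpos.ne']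
    field_simp
  rw [slope_def_field, abs_div, div_le_iff₀ hpos]
  refine hb.trans (le_of_eq ?_)
  rw [e]; ring

end Derivative

/-! ### Velocity fields as elements of L^p of the space-time measure. -/

section Slab

variable {p : ℝ}

theorem memLp_of_energy_lt_top (hp : 0 < p) {μ : ℝ → Measure (Sp d)} {v : ℝ → Sp d → Sp d}
    (hv : Measurable (Function.uncurry v)) {t : ℝ} (h : energy p μ v t < ⊤) :
    MemLp (v t) (ENNReal.ofReal p) (μ t) := by
  refine ⟨hv.of_uncurry_left.aestronglyMeasurable, ?_⟩
  rw [eLpNorm_lt_top_iff_lintegral_rpow_enorm_lt_top (by simpa using hp) (by simp),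
    ENNReal.toReal_ofReal hp.le]
  exact h

theorem integrable_fderiv_apply (hp : 1 ≤ p) {ν : Measure (Sp d)} [IsFiniteMeasure ν]
    {φ : Sp d → ℝ} (hφ : ContDiff ℝ 1 φ) (hc : HasCompactSupport φ) {w : Sp d → Sp d}
    (hw : MemLp w (ENNReal.ofReal p) ν) : Integrable (fun x => fderiv ℝ φ x (w x)) ν := by
  have hcont := hφ.continuous_fderiv one_ne_zero
  obtain ⟨B, hB⟩ := (hc.fderiv ℝ).exists_bound_of_continuous hcont
  have hi : Integrable w ν := hw.integrable (by simpa using hp)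
  refine Integrable.mono' (hi.norm.const_mul B) ?_ (Eventually.of_forall fun x => ?_)
  · exact (ContinuousLinearMap.id ℝ (Sp d →L[ℝ] ℝ)).aestronglyMeasurable_comp₂
      hcont.aestronglyMeasurable hi.1
  · exact ((fderiv ℝ φ x).le_opNorm _).trans (by gcongr; exact hB x)

theorem energy_add_smul_lt_top (hp : 1 ≤ p) {μ : ℝ → Measure (Sp d)} {v w : ℝ → Sp d → Sp d}
    (hv : Measurable (Function.uncurry v)) (hw : Measurable (Function.uncurry w)) {t : ℝ}
    (h : energy p μ v t < ⊤) (h' : energy p μ w t < ⊤) (ε : ℝ) :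
    energy p μ (fun s x => v s x + ε • w s x) t < ⊤ := by
  have hp0 : 0 < p := by linarith
  have := ((memLp_of_energy_lt_top hp0 hv h).add
    ((memLp_of_energy_lt_top hp0 hw h').const_smul ε)).2
  rwa [eLpNorm_lt_top_iff_lintegral_rpow_enorm_lt_top (by simpa using hp0) (by simp),
    ENNReal.toReal_ofReal hp0.le] at this

/-- Only the pairings with gradients enter the continuity equation. The exceptional set of times may
depend on `φ`, so fields obtained by duality qualify. -/
theorem IsVelocityField.of_ae_eq {μ : ℝ → Measure (Sp d)} {v w : ℝ → Sp d → Sp d}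
    (hv : IsVelocityField p μ v) (hw : Measurable (Function.uncurry w))
    (hfin : ∀ᵐ t ∂(volume.restrict (Icc (0 : ℝ) 1)), energy p μ w t < ⊤)
    (heq : ∀ φ : Sp d → ℝ, ContDiff ℝ 1 φ → HasCompactSupport φ →
      ∀ᵐ t ∂(volume.restrict (Icc (0 : ℝ) 1)),
        ∫ x, fderiv ℝ φ x (v t x) ∂(μ t) = ∫ x, fderiv ℝ φ x (w t x) ∂(μ t)) :
    IsVelocityField p μ w := by
  refine ⟨hw, hfin, fun φ hφ hc => ?_⟩
  obtain ⟨h1, h2⟩ := hv.continuity φ hφ hc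
  have hsub : uIoc (0 : ℝ) 1 ⊆ Icc 0 1 := by
    rw [uIoc_of_le zero_le_one]; exact Ioc_subset_Icc_self
  refine ⟨h1.congr_ae (ae_restrict_of_ae_restrict_of_subset hsub (heq φ hφ hc)),
    fun t₁ ht₁ t₂ ht₂ hlt => ?_⟩
  rw [h2 t₁ ht₁ t₂ ht₂ hlt]
  refine intervalIntegral.integral_congr_ae_restrict
    (ae_restrict_of_ae_restrict_of_subset ?_ (heq φ hφ hc))
  rw [uIoc_of_le hlt.le]
  exact Ioc_subset_Icc_self.trans (Icc_subset_Icc ht₁.1 ht₂.2)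

/-- Both pairings have the primitive t ↦ ∫ φ dμ_t - ∫ φ dμ_0, and are recovered from it by Lebesgue
differentiation. -/
theorem IsVelocityField.ae_integral_eq {μ : ℝ → Measure (Sp d)} {v w : ℝ → Sp d → Sp d}
    (hv : IsVelocityField p μ v) (hw : IsVelocityField p μ w) {φ : Sp d → ℝ}
    (hφ : ContDiff ℝ 1 φ) (hc : HasCompactSupport φ) :
    ∀ᵐ t ∂(volume.restrict (Icc (0 : ℝ) 1)),
      ∫ x, fderiv ℝ φ x (v t x) ∂(μ t) = ∫ x, fderiv ℝ φ x (w t x) ∂(μ t) := by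
  obtain ⟨h1, h2⟩ := hv.continuity φ hφ hc
  obtain ⟨k1, k2⟩ := hw.continuity φ hφ hc
  have hd := h1.ae_hasDerivAt_integral
  have kd := k1.ae_hasDerivAt_integral
  rw [uIcc_of_le zero_le_one] at hd kd
  filter_upwards [ae_restrict_of_ae hd, ae_restrict_of_ae kd, ae_Icc_mem_Ioo] with t ht kt htI
  have h0 : (0 : ℝ) ∈ Icc (0 : ℝ) 1 := left_mem_Icc.2 zero_le_one
  have hder := ht (Ioo_subset_Icc_self htI) 0 h0
  have kder := kt (Ioo_subset_Icc_self htI) 0 h0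
  refine hder.unique (kder.congr_of_eventuallyEq ?_)
  filter_upwards [Ioo_mem_nhds htI.1 htI.2] with s hs
  rw [← h2 0 h0 s (Ioo_subset_Icc_self hs) hs.1, ← k2 0 h0 s (Ioo_subset_Icc_self hs) hs.1]

/-- The measure `∫_T μ_t dt` on space-time. -/
noncomputable abbrev slab (κ : ProbabilityTheory.Kernel ℝ (Sp d)) (T : Set ℝ) :
    Measure (ℝ × Sp d) := Measure.compProd (volume.restrict T) κ

variable {κ : ProbabilityTheory.Kernel ℝ (Sp d)} [ProbabilityTheory.IsMarkovKernel κ]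

theorem measurable_energy {v : ℝ → Sp d → Sp d} (hv : Measurable (Function.uncurry v)) :
    Measurable (energy p κ v) :=
  (hv.enorm.pow_const p).lintegral_kernel_prod_right' (κ := κ)

theorem lintegral_slab_rpow {v : ℝ → Sp d → Sp d} (hv : Measurable (Function.uncurry v))
    (T : Set ℝ) : ∫⁻ z, ‖Function.uncurry v z‖ₑ ^ p ∂(slab κ T) = ∫⁻ t in T, energy p κ v t :=
  Measure.lintegral_compProd (hv.enorm.pow_const p)

theorem memLp_slab_iff (hp : 0 < p) {v : ℝ → Sp d → Sp d} (hv : Measurable (Function.uncurry v))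
    {T : Set ℝ} : MemLp (Function.uncurry v) (ENNReal.ofReal p) (slab κ T) ↔
      ∫⁻ t in T, energy p κ v t < ⊤ := by
  rw [← lintegral_slab_rpow hv, MemLp, and_iff_right hv.aestronglyMeasurable,
    eLpNorm_lt_top_iff_lintegral_rpow_enorm_lt_top (by simpa using hp) (by simp),
    ENNReal.toReal_ofReal hp.le]

theorem ofReal_integral_slab_rpow (hp : 0 < p) {v : ℝ → Sp d → Sp d}
    (hv : Measurable (Function.uncurry v)) {T : Set ℝ}
    (h : MemLp (Function.uncurry v) (ENNReal.ofReal p) (slab κ T)) :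
    ENNReal.ofReal (∫ z, ‖Function.uncurry v z‖ ^ p ∂(slab κ T)) = ∫⁻ t in T, energy p κ v t := by
  rw [← lintegral_slab_rpow hv, ofReal_integral_eq_lintegral_ofReal
    (integrable_norm_rpow_of_memLp hp h) (Eventually.of_forall fun z => by positivity)]
  refine lintegral_congr fun z => ?_
  rw [← ofReal_norm, ENNReal.ofReal_rpow_of_nonneg (norm_nonneg _) hp.le]

end Slab

/-! ### The duality map a ↦ |a|^(p-2) a between L^p and L^{p'}. -/

section DualMap

variable {E X : Type*} [NormedAddCommGroup E] [InnerProductSpace ℝ E] [MeasurableSpace X]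
  {M : Measure X}

theorem norm_duality_rpow {p p' : ℝ} (hpp : p.HolderConjugate p') (a : E) :
    ‖(‖a‖ ^ (p - 2)) • a‖ ^ p' = ‖a‖ ^ p := by
  rcases eq_or_ne a 0 with rfl | ha
  · simp [Real.zero_rpow hpp.ne_zero, Real.zero_rpow hpp.symm.ne_zero]
  · have h0 : 0 < ‖a‖ := norm_pos_iff.2 ha
    rw [norm_smul, Real.norm_of_nonneg (by positivity), ← Real.rpow_add_one h0.ne',
      ← Real.rpow_mul h0.le]
    rw [show (p - 2 + 1) * p' = (p - 1) * p' by ring, hpp.sub_one_mul_conj]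

theorem norm_rpow_sub_two_mul_sq {p : ℝ} (hp : 0 < p) (a : E) :
    ‖a‖ ^ (p - 2) * inner ℝ a a = ‖a‖ ^ p := by
  rcases eq_or_ne a 0 with rfl | ha
  · simp [Real.zero_rpow hp.ne']
  · have h0 : 0 < ‖a‖ := norm_pos_iff.2 ha
    rw [real_inner_self_eq_norm_sq, ← Real.rpow_natCast, ← Real.rpow_add h0]
    norm_num

theorem memLp_duality {p p' : ℝ} (hpp : p.HolderConjugate p') {f : X → E}
    (hf : MemLp f (ENNReal.ofReal p) M) :
    MemLp (fun x => (‖f x‖ ^ (p - 2)) • f x) (ENNReal.ofReal p') M := by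
  refine memLp_norm_rpow hpp.symm.pos ?_ ?_
  · exact (hf.1.norm.aemeasurable.pow_const (p - 2)).aestronglyMeasurable.smul hf.1
  · simp only [norm_duality_rpow hpp]
    exact integrable_norm_rpow_of_memLp hpp.pos hf

theorem isClosed_integral_inner_eq {p p' : ℝ} (hpp : p.HolderConjugate p')
    [Fact (1 ≤ ENNReal.ofReal p)] {w : X → E}
    (hw : MemLp w (ENNReal.ofReal p') M) (c : ℝ) :
    IsClosed {f : Lp E (ENNReal.ofReal p) M | ∫ x, inner ℝ (w x) (f x) ∂M = c} := by
  have : ENNReal.HolderConjugate (ENNReal.ofReal p') (ENNReal.ofReal p) := hpp.symm.ennrealOfReal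
  have : Fact (1 ≤ ENNReal.ofReal p') := ⟨by simpa using hpp.symm.lt.le⟩
  have h := ((innerSL ℝ (E := E)).lpPairing M (ENNReal.ofReal p') (ENNReal.ofReal p)
    (hw.toLp w)).continuous
  convert isClosed_singleton (x := c) |>.preimage h using 1
  ext f
  simp only [mem_preimage, mem_singleton_iff, ContinuousLinearMap.lpPairing_eq_integral]
  change (∫ x, inner ℝ (w x) (f x) ∂M = c) ↔ _
  rw [integral_congr_ae (g := fun x => innerSL ℝ ((hw.toLp w) x) (f x))]
  filter_upwards [hw.coeFn_toLp] with x hx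
  rw [hx]; rfl

theorem abs_integral_inner_le {p p' : ℝ} (hpp : p.HolderConjugate p') {f g : X → E}
    (hf : MemLp f (ENNReal.ofReal p) M) (hg : MemLp g (ENNReal.ofReal p') M) :
    Integrable (fun x => inner ℝ (f x) (g x)) M ∧ |∫ x, inner ℝ (f x) (g x) ∂M| ≤
      (∫ x, ‖f x‖ ^ p ∂M) ^ (1 / p) * (∫ x, ‖g x‖ ^ p' ∂M) ^ (1 / p') := by
  have : ENNReal.HolderConjugate (ENNReal.ofReal p) (ENNReal.ofReal p') := hpp.ennrealOfReal
  have hi : Integrable (fun x => ‖f x‖ * ‖g x‖) M := hf.norm.integrable_mul hg.norm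
  have hi' : Integrable (fun x => inner ℝ (f x) (g x)) M :=
    hi.mono' (hf.1.inner hg.1) (Eventually.of_forall fun x => norm_inner_le_norm _ _)
  refine ⟨hi', ?_⟩
  have h1 := integral_mul_norm_le_Lp_mul_Lq hpp hf hg
  refine (abs_integral_le_integral_abs.trans ?_).trans h1
  exact integral_mono hi'.abs hi fun x => abs_real_inner_le_norm _ _

end DualMap

/-! ### Gradients of test functions that are simple in time, and fields orthogonal to them. -/

section SimpleTest

/-- A test function `(t, x) ↦ c t x` that is simple in time and `C^1_c` in space. -/
def IsSimpleTest (c : SimpleFunc ℝ (Sp d → ℝ)) : Prop :=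
  ∀ t, ContDiff ℝ 1 (c t) ∧ HasCompactSupport (c t)

/-- The spatial gradient of a test function that is simple in time. -/
noncomputable def simpleGradient (c : SimpleFunc ℝ (Sp d → ℝ)) (z : ℝ × Sp d) : Sp d :=
  gradient (c z.1) z.2

theorem inner_simpleGradient (c : SimpleFunc ℝ (Sp d → ℝ)) (z : ℝ × Sp d) (a : Sp d) :
    inner ℝ (simpleGradient c z) a = fderiv ℝ (c z.1) z.2 a := inner_gradient_left

theorem norm_simpleGradient (c : SimpleFunc ℝ (Sp d → ℝ)) (z : ℝ × Sp d) :
    ‖simpleGradient c z‖ = ‖fderiv ℝ (c z.1) z.2‖ := by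
  rw [simpleGradient, gradient, LinearIsometryEquiv.norm_map]

theorem measurable_simpleGradient {c : SimpleFunc ℝ (Sp d → ℝ)} (hc : IsSimpleTest c) :
    Measurable (simpleGradient c) := by
  intro B hB
  have : simpleGradient c ⁻¹' B = ⋃ y ∈ c.range, (c ⁻¹' {y}) ×ˢ (gradient y ⁻¹' B) := by
    ext z
    simp only [simpleGradient, mem_preimage, mem_iUnion, mem_prod, mem_singleton_iff, exists_prop]
    exact ⟨fun h => ⟨c z.1, SimpleFunc.mem_range_self c _, rfl, h⟩, fun ⟨y, _, h, h'⟩ => by rwa [h]⟩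
  rw [this]
  refine Finset.measurableSet_biUnion _ fun y hy => (c.measurableSet_fiber y).prod ?_
  obtain ⟨t, rfl⟩ := SimpleFunc.mem_range.1 hy
  have hcont : Continuous (gradient (c t)) :=
    (InnerProductSpace.toDual ℝ (Sp d)).symm.continuous.comp
      ((hc t).1.continuous_fderiv one_ne_zero)
  exact hcont.measurable hB

theorem exists_norm_simpleGradient_le {c : SimpleFunc ℝ (Sp d → ℝ)} (hc : IsSimpleTest c) :
    ∃ B, ∀ z, ‖simpleGradient c z‖ ≤ B := by
  have h : ∀ y ∈ c.range, ∀ᶠ B : ℝ in atTop, ∀ x, ‖fderiv ℝ y x‖ ≤ B := by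
    intro y hy
    obtain ⟨t, rfl⟩ := SimpleFunc.mem_range.1 hy
    obtain ⟨B, hB⟩ := ((hc t).2.fderiv ℝ).exists_bound_of_continuous
      ((hc t).1.continuous_fderiv one_ne_zero)
    filter_upwards [eventually_ge_atTop B] with B' hB' x using (hB x).trans hB'
  obtain ⟨B, hB⟩ := ((Filter.eventually_all_finset c.range).2 h).exists
  exact ⟨B, fun z => by
    rw [norm_simpleGradient]; exact hB _ (SimpleFunc.mem_range_self c z.1) z.2⟩

/-- The linear combination `a c + b c'`. -/
noncomputable def simpleComb (a b : ℝ) (c c' : SimpleFunc ℝ (Sp d → ℝ)) :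
    SimpleFunc ℝ (Sp d → ℝ) := (c.pair c').map fun y => fun x => a * y.1 x + b * y.2 x

theorem IsSimpleTest.comb {c c' : SimpleFunc ℝ (Sp d → ℝ)} (hc : IsSimpleTest c)
    (hc' : IsSimpleTest c') (a b : ℝ) : IsSimpleTest (simpleComb a b c c') := fun t =>
  ⟨(contDiff_const.mul (hc t).1).add (contDiff_const.mul (hc' t).1),
    ((hc t).2.mul_left (f := fun _ => a)).add ((hc' t).2.mul_left (f := fun _ => b))⟩

theorem simpleGradient_comb {c c' : SimpleFunc ℝ (Sp d → ℝ)} (hc : IsSimpleTest c)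
    (hc' : IsSimpleTest c') (a b : ℝ) (z : ℝ × Sp d) :
    simpleGradient (simpleComb a b c c') z = a • simpleGradient c z + b • simpleGradient c' z := by
  refine ext_inner_right ℝ fun y => ?_
  have h1 := ((hc z.1).1.differentiable one_ne_zero z.2).hasFDerivAt.const_mul a
  have h2 := ((hc' z.1).1.differentiable one_ne_zero z.2).hasFDerivAt.const_mul b
  have h3 : fderiv ℝ (simpleComb a b c c' z.1) z.2 =
      a • fderiv ℝ (c z.1) z.2 + b • fderiv ℝ (c' z.1) z.2 := (h1.add h2).fderiv
  rw [inner_simpleGradient, inner_add_left, real_inner_smul_left, real_inner_smul_left,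
    inner_simpleGradient, inner_simpleGradient, h3]
  rfl

variable {p p' C : ℝ} {κ : ProbabilityTheory.Kernel ℝ (Sp d)}
  [ProbabilityTheory.IsMarkovKernel κ] {T : Set ℝ} {v : ℝ → Sp d → Sp d}

theorem isFiniteMeasure_restrict_of_subset_Icc (hT : T ⊆ Icc (0 : ℝ) 1) :
    IsFiniteMeasure (volume.restrict T : Measure ℝ) :=
  ⟨by rw [Measure.restrict_apply_univ]; exact (measure_mono hT).trans_lt (by simp)⟩

theorem integrable_integral_compProd {m : Measure ℝ} [SFinite m] {f : ℝ × Sp d → ℝ}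
    (hf : Integrable f (Measure.compProd m κ)) : Integrable (fun t => ∫ x, f (t, x) ∂(κ t)) m := by
  have h := (Measure.integrable_compProd_iff hf.1).1 hf
  refine h.2.mono' ?_ (Eventually.of_forall fun t => norm_integral_le_integral_norm _)
  refine ⟨fun t => ∫ x, hf.1.mk f (t, x) ∂(κ t),
    hf.1.stronglyMeasurable_mk.integral_kernel_prod_right', ?_⟩
  filter_upwards [Measure.ae_ae_of_ae_compProd hf.1.ae_eq_mk] with t ht
  exact integral_congr_ae ht

theorem memLp_simpleGradient (hT : T ⊆ Icc (0 : ℝ) 1) {c : SimpleFunc ℝ (Sp d → ℝ)}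
    (hc : IsSimpleTest c) {r : ℝ≥0∞} : MemLp (simpleGradient c) r (slab κ T) := by
  have := isFiniteMeasure_restrict_of_subset_Icc hT
  obtain ⟨B, hB⟩ := exists_norm_simpleGradient_le hc
  exact MemLp.of_bound (measurable_simpleGradient hc).aestronglyMeasurable B
    (Eventually.of_forall hB)

/-- Since `c` takes finitely many values, the exceptional null sets of the fixed-time estimate have
a null union; this is the reason for test functions that are simple in time. Hölder's inequality in
time then produces the factor |T|^(1/p). -/
theorem IsVelocityField.abs_integral_simpleGradient_le (hpp : p.HolderConjugate p')
    (h : IsCoupled p C κ) (hv : IsVelocityField p κ v) (hT : T ⊆ Icc (0 : ℝ) 1)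
    (hvT : MemLp (Function.uncurry v) (ENNReal.ofReal p) (slab κ T))
    {c : SimpleFunc ℝ (Sp d → ℝ)} (hc : IsSimpleTest c) :
    |∫ z, inner ℝ (simpleGradient c z) (Function.uncurry v z) ∂(slab κ T)| ≤
      C * (volume.real T ^ (1 / p) *
        (∫ z, ‖simpleGradient c z‖ ^ p' ∂(slab κ T)) ^ (1 / p')) := by
  have := isFiniteMeasure_restrict_of_subset_Icc hT
  have hC := h.pos
  have hp' := hpp.symm.pos
  have hg : MemLp (simpleGradient c) (ENNReal.ofReal p') (slab κ T) := memLp_simpleGradient hT hc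
  have hgi := integrable_norm_rpow_of_memLp hp' hg
  obtain ⟨B, hB⟩ := exists_norm_simpleGradient_le hc
  have hB0 : 0 ≤ B := (norm_nonneg _).trans (hB 0)
  set A : ℝ → ℝ := fun t => ∫ x, ‖simpleGradient c (t, x)‖ ^ p' ∂(κ t)
  have hA0 : ∀ t, 0 ≤ A t := fun t => integral_nonneg fun x => by positivity
  have hAm : StronglyMeasurable A :=
    ((measurable_simpleGradient hc).norm.pow_const p').stronglyMeasurable.integral_kernel_prod_right'
  have hAB : ∀ t, A t ≤ B ^ p' := fun t => by
    have : A t ≤ ∫ _, B ^ p' ∂(κ t) := by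
      refine integral_mono_of_nonneg (Eventually.of_forall fun x => by positivity)
        (integrable_const _) (Eventually.of_forall fun x => ?_)
      exact Real.rpow_le_rpow (norm_nonneg _) (hB _) hp'.le
    simpa using this
  have hAL : MemLp (fun t => A t ^ (1 / p')) (ENNReal.ofReal p') (volume.restrict T) := by
    refine MemLp.of_bound (hAm.measurable.pow_const _).aestronglyMeasurable ((B ^ p') ^ (1 / p'))
      (Eventually.of_forall fun t => ?_)
    rw [Real.norm_of_nonneg (Real.rpow_nonneg (hA0 t) _)]
    exact Real.rpow_le_rpow (hA0 t) (hAB t) (by positivity)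
  have hi := (abs_integral_inner_le hpp.symm hg hvT).1
  rw [Measure.integral_compProd hi, Measure.integral_compProd hgi]
  have hall : ∀ᵐ t ∂(volume.restrict T),
      |∫ x, inner ℝ (simpleGradient c (t, x)) (Function.uncurry v (t, x)) ∂(κ t)| ≤
        C * A t ^ (1 / p') := by
    have h1 : ∀ y ∈ c.range, ∀ᵐ t ∂(volume.restrict T), |∫ x, fderiv ℝ y x (v t x) ∂(κ t)| ≤
        C * (∫ x, ‖fderiv ℝ y x‖ ^ p' ∂(κ t)) ^ (1 / p') := by
      intro y hy
      obtain ⟨t, rfl⟩ := SimpleFunc.mem_range.1 hy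
      exact ae_restrict_of_ae_restrict_of_subset hT
        (hv.ae_abs_integral_fderiv_le hpp h (hc t).1 (hc t).2)
    filter_upwards [(Filter.eventually_all_finset c.range).2 h1] with t ht
    have := ht (c t) (SimpleFunc.mem_range_self c t)
    simpa only [A, inner_simpleGradient, norm_simpleGradient, Function.uncurry_apply_pair] using this
  have hi1 : Integrable (fun t => C * A t ^ (1 / p')) (volume.restrict T) :=
    (hAL.integrable (by simpa using hpp.symm.lt.le)).const_mul C
  have hH := integral_mul_le_Lp_mul_Lq_of_nonneg hpp (μ := volume.restrict T)
    (f := fun _ => (1 : ℝ)) (g := fun t => A t ^ (1 / p')) (Eventually.of_forall fun _ => zero_le_one)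
    (Eventually.of_forall fun t => Real.rpow_nonneg (hA0 t) _) (memLp_const 1) hAL
  have e1 : ∀ t, (A t ^ (1 / p')) ^ p' = A t := fun t => by
    rw [← Real.rpow_mul (hA0 t), one_div_mul_cancel hp'.ne', Real.rpow_one]
  simp only [e1, one_mul, Real.one_rpow, integral_const, smul_eq_mul, mul_one,
    measureReal_restrict_apply_univ] at hH
  calc _ ≤ ∫ t in T, |∫ x, inner ℝ (simpleGradient c (t, x)) (Function.uncurry v (t, x)) ∂(κ t)| :=
        abs_integral_le_integral_abs
    _ ≤ ∫ t in T, C * A t ^ (1 / p') := integral_mono_of_nonneg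
        (Eventually.of_forall fun _ => abs_nonneg _) hi1 hall
    _ = C * ∫ t in T, A t ^ (1 / p') := integral_const_mul _ _
    _ ≤ _ := by gcongr

/-- Testing with `φ` multiplied by the indicator of an arbitrary measurable set of times localises
the orthogonality. -/
theorem ae_integral_inner_gradient_eq_zero (hpp : p.HolderConjugate p') (hT : T ⊆ Icc (0 : ℝ) 1)
    {w : ℝ → Sp d → Sp d}
    (hwT : MemLp (Function.uncurry w) (ENNReal.ofReal p) (slab κ T))
    (horth : ∀ c : SimpleFunc ℝ (Sp d → ℝ), IsSimpleTest c →
      ∫ z, inner ℝ (Function.uncurry w z) (simpleGradient c z) ∂(slab κ T) = 0)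
    {φ : Sp d → ℝ} (hφ : ContDiff ℝ 1 φ) (hc : HasCompactSupport φ) :
    ∀ᵐ t ∂(volume.restrict T), ∫ x, fderiv ℝ φ x (w t x) ∂(κ t) = 0 := by
  have := isFiniteMeasure_restrict_of_subset_Icc hT
  have htest : ∀ s (hs : MeasurableSet s),
      IsSimpleTest (SimpleFunc.piecewise s hs (SimpleFunc.const ℝ φ) (SimpleFunc.const ℝ 0)) := by
    intro s hs t
    by_cases ht : t ∈ s
    · simpa [ht] using ⟨hφ, hc⟩
    · simpa [ht] using ⟨contDiff_const, HasCompactSupport.zero⟩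
  have hgrad : ∀ s (hs : MeasurableSet s) t, ∫ x, inner ℝ (w t x) (simpleGradient
      (SimpleFunc.piecewise s hs (SimpleFunc.const ℝ φ) (SimpleFunc.const ℝ 0)) (t, x)) ∂(κ t) =
      s.indicator (fun t => ∫ x, fderiv ℝ φ x (w t x) ∂(κ t)) t := by
    intro s hs t
    simp only [real_inner_comm (simpleGradient _ _), inner_simpleGradient]
    by_cases ht : t ∈ s <;> simp [ht]
  have hint : ∀ s (hs : MeasurableSet s), Integrable (fun t => s.indicator
      (fun t => ∫ x, fderiv ℝ φ x (w t x) ∂(κ t)) t) (volume.restrict T) ∧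
      ∫ t in T, s.indicator (fun t => ∫ x, fderiv ℝ φ x (w t x) ∂(κ t)) t = 0 := by
    intro s hs
    have hi := (abs_integral_inner_le hpp hwT (memLp_simpleGradient hT (htest s hs))).1
    constructor
    · have := integrable_integral_compProd hi
      refine this.congr (Eventually.of_forall fun t => ?_)
      exact hgrad s hs t
    · rw [← horth _ (htest s hs), Measure.integral_compProd hi]
      exact integral_congr_ae (Eventually.of_forall fun t => (hgrad s hs t).symm)
  have hi : Integrable (fun t => ∫ x, fderiv ℝ φ x (w t x) ∂(κ t)) (volume.restrict T) := by
    simpa using (hint univ MeasurableSet.univ).1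
  refine hi.ae_eq_zero_of_forall_setIntegral_eq_zero fun s hs _ => ?_
  rw [← integral_indicator hs]
  exact (hint s hs).2

/-- A field orthogonal to gradients can be added to v without changing the continuity equation.
Minimality of v at almost every time makes its norm over the slab minimal along v + εw, and the
claim is the resulting Euler-Lagrange equation. -/
theorem IsTangentField.integral_duality_inner_eq_zero (hpp : p.HolderConjugate p')
    (hv : IsTangentField p κ v) (hT : T ⊆ Icc (0 : ℝ) 1) (hTm : MeasurableSet T)
    (hvT : MemLp (Function.uncurry v) (ENNReal.ofReal p) (slab κ T))
    {w : ℝ → Sp d → Sp d} (hw : Measurable (Function.uncurry w))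
    (hwT : MemLp (Function.uncurry w) (ENNReal.ofReal p) (slab κ T))
    (horth : ∀ c : SimpleFunc ℝ (Sp d → ℝ), IsSimpleTest c →
      ∫ z, inner ℝ (Function.uncurry w z) (simpleGradient c z) ∂(slab κ T) = 0) :
    ∫ z, ‖Function.uncurry v z‖ ^ (p - 2) *
      inner ℝ (Function.uncurry v z) (Function.uncurry w z) ∂(slab κ T) = 0 := by
  classical
  have hp := hpp.lt
  have hp0 := hpp.pos
  have hvm := hv.velocity.measurable
  refine integral_norm_rpow_inner_eq_zero hp hvT hwT fun ε => ?_
  -- The integrability and the orthogonality of `w` are known only for times in `T`, whereas a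
  -- velocity field is needed on all of [0,1].
  set w' : ℝ → Sp d → Sp d := fun t x => if t ∈ T then w t x else 0
  have hw' : Measurable (Function.uncurry w') :=
    Measurable.ite (measurable_fst hTm) hw measurable_const
  have hw'T : ∀ t ∈ T, energy p κ w' t = energy p κ w t := fun t ht => by
    simp [energy, w', ht]
  have hwfin : ∀ᵐ t ∂(volume.restrict T), energy p κ w t < ⊤ :=
    ae_lt_top (measurable_energy hw) ((memLp_slab_iff hp0 hw).1 hwT).ne
  have hw'fin : ∀ᵐ t ∂(volume.restrict (Icc (0 : ℝ) 1)), energy p κ w' t < ⊤ := by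
    refine ae_restrict_of_ae ?_
    filter_upwards [(ae_restrict_iff' hTm).1 hwfin] with t ht
    by_cases htT : t ∈ T
    · rw [hw'T t htT]; exact ht htT
    · simp [energy, w', htT, hp0]
  have hvel : IsVelocityField p κ fun t x => v t x + ε • w' t x := by
    refine hv.velocity.of_ae_eq (hvm.add (hw'.const_smul ε)) ?_ fun φ hφ hc => ?_
    · filter_upwards [hv.velocity.finite, hw'fin] with t h1 h2
      exact energy_add_smul_lt_top hp.le hvm hw' h1 h2 ε
    · have h0 := (ae_restrict_iff' hTm).1
        (ae_integral_inner_gradient_eq_zero hpp hT hwT horth hφ hc)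
      filter_upwards [hv.velocity.finite, hw'fin, ae_restrict_of_ae h0] with t h1 h2 h3
      have i1 := integrable_fderiv_apply hp.le hφ hc (memLp_of_energy_lt_top hp0 hvm h1)
      have i2 := integrable_fderiv_apply hp.le hφ hc (memLp_of_energy_lt_top hp0 hw' h2)
      simp only [map_add, map_smul, smul_eq_mul]
      rw [integral_add i1 (i2.const_mul ε), integral_const_mul]
      by_cases htT : t ∈ T
      · simp only [w', htT, if_true, h3 htT, mul_zero, add_zero]
      · simp [w', htT]
  have hle : ∫⁻ t in T, energy p κ v t ≤ ∫⁻ t in T, energy p κ (fun t x => v t x + ε • w t x) t := by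
    refine lintegral_mono_ae ?_
    filter_upwards [ae_restrict_of_ae_restrict_of_subset hT (hv.minimal _ hvel),
      ae_restrict_mem hTm] with t h1 h2
    refine h1.trans_eq ?_
    simp [energy, w', h2]
  have hsum : MemLp (Function.uncurry fun t x => v t x + ε • w t x) (ENNReal.ofReal p) (slab κ T) :=
    hvT.add (hwT.const_smul ε)
  rw [← ofReal_integral_slab_rpow hp0 hvm hvT,
    ← ofReal_integral_slab_rpow hp0 (hvm.add (hw.const_smul ε)) hsum] at hle
  exact (ENNReal.ofReal_le_ofReal_iff (integral_nonneg fun z => by positivity)).1 hle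

end SimpleTest

/-! ### The energy of the tangent field is essentially bounded. -/

section EnergyBound

variable {p p' C : ℝ} {κ : ProbabilityTheory.Kernel ℝ (Sp d)}
  [ProbabilityTheory.IsMarkovKernel κ] {T : Set ℝ} {v : ℝ → Sp d → Sp d}

/-- The dual of the tangent field is a limit of gradients. -/
theorem IsTangentField.exists_simpleGradient_approx (hpp : p.HolderConjugate p')
    (hv : IsTangentField p κ v) (hT : T ⊆ Icc (0 : ℝ) 1) (hTm : MeasurableSet T)
    (hvT : MemLp (Function.uncurry v) (ENNReal.ofReal p) (slab κ T)) {δ : ℝ} (hδ : 0 < δ) :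
    ∃ c : SimpleFunc ℝ (Sp d → ℝ), IsSimpleTest c ∧
      (∫ z, ‖(‖Function.uncurry v z‖ ^ (p - 2)) • Function.uncurry v z + simpleGradient c z‖ ^ p'
        ∂(slab κ T)) ^ (1 / p') < δ := by
  have : Fact (1 ≤ ENNReal.ofReal p') := ⟨by simpa using hpp.symm.lt.le⟩
  have hp' := hpp.symm.pos
  set j : ℝ × Sp d → Sp d := fun z => (‖Function.uncurry v z‖ ^ (p - 2)) • Function.uncurry v z
  have hj : MemLp j (ENNReal.ofReal p') (slab κ T) := memLp_duality hpp hvT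
  -- The translates of `j` by gradients. The claim is that 0 belongs to the closure; it is shown
  -- that the element `h` of least norm there vanishes.
  set A : Set (Lp (Sp d) (ENNReal.ofReal p') (slab κ T)) :=
    {f | ∃ c, IsSimpleTest c ∧ f =ᵐ[slab κ T] fun z => j z + simpleGradient c z}
  have hz : IsSimpleTest (SimpleFunc.const ℝ (0 : Sp d → ℝ)) := fun t =>
    ⟨contDiff_const, HasCompactSupport.zero⟩
  have hG : ∀ c, IsSimpleTest c → MemLp (simpleGradient c) (ENNReal.ofReal p') (slab κ T) :=
    fun c hc => memLp_simpleGradient hT hc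
  have hAne : A.Nonempty := by
    have hm := hj.add (hG _ hz)
    exact ⟨hm.toLp, _, hz, hm.coeFn_toLp⟩
  have hAconv : Convex ℝ A := by
    rintro f ⟨c, hc, hf⟩ g ⟨c', hc', hg⟩ a b - - hab
    refine ⟨simpleComb a b c c', hc.comb hc' a b, ?_⟩
    filter_upwards [hf, hg, Lp.coeFn_add (a • f) (b • g), Lp.coeFn_smul a f, Lp.coeFn_smul b g]
      with z h1 h2 h3 h4 h5
    have e : a • j z + b • j z = j z := by rw [← add_smul, hab, one_smul]
    rw [h3, Pi.add_apply, h4, h5, Pi.smul_apply, Pi.smul_apply, h1, h2,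
      simpleGradient_comb hc hc', smul_add, smul_add, add_add_add_comm, e]
  obtain ⟨h, hh, hmin⟩ := exists_norm_le_of_convex hpp.symm.lt isClosed_closure hAconv.closure
    hAne.closure
  set w : ℝ → Sp d → Sp d := fun t x => (‖h (t, x)‖ ^ (p' - 2)) • h (t, x)
  have hhm : Measurable h := (Lp.stronglyMeasurable h).measurable
  have hw : Measurable (Function.uncurry w) := (hhm.norm.pow_const _).smul hhm
  have hwT : MemLp (Function.uncurry w) (ENNReal.ofReal p) (slab κ T) :=
    memLp_duality hpp.symm (Lp.memLp h)
  -- The closure of `A` is invariant under adding gradients, so the Euler-Lagrange equation of `h`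
  -- says that its dual `w` is orthogonal to them.
  have horth : ∀ c, IsSimpleTest c →
      ∫ z, inner ℝ (Function.uncurry w z) (simpleGradient c z) ∂(slab κ T) = 0 := by
    intro c hc
    have := integral_norm_rpow_inner_eq_zero hpp.symm.lt (Lp.memLp h) (hG c hc) fun ε => by
      have hmem : h + ε • (hG c hc).toLp ∈ closure A := by
        refine map_mem_closure (f := fun f => f + ε • (hG c hc).toLp) (by fun_prop) hh ?_
        rintro f ⟨c', hc', hf⟩
        refine ⟨simpleComb 1 ε c' c, hc'.comb hc 1 ε, ?_⟩
        filter_upwards [hf, Lp.coeFn_add f (ε • (hG c hc).toLp), Lp.coeFn_smul ε (hG c hc).toLp,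
          (hG c hc).coeFn_toLp] with z h1 h2 h3 h4
        rw [h2, Pi.add_apply, h3, Pi.smul_apply, h4, h1, simpleGradient_comb hc' hc, one_smul,
          add_assoc]
      have hle := Real.rpow_le_rpow (norm_nonneg _) (hmin _ hmem) hp'.le
      rw [norm_Lp_rpow hp', norm_Lp_rpow hp'] at hle
      refine hle.trans_eq (integral_congr_ae ?_)
      filter_upwards [Lp.coeFn_add h (ε • (hG c hc).toLp), Lp.coeFn_smul ε (hG c hc).toLp,
          (hG c hc).coeFn_toLp] with z h2 h3 h4
      rw [h2, Pi.add_apply, h3, Pi.smul_apply, h4]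
    rw [← this]
    refine integral_congr_ae (Eventually.of_forall fun z => ?_)
    exact real_inner_smul_left _ _ _
  -- Here the minimality of `v` enters: fields orthogonal to gradients are orthogonal to its dual
  -- `j`.
  have hwj : ∫ z, inner ℝ (Function.uncurry w z) (j z) ∂(slab κ T) = 0 := by
    rw [← hv.integral_duality_inner_eq_zero hpp hT hTm hvT hw hwT horth]
    refine integral_congr_ae (Eventually.of_forall fun z => ?_)
    simp only [j]
    rw [real_inner_smul_right, real_inner_comm]
  -- Now `w` annihilates `A`, by continuity also its closure, and therefore `h`; but the pairing of
  -- `w` with `h` is ∫ |h|^{p'}.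
  have hclosed := isClosed_integral_inner_eq hpp.symm hwT 0
  have hsub : closure A ⊆ _ := hclosed.closure_subset_iff.2 (by
    rintro f ⟨c, hc, hf⟩
    change ∫ z, inner ℝ (Function.uncurry w z) (f z) ∂(slab κ T) = 0
    rw [integral_congr_ae (g := fun z => inner ℝ (Function.uncurry w z) (j z) +
      inner ℝ (Function.uncurry w z) (simpleGradient c z)) (by
        filter_upwards [hf] with z hz
        rw [hz, inner_add_right])]
    rw [integral_add (abs_integral_inner_le hpp hwT hj).1
      (abs_integral_inner_le hpp hwT (hG c hc)).1, hwj, horth c hc, add_zero])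
  have hwh : ∫ z, inner ℝ (Function.uncurry w z) (h z) ∂(slab κ T) = 0 := hsub hh
  have hzero : h = 0 := by
    have : ‖h‖ ^ p' = 0 := by
      rw [norm_Lp_rpow hp', ← hwh]
      refine integral_congr_ae (Eventually.of_forall fun z => ?_)
      change _ = inner ℝ ((‖h z‖ ^ (p' - 2)) • h z) (h z)
      rw [real_inner_smul_left, norm_rpow_sub_two_mul_sq hp']
    exact norm_eq_zero.1 ((Real.rpow_eq_zero (norm_nonneg _) hp'.ne').1 this)
  rw [hzero] at hh
  obtain ⟨f, ⟨c, hc, hf⟩, hfδ⟩ := Metric.mem_closure_iff.1 hh δ hδ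
  refine ⟨c, hc, ?_⟩
  rw [dist_zero_left] at hfδ
  have e : ∫ z, ‖j z + simpleGradient c z‖ ^ p' ∂(slab κ T) = ‖f‖ ^ p' := by
    rw [norm_Lp_rpow hp']
    refine integral_congr_ae ?_
    filter_upwards [hf] with z hz
    rw [hz]
  rw [e, ← Real.rpow_mul (norm_nonneg _), mul_one_div_cancel hp'.ne', Real.rpow_one]
  exact hfδ

theorem integral_norm_add_rpow_le {X : Type*} [MeasurableSpace X] {M : Measure X} {r : ℝ}
    (hr : 1 ≤ r) {f g : X → Sp d} (hf : MemLp f (ENNReal.ofReal r) M)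
    (hg : MemLp g (ENNReal.ofReal r) M) :
    (∫ x, ‖f x + g x‖ ^ r ∂M) ^ (1 / r) ≤
      (∫ x, ‖f x‖ ^ r ∂M) ^ (1 / r) + (∫ x, ‖g x‖ ^ r ∂M) ^ (1 / r) := by
  have hr0 : 0 < r := by linarith
  have : Fact (1 ≤ ENNReal.ofReal r) := ⟨by simpa using hr⟩
  have key : ∀ {F : X → Sp d} (hF : MemLp F (ENNReal.ofReal r) M),
      (∫ x, ‖F x‖ ^ r ∂M) ^ (1 / r) = ‖hF.toLp‖ := by
    intro F hF
    have e : ∫ x, ‖F x‖ ^ r ∂M = ‖hF.toLp‖ ^ r := by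
      rw [norm_Lp_rpow hr0]
      refine integral_congr_ae ?_
      filter_upwards [hF.coeFn_toLp] with x hx
      rw [hx]
    rw [e, ← Real.rpow_mul (norm_nonneg _), mul_one_div_cancel hr0.ne', Real.rpow_one]
  rw [key hf, key hg]
  refine (key (hf.add hg)).le.trans ?_
  rw [MemLp.toLp_add]
  exact norm_add_le _ _

/-- The kinetic energy of the tangent field is controlled by the Lipschitz constant. -/
theorem IsTangentField.setIntegral_rpow_le (hpp : p.HolderConjugate p') (h : IsCoupled p C κ)
    (hv : IsTangentField p κ v) (hT : T ⊆ Icc (0 : ℝ) 1) (hTm : MeasurableSet T)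
    (hvT : MemLp (Function.uncurry v) (ENNReal.ofReal p) (slab κ T)) :
    ∫ z, ‖Function.uncurry v z‖ ^ p ∂(slab κ T) ≤ C ^ p * volume.real T := by
  have hp := hpp.pos
  have hp' := hpp.symm.pos
  have hC := h.pos
  have hj : MemLp (fun z => (‖Function.uncurry v z‖ ^ (p - 2)) • Function.uncurry v z)
    (ENNReal.ofReal p') (slab κ T) := memLp_duality hpp hvT
  set I := ∫ z, ‖Function.uncurry v z‖ ^ p ∂(slab κ T)
  have hI : 0 ≤ I := integral_nonneg fun z => by positivity
  have hIj : ∫ z, ‖(‖Function.uncurry v z‖ ^ (p - 2)) • Function.uncurry v z‖ ^ p' ∂(slab κ T) = I := by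
    simp only [norm_duality_rpow hpp]; rfl
  set b := C * volume.real T ^ (1 / p)
  have hb : 0 ≤ b := by positivity
  -- Write |v|^p as the pairing of v with j(v) + ∇c minus its pairing with ∇c, where j(v) =
  -- |v|^(p-2) v. The former has a factor of norm below δ, the latter is controlled by the Lipschitz
  -- constant, and ∇c has norm at most δ plus that of j(v).
  have hmain : ∀ δ > 0, I ≤ b * I ^ (1 / p') + δ * (I ^ (1 / p) + b) := by
    intro δ hδ
    obtain ⟨c, hc, hcδ⟩ := hv.exists_simpleGradient_approx hpp hT hTm hvT hδ
    have hG : MemLp (simpleGradient c) (ENNReal.ofReal p') (slab κ T) := memLp_simpleGradient hT hc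
    have hsum := hj.add hG
    have h1 := abs_integral_inner_le hpp.symm hsum hvT
    have h2 := hv.velocity.abs_integral_simpleGradient_le hpp h hT hvT hc
    have h3 : (∫ z, ‖simpleGradient c z‖ ^ p' ∂(slab κ T)) ^ (1 / p') ≤ δ + I ^ (1 / p') := by
      have := integral_norm_add_rpow_le hpp.symm.lt.le hsum hj.neg
      simp only [Pi.add_apply, Pi.neg_apply, norm_neg, add_neg_cancel_comm, hIj] at this
      linarith
    have h4 : I = ∫ z, inner ℝ (((fun z => (‖Function.uncurry v z‖ ^ (p - 2)) •
        Function.uncurry v z) + simpleGradient c) z) (Function.uncurry v z) ∂(slab κ T) -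
        ∫ z, inner ℝ (simpleGradient c z) (Function.uncurry v z) ∂(slab κ T) := by
      rw [← integral_sub h1.1 (abs_integral_inner_le hpp.symm hG hvT).1]
      refine integral_congr_ae (Eventually.of_forall fun z => ?_)
      simp only [Pi.add_apply, inner_add_left, add_sub_cancel_right]
      rw [real_inner_smul_left, norm_rpow_sub_two_mul_sq hp]
    have h5 := (abs_le.1 h2).1
    have h6 := (abs_le.1 h1.2).2
    have h7 : (∫ z, ‖((fun z => (‖Function.uncurry v z‖ ^ (p - 2)) • Function.uncurry v z) +
        simpleGradient c) z‖ ^ p' ∂(slab κ T)) ^ (1 / p') * I ^ (1 / p) ≤ δ * I ^ (1 / p) :=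
      mul_le_mul_of_nonneg_right hcδ.le (by positivity)
    have h8 : C * (volume.real T ^ (1 / p) * (∫ z, ‖simpleGradient c z‖ ^ p' ∂(slab κ T)) ^ (1 / p'))
        ≤ b * (δ + I ^ (1 / p')) := by
      rw [← mul_assoc]; exact mul_le_mul_of_nonneg_left h3 hb
    nlinarith
  have hlim : I ≤ b * I ^ (1 / p') := by
    have ht : Tendsto (fun δ => b * I ^ (1 / p') + δ * (I ^ (1 / p) + b)) (𝓝[>] 0)
        (𝓝 (b * I ^ (1 / p'))) := by
      have : Continuous fun δ : ℝ => b * I ^ (1 / p') + δ * (I ^ (1 / p) + b) := by fun_prop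
      have := this.tendsto 0
      simp only [zero_mul, add_zero] at this
      exact this.mono_left nhdsWithin_le_nhds
    exact ge_of_tendsto ht (by filter_upwards [self_mem_nhdsWithin] with δ hδ using hmain δ hδ)
  rcases hI.eq_or_lt with h0 | h0
  · rw [← h0]; positivity
  · have e : I ^ (1 / p) * I ^ (1 / p') = I := by
      rw [← Real.rpow_add h0, one_div, one_div, hpp.inv_add_inv_eq_one, Real.rpow_one]
    have h1 : I ^ (1 / p) ≤ b := by
      have hpos : 0 < I ^ (1 / p') := by positivity
      refine le_of_mul_le_mul_right ?_ hpos
      rw [e]; exact hlim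
    have h2 := Real.rpow_le_rpow (by positivity) h1 hp.le
    rw [← Real.rpow_mul hI, one_div_mul_cancel hp.ne', Real.rpow_one,
      Real.mul_rpow hC.le (by positivity), ← Real.rpow_mul measureReal_nonneg,
      one_div_mul_cancel hp.ne', Real.rpow_one] at h2
    exact h2

/-- On the set of times where the energy exceeds C^p, the integrated bound forces measure zero. That
bound presupposes integrability of |v|^p over the slab, so the set is cut at energy at most N, and N
runs through the integers. -/
theorem IsTangentField.ae_energy_le (hp : 1 < p) (h : IsCoupled p C κ)
    (hv : IsTangentField p κ v) :
    ∀ᵐ t ∂(volume.restrict (Icc (0 : ℝ) 1)), energy p κ v t ≤ ENNReal.ofReal (C ^ p) := by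
  have hpp := Real.HolderConjugate.conjExponent hp
  have hm := measurable_energy (κ := κ) (p := p) hv.velocity.measurable
  have hnull : ∀ N : ℕ, ∀ᵐ t ∂(volume.restrict (Icc (0 : ℝ) 1)),
      ¬ (ENNReal.ofReal (C ^ p) < energy p κ v t ∧ energy p κ v t ≤ N) := by
    intro N
    set T := Icc (0 : ℝ) 1 ∩ {t | ENNReal.ofReal (C ^ p) < energy p κ v t ∧ energy p κ v t ≤ N}
    have hTm : MeasurableSet T := measurableSet_Icc.inter
      ((measurableSet_lt measurable_const hm).inter (measurableSet_le hm measurable_const))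
    have hT : T ⊆ Icc 0 1 := inter_subset_left
    have hTfin : volume T ≠ ⊤ := ((measure_mono hT).trans_lt (by simp)).ne
    have hle : ∫⁻ t in T, energy p κ v t ≤ ∫⁻ _ in T, (N : ℝ≥0∞) :=
      setLIntegral_mono measurable_const fun t ht => ht.2.2
    have hfin : ∫⁻ t in T, energy p κ v t < ⊤ := hle.trans_lt (by
      rw [setLIntegral_const]; exact ENNReal.mul_lt_top (by simp) hTfin.lt_top)
    have hvT := (memLp_slab_iff (κ := κ) (by linarith : 0 < p) hv.velocity.measurable).2 hfin
    have h1 := hv.setIntegral_rpow_le hpp h hT hTm hvT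
    have h2 := ENNReal.ofReal_le_ofReal h1
    rw [ofReal_integral_slab_rpow (by linarith) hv.velocity.measurable hvT,
      ENNReal.ofReal_mul (by have := h.pos; positivity), ofReal_measureReal hTfin,
      ← setLIntegral_const] at h2
    have h3 : volume T = 0 := by
      by_contra h0
      have := setLIntegral_strict_mono hTm h0 hm (f := fun _ => ENNReal.ofReal (C ^ p))
        (by rw [setLIntegral_const]; exact ENNReal.mul_ne_top (by simp) hTfin)
        (Eventually.of_forall fun t ht => ht.2.1)
      exact absurd h2 (not_le.2 this)
    rw [ae_restrict_iff' measurableSet_Icc, ae_iff]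
    convert h3 using 2
    ext t
    simp [T, and_assoc]
  filter_upwards [hv.velocity.finite, ae_all_iff.2 hnull] with t h1 h2
  obtain ⟨N, hN⟩ := ENNReal.exists_nat_gt h1.ne
  by_contra h3
  exact h2 N ⟨not_le.1 h3, hN.le⟩

end EnergyBound

/-! ### Existence of tangent fields. -/

section TangentExistence

variable {p p' : ℝ} {κ : ProbabilityTheory.Kernel ℝ (Sp d)}
  [ProbabilityTheory.IsMarkovKernel κ] {T : Set ℝ} {v w : ℝ → Sp d → Sp d}

theorem IsVelocityField.integral_simpleGradient_eq (hpp : p.HolderConjugate p')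
    (hv : IsVelocityField p κ v) (hw : IsVelocityField p κ w)
    (hvL : MemLp (Function.uncurry v) (ENNReal.ofReal p) (slab κ (Icc 0 1)))
    (hwL : MemLp (Function.uncurry w) (ENNReal.ofReal p) (slab κ (Icc 0 1)))
    {c : SimpleFunc ℝ (Sp d → ℝ)} (hc : IsSimpleTest c) :
    ∫ z, inner ℝ (simpleGradient c z) (Function.uncurry v z) ∂(slab κ (Icc 0 1)) =
      ∫ z, inner ℝ (simpleGradient c z) (Function.uncurry w z) ∂(slab κ (Icc 0 1)) := by
  have hG : MemLp (simpleGradient c) (ENNReal.ofReal p') (slab κ (Icc 0 1)) :=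
    memLp_simpleGradient subset_rfl hc
  rw [Measure.integral_compProd (abs_integral_inner_le hpp.symm hG hvL).1,
    Measure.integral_compProd (abs_integral_inner_le hpp.symm hG hwL).1]
  refine integral_congr_ae ?_
  have h1 : ∀ y ∈ c.range, ∀ᵐ t ∂(volume.restrict (Icc (0 : ℝ) 1)),
      ∫ x, fderiv ℝ y x (v t x) ∂(κ t) = ∫ x, fderiv ℝ y x (w t x) ∂(κ t) := by
    intro y hy
    obtain ⟨t, rfl⟩ := SimpleFunc.mem_range.1 hy
    exact hv.ae_integral_eq hw (hc t).1 (hc t).2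
  filter_upwards [(Filter.eventually_all_finset c.range).2 h1] with t ht
  have := ht (c t) (SimpleFunc.mem_range_self c t)
  simpa only [inner_simpleGradient, Function.uncurry_apply_pair] using this

/-- The field of least L^p norm in space-time among those with the pairings of `w`. It is minimal at
almost every time, because switching to a better field at the times where that field is better would
lower the norm. -/
theorem IsVelocityField.exists_isTangentField (hp : 1 < p) (hw : IsVelocityField p κ w)
    (hwL : MemLp (Function.uncurry w) (ENNReal.ofReal p) (slab κ (Icc 0 1))) :
    ∃ v, IsTangentField p κ v := by
  classical
  have hpp := Real.HolderConjugate.conjExponent hp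
  set p' := p.conjExponent
  have hp0 := hpp.pos
  have : Fact (1 ≤ ENNReal.ofReal p) := ⟨by simpa using hp.le⟩
  have hG : ∀ c : SimpleFunc ℝ (Sp d → ℝ), IsSimpleTest c →
    MemLp (simpleGradient c) (ENNReal.ofReal p') (slab κ (Icc 0 1)) :=
    fun c hc => memLp_simpleGradient subset_rfl hc
  have hGi : ∀ c : SimpleFunc ℝ (Sp d → ℝ), IsSimpleTest c → ∀ {g : ℝ × Sp d → Sp d},
      MemLp g (ENNReal.ofReal p) (slab κ (Icc 0 1)) →
      Integrable (fun z => inner ℝ (simpleGradient c z) (g z)) (slab κ (Icc 0 1)) :=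
    fun c hc g hg => (abs_integral_inner_le hpp.symm (hG c hc) hg).1
  set S : Set (Lp (Sp d) (ENNReal.ofReal p) (slab κ (Icc 0 1))) :=
    {f | ∀ c, IsSimpleTest c → ∫ z, inner ℝ (simpleGradient c z) (f z) ∂(slab κ (Icc 0 1)) =
      ∫ z, inner ℝ (simpleGradient c z) (Function.uncurry w z) ∂(slab κ (Icc 0 1))}
  have hSmem : ∀ {g : ℝ × Sp d → Sp d} (hg : MemLp g (ENNReal.ofReal p) (slab κ (Icc 0 1))),
      (∀ c, IsSimpleTest c → ∫ z, inner ℝ (simpleGradient c z) (g z) ∂(slab κ (Icc 0 1)) =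
        ∫ z, inner ℝ (simpleGradient c z) (Function.uncurry w z) ∂(slab κ (Icc 0 1))) →
      hg.toLp ∈ S := by
    intro g hg h c hc
    rw [← h c hc]
    refine integral_congr_ae ?_
    filter_upwards [hg.coeFn_toLp] with z hz
    rw [hz]
  have hSclosed : IsClosed S := by
    simp only [S, ofPred_forall]
    exact isClosed_iInter fun c => isClosed_iInter fun hc =>
      isClosed_integral_inner_eq hpp (hG c hc) _
  have hSconv : Convex ℝ S := by
    intro f hf g hg a b _ _ hab c hc
    rw [integral_congr_ae (g := fun z => a * inner ℝ (simpleGradient c z) (f z) +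
      b * inner ℝ (simpleGradient c z) (g z)) (by
        filter_upwards [Lp.coeFn_add (a • f) (b • g), Lp.coeFn_smul a f, Lp.coeFn_smul b g]
          with z h1 h2 h3
        rw [h1, Pi.add_apply, h2, h3, Pi.smul_apply, Pi.smul_apply, inner_add_right,
          real_inner_smul_right, real_inner_smul_right]),
      integral_add ((hGi c hc (Lp.memLp f)).const_mul a) ((hGi c hc (Lp.memLp g)).const_mul b),
      integral_const_mul, integral_const_mul, hf c hc, hg c hc, ← add_mul, hab, one_mul]
  obtain ⟨f, hfS, hmin⟩ := exists_norm_le_of_convex hp hSclosed hSconv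
    ⟨hwL.toLp, hSmem hwL fun _ _ => rfl⟩
  have hfm : Measurable f := (Lp.stronglyMeasurable f).measurable
  set v : ℝ → Sp d → Sp d := fun t x => f (t, x)
  have hvm : Measurable (Function.uncurry v) := hfm
  have hvL : MemLp (Function.uncurry v) (ENNReal.ofReal p) (slab κ (Icc 0 1)) := Lp.memLp f
  have hvfin := (memLp_slab_iff (κ := κ) hp0 hvm).1 hvL
  have hvfin' : ∀ᵐ t ∂(volume.restrict (Icc (0 : ℝ) 1)), energy p κ v t < ⊤ :=
    ae_lt_top (measurable_energy hvm) hvfin.ne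
  have hv : IsVelocityField p κ v := by
    refine hw.of_ae_eq hvm hvfin' fun φ hφ hc => ?_
    have h0 := ae_integral_inner_gradient_eq_zero (w := fun t x => v t x - w t x) hpp subset_rfl
      (hvL.sub hwL) (fun c hc => by
        have := hfS c hc
        rw [← sub_eq_zero, ← integral_sub (hGi c hc (Lp.memLp f)) (hGi c hc hwL)] at this
        refine (integral_congr_ae (Eventually.of_forall fun z => ?_)).trans this
        exact (real_inner_comm (F := Sp d) _ _).trans
          (inner_sub_right (simpleGradient c z) (f z) (Function.uncurry w z))) hφ hc
    filter_upwards [h0, hvfin', hw.finite] with t ht h1 h2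
    have i1 := integrable_fderiv_apply hp.le hφ hc (memLp_of_energy_lt_top hp0 hvm h1)
    have i2 := integrable_fderiv_apply hp.le hφ hc (memLp_of_energy_lt_top hp0 hw.measurable h2)
    simp only [map_sub] at ht
    rw [integral_sub i1 i2] at ht
    linarith
  refine ⟨v, hv, fun w₂ hw₂ => ?_⟩
  set A : Set ℝ := {t | energy p κ w₂ t < energy p κ v t}
  have hA : MeasurableSet A :=
    measurableSet_lt (measurable_energy hw₂.measurable) (measurable_energy hvm)
  -- The rival `w₂` need not be p-integrable in space-time, but `u` is, since its energy never
  -- exceeds that of `v`.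
  set u : ℝ → Sp d → Sp d := fun t x => if t ∈ A then w₂ t x else v t x
  have hum : Measurable (Function.uncurry u) :=
    Measurable.ite (measurable_fst hA) hw₂.measurable hvm
  have hu1 : ∀ t ∈ A, energy p κ u t = energy p κ w₂ t := fun t ht => by simp [energy, u, ht]
  have hu2 : ∀ t ∉ A, energy p κ u t = energy p κ v t := fun t ht => by simp [energy, u, ht]
  have hule : ∀ t, energy p κ u t ≤ energy p κ v t := fun t => by
    by_cases ht : t ∈ A
    · rw [hu1 t ht]; exact le_of_lt ht
    · rw [hu2 t ht]
  have huvel : IsVelocityField p κ u := by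
    refine hv.of_ae_eq hum ?_ fun φ hφ hc => ?_
    · filter_upwards [hvfin'] with t ht using (hule t).trans_lt ht
    · filter_upwards [hv.ae_integral_eq hw₂ hφ hc] with t ht
      by_cases htA : t ∈ A
      · simp only [u, htA, if_true]; exact ht
      · simp [u, htA]
  have huL : MemLp (Function.uncurry u) (ENNReal.ofReal p) (slab κ (Icc 0 1)) :=
    (memLp_slab_iff hp0 hum).2 ((lintegral_mono hule).trans_lt hvfin)
  have hle := hmin _ (hSmem huL fun c hc => huvel.integral_simpleGradient_eq hpp hw huL hwL hc)
  have hle' := Real.rpow_le_rpow (norm_nonneg _) hle hp0.le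
  rw [norm_Lp_rpow hp0, norm_Lp_rpow hp0, integral_congr_ae (f := fun z => ‖huL.toLp (Function.uncurry u) z‖ ^ p)
    (g := fun z => ‖Function.uncurry u z‖ ^ p) (by
      filter_upwards [huL.coeFn_toLp] with z hz
      rw [hz])] at hle'
  have hle'' := ENNReal.ofReal_le_ofReal hle'
  rw [ofReal_integral_slab_rpow hp0 hum huL] at hle''
  rw [show (∫ z, ‖f z‖ ^ p ∂(slab κ (Icc 0 1))) =
    ∫ z, ‖Function.uncurry v z‖ ^ p ∂(slab κ (Icc 0 1)) from rfl,
    ofReal_integral_slab_rpow hp0 hvm hvL] at hle''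
  have heq := ae_eq_of_ae_le_of_lintegral_le (Eventually.of_forall hule)
    ((lintegral_mono hule).trans_lt hvfin).ne (measurable_energy hvm).aemeasurable hle''
  filter_upwards [heq] with t ht
  by_contra hlt
  have htA : t ∈ A := not_le.1 hlt
  rw [hu1 t htA] at ht
  exact (ne_of_lt htA) ht

end TangentExistence

/-! ### The continuity equation for test functions depending on time. -/

section TimeDependentTests

variable {p C N : ℝ} {κ : ProbabilityTheory.Kernel ℝ (Sp d)}
  [ProbabilityTheory.IsMarkovKernel κ] {v : ℝ → Sp d → Sp d}

theorem integral_norm_le_of_energy_le (hp : 1 < p) (hN : 0 ≤ N) {μ : ℝ → Measure (Sp d)} {t : ℝ}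
    [IsProbabilityMeasure (μ t)] (hv : Measurable (Function.uncurry v))
    (h : energy p μ v t ≤ ENNReal.ofReal N) :
    Integrable (v t) (μ t) ∧ ∫ x, ‖v t x‖ ∂(μ t) ≤ 1 + N := by
  have hp0 : 0 < p := by linarith
  have hL := memLp_of_energy_lt_top hp0 hv (h.trans_lt ENNReal.ofReal_lt_top)
  have hi : Integrable (v t) (μ t) := hL.integrable (by simpa using hp.le)
  have hr := integrable_norm_rpow_of_memLp hp0 hL
  refine ⟨hi, ?_⟩
  have hE : ∫ x, ‖v t x‖ ^ p ∂(μ t) ≤ N := by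
    rw [← ENNReal.ofReal_le_ofReal_iff hN, ofReal_integral_eq_lintegral_ofReal hr
      (Eventually.of_forall fun x => by positivity)]
    refine le_trans (le_of_eq (lintegral_congr fun x => ?_)) h
    rw [← ofReal_norm, ENNReal.ofReal_rpow_of_nonneg (norm_nonneg _) hp0.le]
  calc ∫ x, ‖v t x‖ ∂(μ t) ≤ ∫ x, (1 + ‖v t x‖ ^ p) ∂(μ t) := by
        refine integral_mono hi.norm ((integrable_const 1).add hr) fun x => ?_
        change ‖v t x‖ ≤ 1 + ‖v t x‖ ^ p
        have h0 : 0 ≤ ‖v t x‖ ^ p := by positivity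
        rcases le_total ‖v t x‖ 1 with h1 | h1
        · linarith
        · have := Real.rpow_le_rpow_of_exponent_le h1 hp.le
          rw [Real.rpow_one] at this
          linarith
    _ = 1 + ∫ x, ‖v t x‖ ^ p ∂(μ t) := by
        rw [integral_add (integrable_const 1) hr]; simp
    _ ≤ 1 + N := by linarith

theorem memLp_slab_of_energy_le (hp : 0 < p) (hv : Measurable (Function.uncurry v))
    (hE : ∀ᵐ t ∂(volume.restrict (Icc (0 : ℝ) 1)), energy p κ v t ≤ ENNReal.ofReal N) :
    MemLp (Function.uncurry v) (ENNReal.ofReal p) (slab κ (Icc 0 1)) := by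
  rw [memLp_slab_iff hp hv]
  refine (lintegral_mono_ae hE).trans_lt ?_
  simp

theorem integrable_slab_of_energy_le (hp : 1 ≤ p) (hv : Measurable (Function.uncurry v))
    (hE : ∀ᵐ t ∂(volume.restrict (Icc (0 : ℝ) 1)), energy p κ v t ≤ ENNReal.ofReal N) :
    Integrable (Function.uncurry v) (slab κ (Icc 0 1)) :=
  (memLp_slab_of_energy_le (by linarith) hv hE).integrable (by simpa using hp)

theorem integrable_slab_fderiv_apply {ψ : ℝ × Sp d → ℝ} (hψ : ContDiff ℝ 1 ψ)
    (hc : HasCompactSupport ψ) (hv : Integrable (Function.uncurry v) (slab κ (Icc 0 1))) :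
    Integrable (fun z : ℝ × Sp d => fderiv ℝ ψ z (1, v z.1 z.2)) (slab κ (Icc 0 1)) := by
  have hcont := hψ.continuous_fderiv one_ne_zero
  obtain ⟨B, hB⟩ := (hc.fderiv ℝ).exists_bound_of_continuous hcont
  have hw : Integrable (fun z : ℝ × Sp d => ((1 : ℝ), v z.1 z.2)) (slab κ (Icc 0 1)) :=
    (integrable_const (1 : ℝ)).prodMk hv
  refine Integrable.mono' (hw.norm.const_mul B) ?_ (Eventually.of_forall fun x => ?_)
  · exact (ContinuousLinearMap.id ℝ (ℝ × Sp d →L[ℝ] ℝ)).aestronglyMeasurable_comp₂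
      hcont.aestronglyMeasurable hw.1
  · exact ((fderiv ℝ ψ x).le_opNorm _).trans (by gcongr; exact hB x)

theorem contDiff_slice {F : Type*} [NormedAddCommGroup F] [NormedSpace ℝ F] {n : WithTop ℕ∞}
    {ψ : ℝ × Sp d → F} (hψ : ContDiff ℝ n ψ) (s : ℝ) : ContDiff ℝ n fun x => ψ (s, x) :=
  hψ.comp (contDiff_const.prodMk contDiff_id)

theorem hasCompactSupport_slice {F : Type*} [NormedAddCommGroup F] {ψ : ℝ × Sp d → F}
    (hc : HasCompactSupport ψ) (s : ℝ) :
    HasCompactSupport fun x => ψ (s, x) := by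
  refine HasCompactSupport.of_support_subset_isCompact (hc.image continuous_snd) fun x hx => ?_
  exact ⟨(s, x), subset_tsupport _ hx, rfl⟩

theorem fderiv_slice {F : Type*} [NormedAddCommGroup F] [NormedSpace ℝ F] {ψ : ℝ × Sp d → F}
    (hψ : ContDiff ℝ 1 ψ) (s : ℝ) (x a : Sp d) :
    fderiv ℝ (fun x => ψ (s, x)) x a = fderiv ℝ ψ (s, x) (0, a) := by
  have h1 : HasFDerivAt (fun x : Sp d => (s, x)) (ContinuousLinearMap.inr ℝ ℝ (Sp d)) x :=
    hasFDerivAt_prodMk_right s x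
  have h2 := (hψ.differentiable one_ne_zero (s, x)).hasFDerivAt.comp x h1
  rw [HasFDerivAt.fderiv (f := fun x => ψ (s, x)) h2]
  rfl

theorem hasDerivAt_slice {F : Type*} [NormedAddCommGroup F] [NormedSpace ℝ F] {ψ : ℝ × Sp d → F}
    (hψ : ContDiff ℝ 1 ψ) (s : ℝ) (x : Sp d) :
    HasDerivAt (fun r => ψ (r, x)) (fderiv ℝ ψ (s, x) (1, 0)) s := by
  have h1 : HasDerivAt (fun r : ℝ => (r, x)) ((1 : ℝ), (0 : Sp d)) s :=
    (hasDerivAt_id s).prodMk (hasDerivAt_const s x)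
  exact (hψ.differentiable one_ne_zero (s, x)).hasFDerivAt.comp_hasDerivAt s h1

/-- The increment splits into that of the test function, integrated at time t, and that of the
measure, to which the continuity equation for the frozen function ψ(s, ·) applies. Uniform
continuity of the derivative and the uniform energy bound make the error o(t - s) at every s, not
only at almost every s. -/
theorem IsVelocityField.eventually_abs_sub_integral_le (hp : 1 < p) (hN : 0 ≤ N)
    (h : IsCoupled p C κ) (hv : IsVelocityField p κ v)
    (hE : ∀ᵐ t ∂(volume.restrict (Icc (0 : ℝ) 1)), energy p κ v t ≤ ENNReal.ofReal N)
    {ψ : ℝ × Sp d → ℝ} (hψ : ContDiff ℝ 1 ψ) (hc : HasCompactSupport ψ) {s : ℝ}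
    (hs : s ∈ Ico (0 : ℝ) 1) {ε : ℝ} (hε : 0 < ε) :
    ∀ᶠ t in 𝓝[>] s, |∫ x, ψ (t, x) ∂(κ t) - ∫ x, ψ (s, x) ∂(κ s) -
      ∫ r in s..t, ∫ x, fderiv ℝ ψ (r, x) (1, v r x) ∂(κ r)| ≤ ε * (5 + N) * (t - s) := by
  have hcont := hψ.continuous_fderiv one_ne_zero
  have hsI : s ∈ Icc (0 : ℝ) 1 := ⟨hs.1, hs.2.le⟩
  obtain ⟨B, hB⟩ := (hc.fderiv ℝ).exists_bound_of_continuous hcont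
  obtain ⟨B₀, hB₀⟩ := hc.exists_bound_of_continuous hψ.continuous
  have hu : UniformContinuous (fderiv ℝ ψ) := (hc.fderiv ℝ).uniformContinuous_of_continuous hcont
  obtain ⟨δ, hδ, H⟩ := Metric.uniformContinuous_iff.1 hu ε hε
  have hclose : ∀ r, |r - s| < δ → ∀ x, ‖fderiv ℝ ψ (r, x) - fderiv ℝ ψ (s, x)‖ ≤ ε := by
    intro r hr x
    rw [← dist_eq_norm]
    refine (H ?_).le
    rw [Prod.dist_eq, dist_self, Real.dist_eq]
    simpa using hr
  set θ : Sp d → ℝ := fun x => fderiv ℝ ψ (s, x) (1, 0)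
  have h10 : ‖((1 : ℝ), (0 : Sp d))‖ = 1 := by simp [Prod.norm_def]
  have hθu : UniformContinuous θ :=
    ((ContinuousLinearMap.apply ℝ ℝ ((1 : ℝ), (0 : Sp d))).uniformContinuous.comp hu).comp
      (uniformContinuous_const.prodMk uniformContinuous_id)
  have hθB : ∀ x, |θ x| ≤ B := fun x => by
    have := (fderiv ℝ ψ (s, x)).le_opNorm ((1 : ℝ), (0 : Sp d))
    rw [h10, mul_one] at this
    exact this.trans (hB _)
  set Θ : ℝ → ℝ := fun r => ∫ x, θ x ∂(κ r)
  have hθi : ∀ r, Integrable θ (κ r) := fun r =>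
    Integrable.of_bound hθu.continuous.aestronglyMeasurable B (Eventually.of_forall hθB)
  have hΘ : ∀ᶠ r in 𝓝[Icc 0 1] s, |Θ r - Θ s| < ε := by
    have := Metric.continuousWithinAt_iff'.1 (h.continuousOn_integral (by linarith) hθu hθB s hsI)
      ε hε
    simpa only [Real.dist_eq] using this
  obtain ⟨δ', hδ', hΘ'⟩ := Metric.mem_nhdsWithin_iff.1 hΘ
  have hvi := integrable_slab_of_energy_le hp.le hv.measurable hE
  have hgi := integrable_integral_compProd (integrable_slab_fderiv_apply hψ hc hvi)
  have hψi : ∀ t r, Integrable (fun x => ψ (t, x)) (κ r) := fun t r =>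
    Integrable.of_bound (contDiff_slice hψ t).continuous.aestronglyMeasurable B₀
      (Eventually.of_forall fun x => hB₀ _)
  filter_upwards [Ioo_mem_nhdsGT (show s < min 1 (min (s + δ) (s + δ')) by
    simp [hs.2, hδ, hδ'])] with t ht
  simp only [mem_Ioo, lt_min_iff] at ht
  obtain ⟨hst, ht1, htδ, htδ'⟩ := ht
  have htI : t ∈ Icc (0 : ℝ) 1 := ⟨hs.1.trans hst.le, ht1.le⟩
  have hΘt : ∀ r ∈ Icc s t, |Θ r - Θ s| ≤ ε := fun r hr => by
    refine le_of_lt (hΘ' ⟨?_, hs.1.trans hr.1, hr.2.trans ht1.le⟩)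
    rw [Metric.mem_ball, Real.dist_eq, abs_of_nonneg (by linarith [hr.1])]
    linarith [hr.2]
  -- the time increment of the test function
  have hfirst : |∫ x, (ψ (t, x) - ψ (s, x)) ∂(κ t) - (t - s) * Θ t| ≤ ε * (t - s) := by
    have hpt : ∀ x, |ψ (t, x) - ψ (s, x) - (t - s) * θ x| ≤ ε * (t - s) := by
      intro x
      have := Convex.norm_image_sub_le_of_norm_hasDerivWithin_le (s := Icc s t)
        (f := fun r => ψ (r, x) - r * θ x) (f' := fun r => fderiv ℝ ψ (r, x) (1, 0) - 1 * θ x)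
        (C := ε) (x := s) (y := t) (fun r _ => ((hasDerivAt_slice hψ r x).sub
          ((hasDerivAt_id r).mul_const (θ x))).hasDerivWithinAt) (fun r hr => ?_) (convex_Icc s t)
        (left_mem_Icc.2 hst.le) (right_mem_Icc.2 hst.le)
      · rw [Real.norm_eq_abs, Real.norm_eq_abs, abs_of_pos (sub_pos.2 hst)] at this
        refine le_trans (le_of_eq ?_) this
        congr 1; ring
      · rw [one_mul, ← sub_apply]
        refine ((fderiv ℝ ψ (r, x) - fderiv ℝ ψ (s, x)).le_opNorm _).trans ?_
        rw [h10, mul_one]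
        refine hclose r ?_ x
        rw [abs_of_nonneg (by linarith [hr.1])]
        linarith [hr.2]
    have hi : Integrable (fun x => ψ (t, x) - ψ (s, x)) (κ t) := (hψi t t).sub (hψi s t)
    rw [← integral_const_mul, ← integral_sub hi ((hθi t).const_mul _)]
    have := norm_integral_le_of_norm_le_const (μ := κ t)
      (f := fun x => ψ (t, x) - ψ (s, x) - (t - s) * θ x) (Eventually.of_forall hpt)
    simpa using this
  -- the increment of the measure
  have hsecond := (hv.continuity _ (contDiff_slice hψ s) (hasCompactSupport_slice hc s)).2
    s hsI t htI hst
  simp only [fderiv_slice hψ] at hsecond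
  have hsub : Ioc s t ⊆ Icc 0 1 := fun r hr => ⟨hs.1.trans hr.1.le, hr.2.trans ht1.le⟩
  have hi2 : IntervalIntegrable (fun r => ∫ x, fderiv ℝ ψ (s, x) (0, v r x) ∂(κ r)) volume s t := by
    have := (hv.continuity _ (contDiff_slice hψ s) (hasCompactSupport_slice hc s)).1
    simp only [fderiv_slice hψ] at this
    refine this.mono_set ?_
    rw [uIcc_of_le hst.le, uIcc_of_le zero_le_one]
    exact Icc_subset_Icc hs.1 ht1.le
  have hig : IntervalIntegrable (fun r => ∫ x, fderiv ℝ ψ (r, x) (1, v r x) ∂(κ r)) volume s t :=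
    (intervalIntegrable_iff_integrableOn_Ioc_of_le hst.le).2 (IntegrableOn.mono_set hgi hsub)
  -- Freezing the derivative costs ε ∫ (1 + |v_r|) ≤ ε (2 + N), and replacing Θ r by Θ s one further
  -- ε. With the two errors from the time increment this adds up to 5 + N.
  have hdiff : |(∫ r in s..t, ∫ x, fderiv ℝ ψ (r, x) (1, v r x) ∂(κ r)) -
      ((t - s) * Θ s + ∫ r in s..t, ∫ x, fderiv ℝ ψ (s, x) (0, v r x) ∂(κ r))| ≤
      ε * (3 + N) * (t - s) := by
    have e : (t - s) * Θ s = ∫ _ in s..t, Θ s := by simp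
    rw [e, ← intervalIntegral.integral_add intervalIntegrable_const hi2,
      ← intervalIntegral.integral_sub hig (intervalIntegrable_const.add hi2)]
    rw [← abs_of_pos (sub_pos.2 hst), ← Real.norm_eq_abs (∫ _ in s..t, _)]
    refine intervalIntegral.norm_integral_le_of_norm_le_const_ae ?_
    rw [uIoc_of_le hst.le]
    have hE' := (ae_restrict_iff' measurableSet_Icc).1 hE
    filter_upwards [hE'] with r hr hrI
    obtain ⟨hvr, hvr'⟩ := integral_norm_le_of_energy_le hp hN hv.measurable (hr (hsub hrI))
    have hrs : |r - s| < δ := by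
      rw [abs_of_pos (by linarith [hrI.1])]; linarith [hrI.2]
    have hw : Integrable (fun x => ((1 : ℝ), v r x)) (κ r) := (integrable_const 1).prodMk hvr
    have happ : ∀ (L : Sp d → ℝ × Sp d →L[ℝ] ℝ) (_ : Continuous L) (_ : ∀ x, ‖L x‖ ≤ B)
        {g : Sp d → ℝ × Sp d} (_ : Integrable g (κ r)), Integrable (fun x => L x (g x)) (κ r) := by
      intro L hL hLB g hg
      refine Integrable.mono' (hg.norm.const_mul B) ?_ (Eventually.of_forall fun x => ?_)
      · exact (ContinuousLinearMap.id ℝ (ℝ × Sp d →L[ℝ] ℝ)).aestronglyMeasurable_comp₂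
          hL.aestronglyMeasurable hg.1
      · exact ((L x).le_opNorm _).trans (by gcongr; exact hLB x)
    have j1 := happ (fun x => fderiv ℝ ψ (r, x)) (by fun_prop) (fun x => hB _) hw
    have j2 := happ (fun x => fderiv ℝ ψ (s, x)) (by fun_prop) (fun x => hB _) hw
    have j3 := happ (fun x => fderiv ℝ ψ (s, x)) (by fun_prop) (fun x => hB _)
      ((integrable_const (0 : ℝ)).prodMk hvr)
    have split : ∫ x, fderiv ℝ ψ (s, x) (1, v r x) ∂(κ r) =
        Θ r + ∫ x, fderiv ℝ ψ (s, x) (0, v r x) ∂(κ r) := by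
      rw [← integral_add (hθi r) j3]
      refine integral_congr_ae (Eventually.of_forall fun x => ?_)
      simp only [θ]
      rw [← map_add]; simp
    have hd1 : |∫ x, fderiv ℝ ψ (r, x) (1, v r x) ∂(κ r) -
        ∫ x, fderiv ℝ ψ (s, x) (1, v r x) ∂(κ r)| ≤ ε * (2 + N) := by
      rw [← integral_sub j1 j2]
      have hi3 : Integrable (fun x => ε * (1 + ‖v r x‖)) (κ r) :=
        ((integrable_const 1).add hvr.norm).const_mul ε
      calc |∫ x, (fderiv ℝ ψ (r, x) (1, v r x) - fderiv ℝ ψ (s, x) (1, v r x)) ∂(κ r)|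
          ≤ ∫ x, |fderiv ℝ ψ (r, x) (1, v r x) - fderiv ℝ ψ (s, x) (1, v r x)| ∂(κ r) :=
            abs_integral_le_integral_abs
        _ ≤ ∫ x, ε * (1 + ‖v r x‖) ∂(κ r) := by
            refine integral_mono (j1.sub j2).abs hi3 fun x => ?_
            simp only [← sub_apply]
            refine ((fderiv ℝ ψ (r, x) - fderiv ℝ ψ (s, x)).le_opNorm _).trans ?_
            refine mul_le_mul (hclose r hrs x) ?_ (norm_nonneg _) hε.le
            rw [Prod.norm_def]
            simp only [norm_one]
            exact max_le (by linarith [norm_nonneg (v r x)]) (by linarith)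
        _ = ε * (1 + ∫ x, ‖v r x‖ ∂(κ r)) := by
            rw [integral_const_mul, integral_add (integrable_const 1) hvr.norm]; simp
        _ ≤ ε * (2 + N) := mul_le_mul_of_nonneg_left (by linarith) hε.le
    have hd2 := hΘt r ⟨hrI.1.le, hrI.2⟩
    rw [Real.norm_eq_abs]
    rw [split] at hd1
    have := abs_add_le (∫ x, fderiv ℝ ψ (r, x) (1, v r x) ∂(κ r) -
        (Θ r + ∫ x, fderiv ℝ ψ (s, x) (0, v r x) ∂(κ r))) (Θ r - Θ s)
    refine le_trans (le_of_eq ?_) (this.trans ((add_le_add hd1 hd2).trans (le_of_eq ?_)))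
    · congr 1; ring
    · ring
  have hts : |(t - s) * Θ t - (t - s) * Θ s| ≤ ε * (t - s) := by
    rw [← mul_sub, abs_mul, abs_of_pos (sub_pos.2 hst), mul_comm]
    exact mul_le_mul_of_nonneg_right (hΘt t ⟨hst.le, le_rfl⟩) (sub_pos.2 hst).le
  have hsum : ∫ x, ψ (t, x) ∂(κ t) - ∫ x, ψ (s, x) ∂(κ s) =
      ∫ x, (ψ (t, x) - ψ (s, x)) ∂(κ t) +
        ∫ r in s..t, ∫ x, fderiv ℝ ψ (s, x) (0, v r x) ∂(κ r) := by
    rw [← hsecond, integral_sub (hψi t t) (hψi s t)]; ring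
  rw [hsum]
  rw [abs_le] at *
  constructor <;> nlinarith

/-- The difference `R` of the two sides is continuous and has right derivative 0 at every point of
[t₁, t₂[, hence is constant. -/
theorem IsVelocityField.integral_sub_eq (hp : 1 < p) (hN : 0 ≤ N)
    (h : IsCoupled p C κ) (hv : IsVelocityField p κ v)
    (hE : ∀ᵐ t ∂(volume.restrict (Icc (0 : ℝ) 1)), energy p κ v t ≤ ENNReal.ofReal N)
    {ψ : ℝ × Sp d → ℝ} (hψ : ContDiff ℝ 1 ψ) (hc : HasCompactSupport ψ) {t₁ t₂ : ℝ}
    (ht₁ : t₁ ∈ Icc (0 : ℝ) 1) (ht₂ : t₂ ∈ Icc (0 : ℝ) 1) (hlt : t₁ ≤ t₂) :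
    ∫ x, ψ (t₂, x) ∂(κ t₂) - ∫ x, ψ (t₁, x) ∂(κ t₁) =
      ∫ r in t₁..t₂, ∫ x, fderiv ℝ ψ (r, x) (1, v r x) ∂(κ r) := by
  have hvi := integrable_slab_of_energy_le hp.le hv.measurable hE
  have hgi := integrable_integral_compProd (integrable_slab_fderiv_apply hψ hc hvi)
  obtain ⟨B₀, hB₀⟩ := hc.exists_bound_of_continuous hψ.continuous
  have hψi : ∀ t r, Integrable (fun x => ψ (t, x)) (κ r) := fun t r =>
    Integrable.of_bound (contDiff_slice hψ t).continuous.aestronglyMeasurable B₀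
      (Eventually.of_forall fun x => hB₀ _)
  have hig : ∀ a ∈ Icc (0 : ℝ) 1, ∀ b ∈ Icc (0 : ℝ) 1,
      IntervalIntegrable (fun r => ∫ x, fderiv ℝ ψ (r, x) (1, v r x) ∂(κ r)) volume a b :=
    fun a ha b hb => (IntegrableOn.mono_set hgi (uIcc_subset_Icc ha hb)).intervalIntegrable
  obtain ⟨L, hL⟩ := hψ.lipschitzWith_of_hasCompactSupport hc one_ne_zero
  have hm : ContinuousOn (fun t => ∫ x, ψ (t, x) ∂(κ t)) (Icc 0 1) := by
    intro s hs
    have h1 := h.continuousOn_integral (by linarith : 0 < p)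
      ((hasCompactSupport_slice hc s).uniformContinuous_of_continuous
        (contDiff_slice hψ s).continuous) (fun x => hB₀ (s, x)) s hs
    have h2 : Tendsto (fun t => ∫ x, ψ (t, x) ∂(κ t) - ∫ x, ψ (s, x) ∂(κ t)) (𝓝[Icc 0 1] s)
        (𝓝 0) := by
      refine squeeze_zero_norm (a := fun t => L * |t - s|) (fun t => ?_) ?_
      · rw [← integral_sub (hψi t t) (hψi s t)]
        have := norm_integral_le_of_norm_le_const (μ := κ t) (f := fun x => ψ (t, x) - ψ (s, x))
          (C := L * |t - s|) (Eventually.of_forall fun x => by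
            have := hL.dist_le_mul (t, x) (s, x)
            rwa [Prod.dist_eq, dist_self, Real.dist_eq, max_eq_left (by simp), dist_eq_norm]
              at this)
        simpa using this
      · have : Continuous fun t => (L : ℝ) * |t - s| := by fun_prop
        have := this.tendsto s
        simp only [sub_self, abs_zero, mul_zero] at this
        exact this.mono_left nhdsWithin_le_nhds
    have h3 := h2.add h1
    simp only [sub_add_cancel, zero_add] at h3
    exact h3
  have hsub : Icc t₁ t₂ ⊆ Icc 0 1 := Icc_subset_Icc ht₁.1 ht₂.2
  set R : ℝ → ℝ := fun t => ∫ x, ψ (t, x) ∂(κ t) -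
    ∫ r in t₁..t, ∫ x, fderiv ℝ ψ (r, x) (1, v r x) ∂(κ r)
  have hRc : ContinuousOn R (Icc t₁ t₂) := by
    refine (hm.mono hsub).sub ?_
    have := intervalIntegral.continuousOn_primitive_interval' (hig t₁ ht₁ t₂ ht₂)
      (left_mem_uIcc)
    rwa [uIcc_of_le hlt] at this
  have hRd : ∀ s ∈ Ico t₁ t₂, HasDerivWithinAt R 0 (Ici s) s := by
    intro s hs
    have hs0 : s ∈ Ico (0 : ℝ) 1 := ⟨ht₁.1.trans hs.1, hs.2.trans_le ht₂.2⟩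
    have hsI : s ∈ Icc (0 : ℝ) 1 := ⟨hs0.1, hs0.2.le⟩
    rw [← hasDerivWithinAt_Ioi_iff_Ici, hasDerivWithinAt_iff_isLittleO,
      Asymptotics.isLittleO_iff]
    intro ε hε
    have := hv.eventually_abs_sub_integral_le hp hN h hE hψ hc hs0
      (div_pos hε (by linarith : 0 < 5 + N))
    filter_upwards [this, Ioo_mem_nhdsGT hs0.2] with t ht hst
    rw [div_mul_cancel₀ _ (by linarith : 5 + N ≠ 0)] at ht
    rw [smul_zero, sub_zero, Real.norm_eq_abs, Real.norm_eq_abs, abs_of_pos (sub_pos.2 hst.1)]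
    refine le_trans (le_of_eq ?_) ht
    have hadd := intervalIntegral.integral_add_adjacent_intervals (hig t₁ ht₁ s hsI)
      (hig s hsI t ⟨hs0.1.trans hst.1.le, hst.2.le⟩)
    simp only [R]
    rw [← hadd]
    congr 1; ring
  have := constant_of_has_deriv_right_zero hRc hRd t₂ (right_mem_Icc.2 hlt)
  simp only [R, intervalIntegral.integral_same, sub_zero] at this
  linarith

end TimeDependentTests

/-! ### Only the values of a curve on [0,1] matter. -/

section Congr

variable {p : ℝ} {Ω : Set (Sp d)} {μ ν : ℝ → Measure (Sp d)} {v : ℝ → Sp d → Sp d}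

theorem energy_congr (h : ∀ t ∈ Icc (0 : ℝ) 1, μ t = ν t) {t : ℝ} (ht : t ∈ Icc (0 : ℝ) 1) :
    energy p μ v t = energy p ν v t := by
  rw [energy, energy, h t ht]

theorem IsVelocityField.congr (h : ∀ t ∈ Icc (0 : ℝ) 1, μ t = ν t) (hv : IsVelocityField p μ v) :
    IsVelocityField p ν v := by
  refine ⟨hv.measurable, ?_, fun φ hφ hc => ?_⟩
  · filter_upwards [hv.finite, ae_restrict_mem measurableSet_Icc] with t h1 h2
    rwa [← energy_congr h h2]
  · obtain ⟨h1, h2⟩ := hv.continuity φ hφ hc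
    have hae : (fun s => ∫ x, fderiv ℝ φ x (v s x) ∂(μ s)) =ᵐ[volume.restrict (uIoc (0 : ℝ) 1)]
        fun s => ∫ x, fderiv ℝ φ x (v s x) ∂(ν s) := by
      refine (ae_restrict_iff' measurableSet_uIoc).2 (Eventually.of_forall fun s hs => ?_)
      rw [uIoc_of_le zero_le_one] at hs
      simp only [h s (Ioc_subset_Icc_self hs)]
    refine ⟨h1.congr_ae hae, fun t₁ ht₁ t₂ ht₂ hlt => ?_⟩
    rw [← h t₁ ht₁, ← h t₂ ht₂, h2 t₁ ht₁ t₂ ht₂ hlt]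
    refine intervalIntegral.integral_congr fun s hs => ?_
    rw [uIcc_of_le hlt.le] at hs
    simp only [h s ⟨ht₁.1.trans hs.1, hs.2.trans ht₂.2⟩]

theorem IsTangentField.congr (h : ∀ t ∈ Icc (0 : ℝ) 1, μ t = ν t) (hv : IsTangentField p μ v) :
    IsTangentField p ν v := by
  refine ⟨hv.velocity.congr h, fun w hw => ?_⟩
  filter_upwards [hv.minimal w (hw.congr fun t ht => (h t ht).symm),
    ae_restrict_mem measurableSet_Icc] with t h1 h2
  rwa [← energy_congr h h2, ← energy_congr h h2]

theorem IsCoupled.congr {C : ℝ} (h : ∀ t ∈ Icc (0 : ℝ) 1, μ t = ν t) (hμ : IsCoupled p C μ) :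
    IsCoupled p C ν := by
  refine ⟨hμ.pos, fun t ht => h t ht ▸ hμ.prob t ht, fun s hs t ht hst => ?_⟩
  rw [← h s hs, ← h t ht]
  exact hμ.plan s hs t ht hst

end Congr

/-! ### The velocity field of a perturbed curve. -/

section Perturbation

variable {p C N : ℝ} {κ : ProbabilityTheory.Kernel ℝ (Sp d)}
  [ProbabilityTheory.IsMarkovKernel κ] {v : ℝ → Sp d → Sp d} {ξ : ℝ × Sp d → Sp d}

/-- The image of the curve `μ` under the maps `x ↦ x + ε ξ(t, x)`. -/
noncomputable def perturbed (μ : ℝ → Measure (Sp d)) (ξ : ℝ × Sp d → Sp d) (ε : ℝ) (t : ℝ) :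
    Measure (Sp d) := (μ t).map fun x => x + ε • ξ (t, x)

theorem measurable_perturbation (hξ : Continuous ξ) (ε t : ℝ) :
    Measurable fun x : Sp d => x + ε • ξ (t, x) := by
  have : Continuous fun x : Sp d => x + ε • ξ (t, x) := by fun_prop
  exact this.measurable

theorem exists_velocity_bound (hξ : ContDiff ℝ 1 ξ) (hc : HasCompactSupport ξ) :
    ∃ B, 0 ≤ B ∧ ∀ t (x a : Sp d), ‖fderiv ℝ ξ (t, x) (1, a)‖ ≤ B * (1 + ‖a‖) := by
  obtain ⟨B, hB⟩ := (hc.fderiv ℝ).exists_bound_of_continuous (hξ.continuous_fderiv one_ne_zero)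
  have hB0 : 0 ≤ B := (norm_nonneg _).trans (hB 0)
  refine ⟨B, hB0, fun t x a => ((fderiv ℝ ξ (t, x)).le_opNorm _).trans ?_⟩
  refine mul_le_mul (hB _) ?_ (norm_nonneg _) hB0
  rw [Prod.norm_def, norm_one]
  exact max_le (by linarith [norm_nonneg a]) (by linarith)

theorem measurable_fderiv_velocity (hξ : ContDiff ℝ 1 ξ) (hv : Measurable (Function.uncurry v)) :
    Measurable fun z : ℝ × Sp d => fderiv ℝ ξ z (1, v z.1 z.2) := by
  have hcont := hξ.continuous_fderiv one_ne_zero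
  have h2 : Measurable fun z : ℝ × Sp d => ((1 : ℝ), v z.1 z.2) := measurable_const.prodMk hv
  have h3 : Continuous fun q : (ℝ × Sp d →L[ℝ] Sp d) × (ℝ × Sp d) => q.1 q.2 := by fun_prop
  exact h3.measurable.comp (hcont.measurable.prodMk h2)

theorem memLp_perturbed_velocity (hξ : ContDiff ℝ 1 ξ) (hc : HasCompactSupport ξ)
    {X : Type*} [MeasurableSpace X] {M : Measure X} [IsFiniteMeasure M] {g : X → Sp d}
    {f : X → ℝ × Sp d} (hf : Measurable f) (hg : MemLp g (ENNReal.ofReal p) M) :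
    MemLp (fun z => fderiv ℝ ξ (f z) (1, g z)) (ENNReal.ofReal p) M := by
  obtain ⟨B, hB, H⟩ := exists_velocity_bound hξ hc
  have hm : AEStronglyMeasurable (fun z => fderiv ℝ ξ (f z) (1, g z)) M := by
    refine (ContinuousLinearMap.id ℝ (ℝ × Sp d →L[ℝ] Sp d)).aestronglyMeasurable_comp₂
      ?_ (aestronglyMeasurable_const.prodMk hg.1)
    exact ((hξ.continuous_fderiv one_ne_zero).measurable.comp hf).aestronglyMeasurable
  refine (((memLp_const (1 : ℝ)).add hg.norm).const_mul B).mono hm (Eventually.of_forall fun z => ?_)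
  refine (H (f z).1 (f z).2 (g z)).trans (le_of_eq ?_)
  simp only [Pi.add_apply]
  rw [Real.norm_of_nonneg (by positivity)]

/-- Particle paths are mapped by (t, x) ↦ x + ε ξ(t, x), so the new velocity at the image point is
the derivative of this map in the direction (1, v). Pulling a test function back along the map makes
it depend on time, which is why the time-dependent continuity equation is needed. -/
theorem IsVelocityField.exists_perturbed (hp : 1 < p) (hN : 0 ≤ N)
    (h : IsCoupled p C κ) (hv : IsVelocityField p κ v)
    (hE : ∀ᵐ t ∂(volume.restrict (Icc (0 : ℝ) 1)), energy p κ v t ≤ ENNReal.ofReal N)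
    (hξ : ContDiff ℝ 1 ξ) (hc : HasCompactSupport ξ) {ε : ℝ}
    (hinj : ∀ t, Function.Injective fun x => x + ε • ξ (t, x)) :
    ∃ w, IsVelocityField p (perturbed κ ξ ε) w ∧ ∀ t, energy p (perturbed κ ξ ε) w t =
      energy p κ (fun t x => v t x + ε • fderiv ℝ ξ (t, x) (1, v t x)) t := by
  have hp0 : 0 < p := by linarith
  set Φ : ℝ × Sp d → ℝ × Sp d := fun z => (z.1, z.2 + ε • ξ z)
  have hΦc : Continuous Φ := by have := hξ.continuous; fun_prop
  have hΦi : Function.Injective Φ := by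
    rintro ⟨t, x⟩ ⟨s, y⟩ hxy
    obtain ⟨h1, h2⟩ := Prod.mk.inj hxy
    simp only at h1 h2
    subst h1
    rw [hinj t h2]
  have hΦ : MeasurableEmbedding Φ := hΦc.measurableEmbedding hΦi
  have hgm : Measurable fun z : ℝ × Sp d => v z.1 z.2 + ε • fderiv ℝ ξ z (1, v z.1 z.2) :=
    hv.measurable.add ((measurable_fderiv_velocity hξ hv.measurable).const_smul ε)
  -- Injectivity makes `Φ` a measurable embedding, so the field prescribed on its range is Borel.
  -- The values off the range are irrelevant, as the perturbed curve does not charge them.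
  obtain ⟨w', hw'm, hw'⟩ := hΦ.exists_measurable_extend hgm fun _ => ⟨0⟩
  set w : ℝ → Sp d → Sp d := fun t x => w' (t, x)
  have hwm : Measurable (Function.uncurry w) := hw'm
  have hwX : ∀ t x, w t (x + ε • ξ (t, x)) = v t x + ε • fderiv ℝ ξ (t, x) (1, v t x) :=
    fun t x => congrFun hw' (t, x)
  have hXm := measurable_perturbation hξ.continuous ε
  have hen : ∀ t, energy p (perturbed κ ξ ε) w t =
      energy p κ (fun t x => v t x + ε • fderiv ℝ ξ (t, x) (1, v t x)) t := by
    intro t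
    rw [energy, perturbed, lintegral_map (hwm.of_uncurry_left.enorm.pow_const p) (hXm t)]
    simp only [hwX]
    rfl
  have hvi := integrable_slab_of_energy_le hp.le hv.measurable hE
  refine ⟨w, ⟨hwm, ?_, fun φ hφ hφc => ?_⟩, hen⟩
  · filter_upwards [hv.finite] with t ht
    rw [hen]
    have hL := memLp_of_energy_lt_top hp0 hv.measurable ht
    have := (hL.add ((memLp_perturbed_velocity hξ hc (measurable_prodMk_left (x := t))
      hL).const_smul ε)).2
    rwa [eLpNorm_lt_top_iff_lintegral_rpow_enorm_lt_top (by simpa using hp0) (by simp),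
      ENNReal.toReal_ofReal hp0.le] at this
  -- the test function pulled back along the perturbation, cut off in time
  let χ : ContDiffBump (1 / 2 : ℝ) := ⟨1, 2, one_pos, one_lt_two⟩
  set Y : ℝ × Sp d → Sp d := fun z => z.2 + ε • ξ z
  have hY : ContDiff ℝ 1 Y := contDiff_snd.add (hξ.const_smul ε)
  set ψ : ℝ × Sp d → ℝ := fun z => χ z.1 * φ (Y z)
  have hψ : ContDiff ℝ 1 ψ := (χ.contDiff.comp contDiff_fst).mul (hφ.comp hY)
  obtain ⟨b, hb⟩ := hc.exists_bound_of_continuous hξ.continuous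
  obtain ⟨R, hR⟩ := hφc.isBounded.exists_norm_le
  have hψc : HasCompactSupport ψ := by
    refine HasCompactSupport.of_support_subset_isCompact (χ.hasCompactSupport.prod
      (isCompact_closedBall (0 : Sp d) (R + |ε| * b))) fun z hz => ?_
    have h1 : χ z.1 ≠ 0 := left_ne_zero_of_mul hz
    have h2 : φ (Y z) ≠ 0 := right_ne_zero_of_mul hz
    refine ⟨subset_tsupport _ h1, ?_⟩
    rw [mem_closedBall_zero_iff]
    have h3 := hR _ (subset_tsupport φ h2)
    have h4 : ‖ε • ξ z‖ ≤ |ε| * b := by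
      rw [norm_smul, Real.norm_eq_abs]; exact mul_le_mul_of_nonneg_left (hb z) (abs_nonneg _)
    have h5 : z.2 = Y z - ε • ξ z := by simp [Y]
    rw [h5]
    exact (norm_sub_le _ _).trans (add_le_add h3 h4)
  have hχ : ∀ t ∈ Icc (0 : ℝ) 1, ∀ᶠ s in 𝓝 t, χ s = 1 := by
    intro t ht
    have : Metric.ball (1 / 2 : ℝ) 1 ∈ 𝓝 t := Metric.isOpen_ball.mem_nhds (by
      rw [Metric.mem_ball, Real.dist_eq, abs_lt]; constructor <;> linarith [ht.1, ht.2])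
    filter_upwards [this] with s hs
    exact χ.one_of_mem_closedBall (Metric.ball_subset_closedBall hs)
  have hψ1 : ∀ t ∈ Icc (0 : ℝ) 1, ∀ x, ψ (t, x) = φ (x + ε • ξ (t, x)) := fun t ht x => by
    simp [ψ, Y, (hχ t ht).self_of_nhds]
  have hψd : ∀ t ∈ Icc (0 : ℝ) 1, ∀ x, fderiv ℝ ψ (t, x) (1, v t x) =
      fderiv ℝ φ (x + ε • ξ (t, x)) (w t (x + ε • ξ (t, x))) := by
    intro t ht x
    have heq : ψ =ᶠ[𝓝 (t, x)] φ ∘ Y := by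
      have : Tendsto (Prod.fst : ℝ × Sp d → ℝ) (𝓝 (t, x)) (𝓝 t) := continuous_fst.tendsto (t, x)
      filter_upwards [this.eventually (hχ t ht)] with z hz
      simp [ψ, hz]
    have hYd : HasFDerivAt Y (ContinuousLinearMap.snd ℝ ℝ (Sp d) + ε • fderiv ℝ ξ (t, x)) (t, x) :=
      hasFDerivAt_snd.add ((hξ.differentiable one_ne_zero (t, x)).hasFDerivAt.const_smul ε)
    rw [heq.fderiv_eq, ((hφ.differentiable one_ne_zero (Y (t, x))).hasFDerivAt.comp _ hYd).fderiv,
      hwX]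
    rfl
  have hint : ∀ t ∈ Icc (0 : ℝ) 1, ∫ x, fderiv ℝ φ x (w t x) ∂(perturbed κ ξ ε t) =
      ∫ x, fderiv ℝ ψ (t, x) (1, v t x) ∂(κ t) := by
    intro t ht
    rw [perturbed, integral_map (hXm t).aemeasurable]
    · exact integral_congr_ae (Eventually.of_forall fun x => (hψd t ht x).symm)
    · refine (ContinuousLinearMap.id ℝ (Sp d →L[ℝ] ℝ)).aestronglyMeasurable_comp₂
        (hφ.continuous_fderiv one_ne_zero).aestronglyMeasurable
        hwm.of_uncurry_left.aestronglyMeasurable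
  have hφint : ∀ t ∈ Icc (0 : ℝ) 1, ∫ x, φ x ∂(perturbed κ ξ ε t) = ∫ x, ψ (t, x) ∂(κ t) := by
    intro t ht
    rw [perturbed, integral_map (hXm t).aemeasurable hφ.continuous.aestronglyMeasurable]
    exact integral_congr_ae (Eventually.of_forall fun x => (hψ1 t ht x).symm)
  have hgi := integrable_integral_compProd (integrable_slab_fderiv_apply hψ hψc hvi)
  constructor
  · have : IntegrableOn (fun s => ∫ x, fderiv ℝ φ x (w s x) ∂(perturbed κ ξ ε s)) (Icc 0 1) := by
      refine Integrable.congr hgi ((ae_restrict_iff' measurableSet_Icc).2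
        (Eventually.of_forall fun t ht => ?_))
      exact (hint t ht).symm
    refine (this.mono_set ?_).intervalIntegrable
    rw [uIcc_of_le zero_le_one]
  · intro t₁ ht₁ t₂ ht₂ hlt
    rw [hφint t₁ ht₁, hφint t₂ ht₂, hv.integral_sub_eq hp hN h hE hψ hψc ht₁ ht₂ hlt.le]
    refine intervalIntegral.integral_congr fun s hs => ?_
    rw [uIcc_of_le hlt.le] at hs
    exact (hint s ⟨ht₁.1.trans hs.1, hs.2.trans ht₂.2⟩).symm

end Perturbation

/-! ### Perturbed curves are admissible, with an upper bound for their action. -/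

section Competitor

variable {p q α β C N : ℝ} {Ω : Set (Sp d)} {μ₀ μ₁ : Measure (Sp d)} {μ ν : ℝ → Measure (Sp d)}

theorem wDist_le_of_plan (hp : 0 < p) {m m' : Measure (Sp d)} {π : Measure (Sp d × Sp d)}
    (h1 : π.map Prod.fst = m) (h2 : π.map Prod.snd = m')
    (hi : Integrable (fun z => ‖z.1 - z.2‖ ^ p) π) {A : ℝ} (hA : 0 ≤ A)
    (h : ∫ z, ‖z.1 - z.2‖ ^ p ∂π ≤ A ^ p) : wDist p m m' ≤ ENNReal.ofReal A := by
  have e : ∫⁻ z, edist z.1 z.2 ^ p ∂π = ENNReal.ofReal (∫ z, ‖z.1 - z.2‖ ^ p ∂π) := by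
    rw [ofReal_integral_eq_lintegral_ofReal hi (Eventually.of_forall fun z => by positivity)]
    refine lintegral_congr fun z => ?_
    rw [edist_dist, dist_eq_norm, ENNReal.ofReal_rpow_of_nonneg (norm_nonneg _) hp.le]
  have h3 : (⨅ π ∈ couplings m m', ∫⁻ z, edist z.1 z.2 ^ p ∂π) ≤ ENNReal.ofReal A ^ p := by
    refine (iInf₂_le π ⟨h1, h2⟩).trans ?_
    rw [e, ENNReal.ofReal_rpow_of_nonneg hA hp.le]
    exact ENNReal.ofReal_le_ofReal h
  refine (ENNReal.rpow_le_rpow h3 (by positivity)).trans (le_of_eq ?_)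
  rw [← ENNReal.rpow_mul, mul_one_div_cancel hp.ne', ENNReal.rpow_one]

theorem wDist_self (hp : 0 < p) (m : Measure (Sp d)) : wDist p m m = 0 := by
  have hm : Measurable fun x : Sp d => (x, x) := measurable_id.prodMk measurable_id
  have hz : ∫ z, ‖z.1 - z.2‖ ^ p ∂(m.map fun x : Sp d => (x, x)) = 0 := by
    rw [integral_map hm.aemeasurable]
    · simp [Real.zero_rpow hp.ne']
    · have : Continuous fun z : Sp d × Sp d => ‖z.1 - z.2‖ ^ p :=
        (continuous_fst.sub continuous_snd).norm.rpow_const fun _ => Or.inr hp.le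
      exact this.aestronglyMeasurable
  have hi : Integrable (fun z => ‖z.1 - z.2‖ ^ p) (m.map fun x : Sp d => (x, x)) := by
    have hc : Continuous fun z : Sp d × Sp d => ‖z.1 - z.2‖ ^ p :=
      (continuous_fst.sub continuous_snd).norm.rpow_const fun _ => Or.inr hp.le
    rw [integrable_map_measure hc.aestronglyMeasurable hm.aemeasurable]
    refine (integrable_zero _ _ _).congr (Eventually.of_forall fun x => ?_)
    simp [Real.zero_rpow hp.ne']
  have h1 : (m.map fun x : Sp d => (x, x)).map Prod.fst = m := by
    rw [Measure.map_map measurable_fst hm]; exact Measure.map_id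
  have h2 : (m.map fun x : Sp d => (x, x)).map Prod.snd = m := by
    rw [Measure.map_map measurable_snd hm]; exact Measure.map_id
  have := wDist_le_of_plan hp h1 h2 hi le_rfl (by rw [hz]; positivity)
  simpa using this

theorem IsCoupled.wDist_le (hp : 0 < p) (h : IsCoupled p C μ) {s t : ℝ} (hs : s ∈ Icc (0 : ℝ) 1)
    (ht : t ∈ Icc (0 : ℝ) 1) : wDist p (μ s) (μ t) ≤ ENNReal.ofReal (C * |s - t|) := by
  rcases eq_or_ne s t with rfl | hst
  · simp [wDist_self hp]
  · obtain ⟨π, h1, h2, h3, h4⟩ := h.plan s hs t ht hst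
    exact wDist_le_of_plan hp h1 h2 h3 (mul_nonneg h.pos.le (abs_nonneg _)) h4

theorem IsCoupled.isLipschitzCurve (hp : 0 < p) (h : IsCoupled p C μ)
    (hmem : ∀ t ∈ Icc (0 : ℝ) 1, μ t ∈ wSpace p Ω) (h0 : μ 0 = μ₀) (h1 : μ 1 = μ₁) :
    IsLipschitzCurve p Ω μ₀ μ₁ μ := by
  refine ⟨hmem, ⟨C.toNNReal, fun s hs t ht => (h.wDist_le hp hs ht).trans (le_of_eq ?_)⟩, h0, h1⟩
  rw [ENNReal.ofReal_mul h.pos.le, edist_dist, Real.dist_eq]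
  rfl

theorem action_congr (h : ∀ t ∈ Icc (0 : ℝ) 1, μ t = ν t) :
    action p q α β Ω μ = action p q α β Ω ν := by
  have key : ∀ {μ ν : ℝ → Measure (Sp d)}, (∀ t ∈ Icc (0 : ℝ) 1, μ t = ν t) →
      action p q α β Ω μ ≤ action p q α β Ω ν := by
    intro μ ν h
    refine le_iInf₂ fun v hv => (iInf₂_le v (hv.congr fun t ht => (h t ht).symm)).trans
      (le_of_eq (setLIntegral_congr_fun measurableSet_Icc fun t ht => ?_))
    simp only [h t ht, energy_congr h ht]
  exact le_antisymm (key h) (key fun t ht => (h t ht).symm)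

variable {ξ : ℝ × Sp d → Sp d}

theorem add_rpow_le_two_rpow (hp : 0 < p) {a b : ℝ} (ha : 0 ≤ a) (hb : 0 ≤ b) :
    (a + b) ^ p ≤ 2 ^ p * (a ^ p + b ^ p) := by
  have h1 : a + b ≤ 2 * max a b := by linarith [le_max_left a b, le_max_right a b]
  calc (a + b) ^ p ≤ (2 * max a b) ^ p := by gcongr
    _ = 2 ^ p * max a b ^ p := Real.mul_rpow (by norm_num) (le_max_of_le_left ha)
    _ ≤ 2 ^ p * (a ^ p + b ^ p) := by
      gcongr
      rcases max_choice a b with h | h <;> rw [h]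
      · linarith [Real.rpow_nonneg hb p]
      · linarith [Real.rpow_nonneg ha p]

/-- The product of the maps at times s and t pushes a plan forward. Joint Lipschitz continuity of
`ξ` bounds the new distance by a multiple of the old one plus |s - t|. -/
theorem IsCoupled.exists_perturbed (hp : 0 < p) (h : IsCoupled p C μ) {L : ℝ≥0}
    (hL : LipschitzWith L ξ) (ε : ℝ) : ∃ D, IsCoupled p D (perturbed μ ξ ε) := by
  have hC := h.pos
  set A : ℝ := 1 + |ε| * L
  have hA : 0 < A := by positivity
  have hX := measurable_perturbation hL.continuous ε
  -- Here `A` is the Lipschitz factor of the maps, 2 comes from (a + b)^p ≤ 2^p (a^p + b^p), and C^p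
  -- + 1 adds the cost of the old plan and the increment of time.
  refine ⟨2 * A * (C ^ p + 1) ^ (1 / p), by positivity, fun t ht => ?_, fun s hs t ht hst => ?_⟩
  · have := h.prob t ht
    exact Measure.isProbabilityMeasure_map (hX t).aemeasurable
  obtain ⟨π, h1, h2, h3, h4⟩ := h.plan s hs t ht hst
  have := h.prob s hs
  have : IsProbabilityMeasure π := isProbabilityMeasure_of_map_fst h1
  have hm : Measurable (Prod.map (fun x : Sp d => x + ε • ξ (s, x)) fun x => x + ε • ξ (t, x)) :=
    (hX s).prodMap (hX t)
  have hcont : Continuous fun z : Sp d × Sp d => ‖z.1 - z.2‖ ^ p :=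
    (continuous_fst.sub continuous_snd).norm.rpow_const fun _ => Or.inr hp.le
  have hb : ∀ z : Sp d × Sp d, ‖(z.1 + ε • ξ (s, z.1)) - (z.2 + ε • ξ (t, z.2))‖ ^ p ≤
      A ^ p * (2 ^ p * (‖z.1 - z.2‖ ^ p + |s - t| ^ p)) := by
    intro z
    have e1 : ‖ξ (s, z.1) - ξ (t, z.2)‖ ≤ L * (‖z.1 - z.2‖ + |s - t|) := by
      refine (hL.norm_sub_le _ _).trans (mul_le_mul_of_nonneg_left ?_ L.2)
      rw [Prod.mk_sub_mk, Prod.norm_def]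
      refine max_le ?_ ?_
      · rw [Real.norm_eq_abs]; linarith [norm_nonneg (z.1 - z.2)]
      · linarith [abs_nonneg (s - t)]
    have e2 : ‖(z.1 + ε • ξ (s, z.1)) - (z.2 + ε • ξ (t, z.2))‖ ≤
        A * (‖z.1 - z.2‖ + |s - t|) := by
      have : (z.1 + ε • ξ (s, z.1)) - (z.2 + ε • ξ (t, z.2)) =
          (z.1 - z.2) + ε • (ξ (s, z.1) - ξ (t, z.2)) := by rw [smul_sub]; abel
      rw [this]
      refine (norm_add_le _ _).trans ?_
      rw [norm_smul, Real.norm_eq_abs]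
      have := mul_le_mul_of_nonneg_left e1 (abs_nonneg ε)
      have := abs_nonneg (s - t)
      simp only [A]
      linarith
    calc _ ≤ (A * (‖z.1 - z.2‖ + |s - t|)) ^ p := by gcongr
      _ = A ^ p * (‖z.1 - z.2‖ + |s - t|) ^ p := Real.mul_rpow hA.le (by positivity)
      _ ≤ _ := by
        gcongr
        exact add_rpow_le_two_rpow hp (norm_nonneg _) (abs_nonneg _)
  have hbi : Integrable (fun z : Sp d × Sp d =>
      A ^ p * (2 ^ p * (‖z.1 - z.2‖ ^ p + |s - t| ^ p))) π :=
    ((h3.add (integrable_const _)).const_mul _).const_mul _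
  refine ⟨π.map (Prod.map (fun x => x + ε • ξ (s, x)) fun x => x + ε • ξ (t, x)), ?_, ?_, ?_, ?_⟩
  · rw [Measure.map_map measurable_fst hm, perturbed, ← h1,
      Measure.map_map (hX s) measurable_fst]
    rfl
  · rw [Measure.map_map measurable_snd hm, perturbed, ← h2,
      Measure.map_map (hX t) measurable_snd]
    rfl
  · rw [integrable_map_measure hcont.aestronglyMeasurable hm.aemeasurable]
    refine hbi.mono' ((hcont.measurable.comp hm).aestronglyMeasurable)
      (Eventually.of_forall fun z => ?_)
    rw [Function.comp_apply, Real.norm_of_nonneg (by positivity)]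
    exact hb z
  · rw [integral_map hm.aemeasurable hcont.aestronglyMeasurable]
    calc _ ≤ ∫ z, A ^ p * (2 ^ p * (‖z.1 - z.2‖ ^ p + |s - t| ^ p)) ∂π :=
          integral_mono_of_nonneg (Eventually.of_forall fun z => by positivity) hbi
            (Eventually.of_forall hb)
      _ = A ^ p * (2 ^ p * (∫ z, ‖z.1 - z.2‖ ^ p ∂π + |s - t| ^ p)) := by
        rw [integral_const_mul, integral_const_mul, integral_add h3 (integrable_const _)]
        simp
      _ ≤ A ^ p * (2 ^ p * ((C * |s - t|) ^ p + |s - t| ^ p)) := by gcongr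
      _ = _ := by
        rw [Real.mul_rpow hC.le (abs_nonneg _), Real.mul_rpow (by positivity) (abs_nonneg _),
          Real.mul_rpow (by positivity) (by positivity), Real.mul_rpow (by positivity) hA.le,
          ← Real.rpow_mul (by positivity), one_div_mul_cancel hp.ne', Real.rpow_one]
        ring

theorem perturbed_mem_wSpace (hp : 1 < p) (hξ : Continuous ξ) (hc : HasCompactSupport ξ) {ε t : ℝ}
    (hμ : μ t ∈ wSpace p Ω) (hΩ : MeasurableSet Ω) (hmaps : ∀ x ∈ Ω, x + ε • ξ (t, x) ∈ Ω) :
    perturbed μ ξ ε t ∈ wSpace p Ω := by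
  obtain ⟨h1, h2, h3⟩ := hμ
  have hp0 : 0 < p := by linarith
  have hX := measurable_perturbation hξ ε t
  refine ⟨Measure.isProbabilityMeasure_map hX.aemeasurable, ?_, ?_⟩
  · rw [perturbed, Measure.map_apply hX hΩ.compl]
    exact measure_mono_null (fun x hx hxΩ => hx (hmaps x hxΩ)) h2
  · obtain ⟨b, hb⟩ := hc.exists_bound_of_continuous hξ
    have e1 : MemLp (fun x : Sp d => x) (ENNReal.ofReal p) (μ t) := by
      refine ⟨measurable_id.aestronglyMeasurable, ?_⟩
      rwa [eLpNorm_lt_top_iff_lintegral_rpow_enorm_lt_top (by simpa using hp0) (by simp),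
        ENNReal.toReal_ofReal hp0.le]
    have e2 : MemLp (fun x : Sp d => ξ (t, x)) (ENNReal.ofReal p) (μ t) :=
      MemLp.of_bound (by
        have : Continuous fun x : Sp d => ξ (t, x) := by fun_prop
        exact this.aestronglyMeasurable) b (Eventually.of_forall fun x => hb _)
    have := (e1.add (e2.const_smul ε)).2
    rw [perturbed, lintegral_map (by fun_prop) hX]
    rwa [eLpNorm_lt_top_iff_lintegral_rpow_enorm_lt_top (by simpa using hp0) (by simp),
        ENNReal.toReal_ofReal hp0.le] at this

theorem perturbed_eq_self {ε t : ℝ} (h : ∀ x, ξ (t, x) = 0) : perturbed μ ξ ε t = μ t := by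
  simp only [perturbed, h, smul_zero, add_zero]
  exact Measure.map_id

variable {κ : ProbabilityTheory.Kernel ℝ (Sp d)} [ProbabilityTheory.IsMarkovKernel κ]
  {v : ℝ → Sp d → Sp d}

/-- The tangent field of the perturbed curve is not explicit. It exists because the transported
field is in L^p of space-time, and its energy is at most the energy of that field, which is all that
is required of a competitor. -/
theorem action_perturbed_le (hp : 1 < p) (hβ : 0 ≤ β) (hN : 0 ≤ N) (h : IsCoupled p C κ)
    (hv : IsVelocityField p κ v)
    (hE : ∀ᵐ t ∂(volume.restrict (Icc (0 : ℝ) 1)), energy p κ v t ≤ ENNReal.ofReal N)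
    (hξ : ContDiff ℝ 1 ξ) (hc : HasCompactSupport ξ) {ε : ℝ}
    (hinj : ∀ t, Function.Injective fun x => x + ε • ξ (t, x)) :
    action p q α β Ω (perturbed κ ξ ε) ≤ ∫⁻ t in Icc (0 : ℝ) 1, Lq q Ω (perturbed κ ξ ε t) ^ α *
      energy p κ (fun t x => v t x + ε • fderiv ℝ ξ (t, x) (1, v t x)) t ^ β := by
  have hp0 : 0 < p := by linarith
  obtain ⟨w, hw, hwe⟩ := hv.exists_perturbed hp hN h hE hξ hc hinj
  obtain ⟨L, hL⟩ : ∃ L : ℝ≥0, LipschitzWith L ξ :=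
    ⟨_, (hξ.lipschitzWith_of_hasCompactSupport hc one_ne_zero).choose_spec⟩
  obtain ⟨D, hD⟩ := h.exists_perturbed hp0 hL ε
  obtain ⟨κ', _, hκ'⟩ := hD.exists_kernel hp0
  have hw' := hw.congr fun t ht => (hκ' t ht).symm
  have hmem : MemLp (Function.uncurry w) (ENNReal.ofReal p) (slab κ' (Icc 0 1)) := by
    rw [memLp_slab_iff hp0 hw.measurable]
    have e : ∫⁻ t in Icc (0 : ℝ) 1, energy p κ' w t = ∫⁻ t in Icc (0 : ℝ) 1,
        energy p κ (fun t x => v t x + ε • fderiv ℝ ξ (t, x) (1, v t x)) t :=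
      setLIntegral_congr_fun measurableSet_Icc fun t ht => by
        rw [energy_congr hκ' ht, hwe]
    rw [e, ← memLp_slab_iff hp0 (hv.measurable.add
      ((measurable_fderiv_velocity hξ hv.measurable).const_smul ε))]
    have hvL := memLp_slab_of_energy_le hp0 hv.measurable hE
    exact hvL.add ((memLp_perturbed_velocity hξ hc measurable_id hvL).const_smul ε)
  obtain ⟨v', hv'⟩ := hw'.exists_isTangentField hp hmem
  have hv'' := hv'.congr hκ'
  rw [action_eq _ _ _ _ _ _ v' hv'']
  refine lintegral_mono_ae ?_
  filter_upwards [hv''.minimal w hw] with t ht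
  rw [hwe] at ht
  gcongr

end Competitor

/-! ### The functional L_q under a diffeomorphism onto its image. -/

section ChangeOfVariables

/-- The image density at X(x) is f(x) / |det X'(x)|, and changing variables in its q-th power leaves
|det X'|^(1-q). It is an inequality because the integral over Ω is enlarged to the whole space. -/
theorem Lq_map_le {q : ℝ} (hq : 0 < q) (Ω : Set (Sp d)) {f : Sp d → ℝ≥0∞} (hf : Measurable f)
    {X : Sp d → Sp d} {X' : Sp d → Sp d →L[ℝ] Sp d} (hX : ∀ x, HasFDerivAt X (X' x) x)
    (hX' : Continuous X') (hinj : Function.Injective X) (hdet : ∀ x, 0 < |(X' x).det|) :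
    Lq q Ω ((volume.withDensity f).map X) ≤
      ∫⁻ x, f x ^ q * ENNReal.ofReal (|(X' x).det| ^ (1 - q)) := by
  have hXc : Continuous X := continuous_iff_continuousAt.2 fun x => (hX x).continuousAt
  have hXe : MeasurableEmbedding X := hXc.measurableEmbedding hinj
  have hdm : Measurable fun x => ENNReal.ofReal |(X' x).det| := by
    have : Continuous fun x => |(X' x).det| := (ContinuousLinearMap.continuous_det.comp hX').abs
    exact this.measurable.ennreal_ofReal
  obtain ⟨g₀, hg₀, hg⟩ := hXe.exists_measurable_extend (hf.mul hdm.inv) fun _ => ⟨0⟩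
  have hgX : ∀ x, g₀ (X x) = f x * (ENNReal.ofReal |(X' x).det|)⁻¹ := fun x => congrFun hg x
  -- The measurable extension `g₀` is arbitrary off the range of `X`, where the image measure has
  -- density 0.
  set g := (range X).indicator g₀
  have hgm : Measurable g := hg₀.indicator hXe.measurableSet_range
  have hgX' : ∀ x, g (X x) = f x * (ENNReal.ofReal |(X' x).det|)⁻¹ := fun x => by
    rw [← hgX]; exact indicator_of_mem (mem_range_self x) g₀
  have hcv : ∀ (s : Set (Sp d)), MeasurableSet s → ∀ G : Sp d → ℝ≥0∞,
      ∫⁻ y in X '' s, G y = ∫⁻ x in s, ENNReal.ofReal |(X' x).det| * G (X x) := fun s hs G =>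
    lintegral_image_eq_lintegral_abs_det_fderiv_mul volume hs
      (fun x _ => (hX x).hasFDerivWithinAt) hinj.injOn G
  have hd0 : ∀ x, ENNReal.ofReal |(X' x).det| ≠ 0 := fun x => by simpa using hdet x
  have hmap : (volume.withDensity f).map X = volume.withDensity g := by
    ext s hs
    rw [Measure.map_apply hXc.measurable hs, withDensity_apply _ (hXc.measurable hs),
      withDensity_apply _ hs, setLIntegral_indicator hXe.measurableSet_range,
      inter_comm, ← image_preimage_eq_inter_range, hcv _ (hXc.measurable hs)]
    refine lintegral_congr fun x => ?_
    rw [hgX, mul_comm (f x), ← mul_assoc, ENNReal.mul_inv_cancel (hd0 x) ENNReal.ofReal_ne_top,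
      one_mul]
  rw [hmap, Lq, if_pos (withDensity_absolutelyContinuous _ _)]
  calc ∫⁻ x in Ω, (volume.withDensity g).rnDeriv volume x ^ q
      ≤ ∫⁻ x, (volume.withDensity g).rnDeriv volume x ^ q := setLIntegral_le_lintegral _ _
    _ = ∫⁻ x, g x ^ q := lintegral_congr_ae (by
        filter_upwards [Measure.rnDeriv_withDensity volume hgm] with x hx
        rw [hx])
    _ = ∫⁻ x in X '' univ, g₀ x ^ q := by
        rw [image_univ, ← lintegral_indicator hXe.measurableSet_range]
        refine lintegral_congr fun x => ?_
        by_cases hx : x ∈ range X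
        · simp [g, hx]
        · simp [g, hx, hq]
    _ = ∫⁻ x, f x ^ q * ENNReal.ofReal (|(X' x).det| ^ (1 - q)) := by
        rw [hcv _ MeasurableSet.univ, Measure.restrict_univ]
        refine lintegral_congr fun x => ?_
        rw [hgX, ENNReal.mul_rpow_of_nonneg _ _ hq.le, ← ENNReal.ofReal_rpow_of_pos (hdet x),
          ENNReal.rpow_sub _ _ (hd0 x) ENNReal.ofReal_ne_top, ENNReal.rpow_one,
          ENNReal.inv_rpow, ENNReal.div_eq_inv_mul]
        ring

end ChangeOfVariables

/-! ### Small perturbations preserve Ω and are injective. -/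

section Admissible

variable {ξ : ℝ × Sp d → Sp d} {Ω : Set (Sp d)}

/-- A point moves only if it lies in the spatial projection of the support, a compact subset of the
interior of Ω, and a short displacement does not leave the interior. -/
theorem exists_maps_of_tsupport_subset (hξ : Continuous ξ) (hc : HasCompactSupport ξ)
    (hs : tsupport ξ ⊆ univ ×ˢ interior Ω) :
    ∃ δ > 0, ∀ ε : ℝ, |ε| < δ → ∀ t, ∀ x ∈ Ω, x + ε • ξ (t, x) ∈ Ω := by
  obtain ⟨δ, hδ, hsub⟩ := (hc.isCompact.image continuous_snd).exists_cthickening_subset_open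
    isOpen_interior (image_subset_iff.2 fun z hz => (hs hz).2)
  obtain ⟨b, hb⟩ := hc.exists_bound_of_continuous hξ
  have hb0 : 0 ≤ b := (norm_nonneg _).trans (hb 0)
  refine ⟨δ / (b + 1), by positivity, fun ε hε t x hx => ?_⟩
  by_cases h : ξ (t, x) = 0
  · simpa [h]
  refine interior_subset (hsub (Metric.mem_cthickening_of_dist_le _ x _ _
    ⟨(t, x), subset_tsupport _ h, rfl⟩ ?_))
  rw [dist_eq_norm, add_sub_cancel_left, norm_smul, Real.norm_eq_abs]
  rw [lt_div_iff₀ (by positivity)] at hε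
  calc |ε| * ‖ξ (t, x)‖ ≤ |ε| * (b + 1) := by gcongr; linarith [hb (t, x)]
    _ ≤ δ := hε.le

theorem exists_injective_perturbation (hξ : ContDiff ℝ 1 ξ) (hc : HasCompactSupport ξ) :
    ∃ δ > 0, ∀ ε : ℝ, |ε| < δ → ∀ t, Function.Injective fun x => x + ε • ξ (t, x) := by
  obtain ⟨L, hL⟩ := hξ.lipschitzWith_of_hasCompactSupport hc one_ne_zero
  refine ⟨1 / (L + 1), by positivity, fun ε hε t x y hxy => ?_⟩
  rw [lt_div_iff₀ (by positivity)] at hε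
  have e : x - y = ε • (ξ (t, y) - ξ (t, x)) := by
    simp only at hxy
    rw [smul_sub, sub_eq_sub_iff_add_eq_add, hxy, add_comm]
  have h1 : ‖x - y‖ ≤ |ε| * L * ‖x - y‖ := by
    calc ‖x - y‖ = |ε| * ‖ξ (t, y) - ξ (t, x)‖ := by
          conv_lhs => rw [e]
          rw [norm_smul, Real.norm_eq_abs]
      _ ≤ |ε| * (L * ‖(t, y) - (t, x)‖) := by gcongr; exact hL.norm_sub_le _ _
      _ = |ε| * L * ‖x - y‖ := by simp [Prod.norm_def, norm_sub_rev y x, mul_assoc]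
  have h2 : ‖x - y‖ = 0 := by
    have := norm_nonneg (x - y)
    have := abs_nonneg ε
    by_contra hne
    have : 0 < ‖x - y‖ := by positivity
    nlinarith
  exact sub_eq_zero.1 (norm_eq_zero.1 h2)

end Admissible

/-! ### Jointly measurable densities and regular times. -/

section Density

variable {p q α β : ℝ} {Ω : Set (Sp d)} {κ : ProbabilityTheory.Kernel ℝ (Sp d)}
  [ProbabilityTheory.IsMarkovKernel κ] {u : ℝ → Sp d → ℝ} {v : ℝ → Sp d → Sp d}

theorem exists_measurable_density (κ : ProbabilityTheory.Kernel ℝ (Sp d))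
    [ProbabilityTheory.IsMarkovKernel κ] :
    ∃ r : ℝ → Sp d → ℝ≥0∞, Measurable (Function.uncurry r) ∧
      ∀ t, κ t ≪ volume → κ t = volume.withDensity (r t) := by
  -- Densities of kernels are taken with respect to a finite measure with the same null sets as
  -- Lebesgue measure; the density with respect to Lebesgue measure is a product.
  set m : Measure (Sp d) := (volume : Measure (Sp d)).toFinite
  set η : ProbabilityTheory.Kernel ℝ (Sp d) := ProbabilityTheory.Kernel.const ℝ m
  have hr := ProbabilityTheory.Kernel.measurable_rnDeriv κ η
  have hρ : Measurable (m.rnDeriv volume) := Measure.measurable_rnDeriv _ _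
  have hm : volume.withDensity (m.rnDeriv volume) = m :=
    Measure.withDensity_rnDeriv_eq _ _ (toFinite_absolutelyContinuous _)
  refine ⟨fun t x => m.rnDeriv volume x * ProbabilityTheory.Kernel.rnDeriv κ η t x,
    (hρ.comp measurable_snd).mul hr, fun t ht => ?_⟩
  have h1 : κ t ≪ η t := ht.trans (absolutelyContinuous_toFinite _)
  have h2 := ProbabilityTheory.Kernel.withDensity_rnDeriv_eq h1
  rw [ProbabilityTheory.Kernel.withDensity_apply _ hr] at h2
  rw [← h2, ProbabilityTheory.Kernel.const_apply]
  conv_lhs => rw [← hm]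
  exact (withDensity_mul _ hρ hr.of_uncurry_left).symm

theorem Lq_withDensity {f : Sp d → ℝ≥0∞} (hf : Measurable f) :
    Lq q Ω (volume.withDensity f) = ∫⁻ x in Ω, f x ^ q := by
  rw [Lq, if_pos (withDensity_absolutelyContinuous _ _)]
  refine lintegral_congr_ae (ae_restrict_of_ae ?_)
  filter_upwards [Measure.rnDeriv_withDensity volume hf] with x hx
  rw [hx]

theorem measurable_Lq (q : ℝ) (Ω : Set (Sp d)) (κ : ProbabilityTheory.Kernel ℝ (Sp d))
    [ProbabilityTheory.IsMarkovKernel κ] : Measurable fun t => Lq q Ω (κ t) := by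
  classical
  obtain ⟨r, hr, h⟩ := exists_measurable_density κ
  have hS : MeasurableSet {t | κ t ≪ volume} := by
    have := ProbabilityTheory.Kernel.measurableSet_absolutelyContinuous κ
      (ProbabilityTheory.Kernel.const ℝ (volume : Measure (Sp d)).toFinite)
    convert this using 3 with t
    rw [ProbabilityTheory.Kernel.const_apply]
    exact ⟨fun h => h.trans (absolutelyContinuous_toFinite _),
      fun h => h.trans (toFinite_absolutelyContinuous _)⟩
  have e : (fun t => Lq q Ω (κ t)) = fun t =>
      if κ t ≪ volume then ∫⁻ x in Ω, r t x ^ q else ⊤ := by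
    funext t
    by_cases ht : κ t ≪ volume
    · rw [if_pos ht]
      conv_lhs => rw [h t ht]
      exact Lq_withDensity hr.of_uncurry_left
    · rw [if_neg ht, Lq, if_neg ht]
  rw [e]
  exact Measurable.ite hS (Measurable.lintegral_prod_right' (hr.pow_const q)) measurable_const

theorem exists_isDensity (h : ∀ᵐ t ∂(volume.restrict (Icc (0 : ℝ) 1)), κ t ≪ volume) :
    ∃ u : ℝ → Sp d → ℝ, IsDensity κ u := by
  obtain ⟨r, hr, hκ⟩ := exists_measurable_density κ
  refine ⟨fun t x => (r t x).toReal, hr.ennreal_toReal, fun t x => ENNReal.toReal_nonneg, ?_⟩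
  filter_upwards [h] with t ht
  have hfin : ∀ᵐ x, r t x < ⊤ := by
    refine ae_lt_top hr.of_uncurry_left ?_
    have : κ t univ = 1 := measure_univ
    rw [hκ t ht, withDensity_apply _ MeasurableSet.univ, Measure.restrict_univ] at this
    simp [this]
  conv_lhs => rw [hκ t ht]
  refine withDensity_congr_ae ?_
  filter_upwards [hfin] with x hx
  rw [ENNReal.ofReal_toReal hx.ne]

/-- At the time `t` the curve has the density `u t`, and `F t = ∫ (u t)^q` and
`V t = ∫ |v t|^p u t` are finite and positive. -/
structure IsRegularTime (p q : ℝ) (κ : ℝ → Measure (Sp d)) (u : ℝ → Sp d → ℝ)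
    (v : ℝ → Sp d → Sp d) (F V : ℝ → ℝ) (t : ℝ) : Prop where
  eq : κ t = densMeasure (u t)
  integrable : Integrable fun x => u t x ^ q
  pressure : F t = ∫ x, u t x ^ q
  pressure_pos : 0 < F t
  memLp : MemLp (v t) (ENNReal.ofReal p) (κ t)
  kinetic : V t = ∫ x, ‖v t x‖ ^ p ∂(κ t)
  kinetic_pos : 0 < V t

theorem energy_eq_ofReal (hp : 0 < p) {μ : ℝ → Measure (Sp d)} {t : ℝ}
    (h : MemLp (v t) (ENNReal.ofReal p) (μ t)) :
    energy p μ v t = ENNReal.ofReal (∫ x, ‖v t x‖ ^ p ∂(μ t)) := by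
  rw [ofReal_integral_eq_lintegral_ofReal (integrable_norm_rpow_of_memLp hp h)
    (Eventually.of_forall fun z => by positivity), energy]
  refine lintegral_congr fun z => ?_
  rw [← ofReal_norm, ENNReal.ofReal_rpow_of_nonneg (norm_nonneg _) hp.le]

/-- The integral over Ω is one over the whole space, since the measure is carried by Ω. It is
positive: otherwise the density would vanish almost everywhere, which is impossible for a
probability measure. -/
theorem isRegularTime_of_lt_top (hp : 0 < p) (hq : 0 < q) (hΩ : MeasurableSet Ω)
    {m : ℝ → Measure (Sp d)} {t : ℝ} (hm : IsProbabilityMeasure (m t)) (hmΩ : m t Ωᶜ = 0)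
    (hum : Measurable (u t)) (hu : ∀ x, 0 ≤ u t x) (hv : Measurable (Function.uncurry v))
    (heq : m t = densMeasure (u t)) (hL : Lq q Ω (m t) < ⊤) (hE : energy p m v t < ⊤)
    (hE0 : 0 < energy p m v t) :
    IsRegularTime p q m u v (fun t => (Lq q Ω (m t)).toReal)
      (fun t => (energy p m v t).toReal) t := by
  have hLe : Lq q Ω (m t) = ∫⁻ x, ENNReal.ofReal (u t x) ^ q := by
    rw [heq, densMeasure, Lq_withDensity hum.ennreal_ofReal, ← lintegral_indicator hΩ]
    have h0 : ∀ᵐ x, x ∈ Ωᶜ → ENNReal.ofReal (u t x) = 0 := by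
      rw [heq, densMeasure, withDensity_apply _ hΩ.compl,
        lintegral_eq_zero_iff hum.ennreal_ofReal] at hmΩ
      exact (ae_restrict_iff' hΩ.compl).1 hmΩ
    refine lintegral_congr_ae ?_
    filter_upwards [h0] with x hx
    by_cases hxΩ : x ∈ Ω
    · rw [indicator_of_mem hxΩ]
    · rw [indicator_of_notMem hxΩ, hx hxΩ, ENNReal.zero_rpow_of_pos hq]
  have e : ∀ x, ENNReal.ofReal (u t x) ^ q = ENNReal.ofReal (u t x ^ q) := fun x =>
    ENNReal.ofReal_rpow_of_nonneg (hu x) hq.le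
  have hnn : 0 ≤ᵐ[volume] fun x => u t x ^ q :=
    Eventually.of_forall fun x => Real.rpow_nonneg (hu x) q
  have hint : Integrable fun x => u t x ^ q := by
    refine ⟨(hum.pow_const q).aestronglyMeasurable, ?_⟩
    rw [hasFiniteIntegral_iff_ofReal hnn]
    simpa only [hLe, e] using hL
  have hLr : Lq q Ω (m t) = ENNReal.ofReal (∫ x, u t x ^ q) := by
    rw [ofReal_integral_eq_lintegral_ofReal hint hnn, hLe]
    simp only [e]
  have hF0 : 0 ≤ ∫ x, u t x ^ q := integral_nonneg_of_ae hnn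
  have hM := memLp_of_energy_lt_top hp hv hE
  have hEr := energy_eq_ofReal hp hM
  have hV0 : 0 ≤ ∫ x, ‖v t x‖ ^ p ∂(m t) := integral_nonneg fun x => by positivity
  refine ⟨heq, hint, by rw [hLr, ENNReal.toReal_ofReal hF0], ?_, hM,
    by rw [hEr, ENNReal.toReal_ofReal hV0], ENNReal.toReal_pos hE0.ne' hE.ne⟩
  refine ENNReal.toReal_pos (fun h0 => ?_) hL.ne
  rw [hLr, ENNReal.ofReal_eq_zero] at h0
  have h1 := (integral_eq_zero_iff_of_nonneg_ae hnn hint).1 (le_antisymm h0 hF0)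
  have h2 : m t = 0 := by
    rw [heq, densMeasure, withDensity_eq_zero_iff hum.ennreal_ofReal.aemeasurable]
    filter_upwards [h1] with x hx
    have := (Real.rpow_eq_zero (hu x) hq.ne').1 hx
    simp [this]
  have h3 : m t univ = 1 := hm.measure_univ
  simp [h2] at h3

theorem IsRegularTime.integral_eq {F V : ℝ → ℝ} {t : ℝ} {E : Type*} [NormedAddCommGroup E]
    [NormedSpace ℝ E] {m : ℝ → Measure (Sp d)} (h : IsRegularTime p q m u v F V t)
    (hum : Measurable (u t)) (hu : ∀ x, 0 ≤ u t x) (g : Sp d → E) :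
    ∫ x, g x ∂(m t) = ∫ x, u t x • g x := by
  rw [h.eq, densMeasure, integral_withDensity_eq_integral_toReal_smul hum.ennreal_ofReal (by simp)]
  simp only [ENNReal.toReal_ofReal (hu _)]

theorem IsRegularTime.integrable_iff {F V : ℝ → ℝ} {t : ℝ} {E : Type*} [NormedAddCommGroup E]
    [NormedSpace ℝ E] {m : ℝ → Measure (Sp d)} (h : IsRegularTime p q m u v F V t)
    (hum : Measurable (u t)) (hu : ∀ x, 0 ≤ u t x) {g : Sp d → E} :
    Integrable g (m t) ↔ Integrable fun x => u t x • g x := by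
  rw [h.eq, densMeasure, integrable_withDensity_iff_integrable_smul' hum.ennreal_ofReal (by simp)]
  simp only [ENNReal.toReal_ofReal (hu _)]

theorem ae_energy_pos {μ : ℝ → Measure (Sp d)}
    (hV : ∀ a b : ℝ, 0 < a → a < b → b < 1 → ∃ V₀ : ℝ≥0∞, 0 < V₀ ∧
      ∀ᵐ t ∂(volume.restrict (Icc a b)), V₀ ≤ energy p μ v t) :
    ∀ᵐ t ∂(volume.restrict (Icc (0 : ℝ) 1)), 0 < energy p μ v t := by
  -- These intervals exhaust ]0,1[; the shift by 3 keeps their end points in order already for n =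
  -- 0.
  have h : ∀ n : ℕ, ∀ᵐ t : ℝ, t ∈ Icc (1 / (n + 3 : ℝ)) (1 - 1 / (n + 3 : ℝ)) →
      0 < energy p μ v t := by
    intro n
    have h3 : (0 : ℝ) < n + 3 := by positivity
    obtain ⟨V₀, h0, h1⟩ := hV (1 / (n + 3 : ℝ)) (1 - 1 / (n + 3 : ℝ)) (by positivity) (by
      have : 1 / (n + 3 : ℝ) ≤ 1 / 3 := by gcongr; linarith [(n.cast_nonneg : (0 : ℝ) ≤ n)]
      linarith) (by have : 0 < 1 / (n + 3 : ℝ) := by positivity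
                    linarith)
    filter_upwards [(ae_restrict_iff' measurableSet_Icc).1 h1] with t ht hmem
    exact h0.trans_le (ht hmem)
  filter_upwards [ae_restrict_of_ae (ae_all_iff.2 h), ae_Icc_mem_Ioo] with t ht hmem
  obtain ⟨n, hn⟩ := exists_nat_one_div_lt (lt_min hmem.1 (sub_pos.2 hmem.2))
  have hle : 1 / (n + 3 : ℝ) ≤ 1 / ((n : ℝ) + 1) := by gcongr; norm_num
  have h1 := hle.trans_lt hn
  rw [lt_min_iff] at h1
  exact ht n ⟨h1.1.le, by linarith [h1.2]⟩

end Density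

/-! ### The first variation of the functional. -/

section Variation

/-- The spatial part of the derivative of `ξ`. -/
noncomputable def spaceFDeriv (ξ : ℝ × Sp d → Sp d) (z : ℝ × Sp d) : Sp d →L[ℝ] Sp d :=
  (fderiv ℝ ξ z).comp (ContinuousLinearMap.inr ℝ ℝ (Sp d))

theorem traceSp_spaceFDeriv (ξ : ℝ × Sp d → Sp d) (z : ℝ × Sp d) :
    traceSp (spaceFDeriv ξ z) = spaceDiv ξ z := rfl

variable {ξ : ℝ × Sp d → Sp d}

theorem continuous_spaceFDeriv (hξ : ContDiff ℝ 1 ξ) : Continuous (spaceFDeriv ξ) :=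
  (hξ.continuous_fderiv one_ne_zero).clm_comp continuous_const

theorem hasFDerivAt_perturbation (hξ : ContDiff ℝ 1 ξ) (ε t : ℝ) (x : Sp d) :
    HasFDerivAt (fun x => x + ε • ξ (t, x)) (1 + ε • spaceFDeriv ξ (t, x)) x := by
  have h1 : HasFDerivAt (fun x : Sp d => (t, x)) (ContinuousLinearMap.inr ℝ ℝ (Sp d)) x :=
    hasFDerivAt_prodMk_right t x
  exact (hasFDerivAt_id x).add
    (((hξ.differentiable one_ne_zero (t, x)).hasFDerivAt.comp x h1).const_smul ε)

theorem exists_abs_det_perturbation_le (hξ : ContDiff ℝ 1 ξ) (hc : HasCompactSupport ξ) (s : ℝ) :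
    ∃ δ > 0, ∃ c, 0 ≤ c ∧ ∀ ε : ℝ, |ε| < δ → ∀ z, 0 < |(1 + ε • spaceFDeriv ξ z).det| ∧
      |(|(1 + ε • spaceFDeriv ξ z).det| ^ s - 1)| ≤ c * |ε| := by
  obtain ⟨r, hr, L, hL, H⟩ := exists_abs_det_rpow_sub_one_le (d := d) s
  obtain ⟨B, hB⟩ := (hc.fderiv ℝ).exists_bound_of_continuous (hξ.continuous_fderiv one_ne_zero)
  have hB0 : 0 ≤ B := (norm_nonneg _).trans (hB 0)
  have hD : ∀ z, ‖spaceFDeriv ξ z‖ ≤ B := fun z => by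
    refine ContinuousLinearMap.opNorm_le_bound _ hB0 fun a => ?_
    have e : ‖((0 : ℝ), a)‖ = ‖a‖ := by simp [Prod.norm_def]
    have h := (fderiv ℝ ξ z).le_opNorm ((0 : ℝ), a)
    rw [e] at h
    exact h.trans (mul_le_mul_of_nonneg_right (hB z) (norm_nonneg a))
  refine ⟨r / (B + 1), by positivity, L * B, by positivity, fun ε hε z => ?_⟩
  rw [lt_div_iff₀ (by positivity)] at hε
  have h1 : ‖ε • spaceFDeriv ξ z‖ ≤ |ε| * B := by
    rw [norm_smul, Real.norm_eq_abs]
    exact mul_le_mul_of_nonneg_left (hD z) (abs_nonneg ε)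
  obtain ⟨h2, h3⟩ := H (ε • spaceFDeriv ξ z) (h1.trans_lt (by nlinarith [abs_nonneg ε]))
  refine ⟨h2, h3.trans ?_⟩
  calc L * ‖ε • spaceFDeriv ξ z‖ ≤ L * (|ε| * B) := by gcongr
    _ = L * B * |ε| := by ring

/-- Differentiability at (1, 1). It is applied to the ratios of perturbed to unperturbed quantities,
so that one constant serves all times. -/
theorem exists_abs_rpow_mul_rpow_sub_one_le (α β : ℝ) :
    ∃ r > 0, ∃ L, 0 ≤ L ∧ ∀ x y : ℝ, |x - 1| < r → |y - 1| < r →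
      |x ^ α * y ^ β - 1| ≤ L * max |x - 1| |y - 1| := by
  have h : DifferentiableAt ℝ (fun z : ℝ × ℝ => z.1 ^ α * z.2 ^ β) (1, 1) :=
    (DifferentiableAt.rpow_const (f := fun z : ℝ × ℝ => z.1) (x := ((1 : ℝ), (1 : ℝ)))
      differentiableAt_fst (Or.inl one_ne_zero)).mul
    (DifferentiableAt.rpow_const (f := fun z : ℝ × ℝ => z.2) (x := ((1 : ℝ), (1 : ℝ)))
      differentiableAt_snd (Or.inl one_ne_zero))
  obtain ⟨L, hL0, hL⟩ := h.hasFDerivAt.isBigO_sub.exists_nonneg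
  obtain ⟨r, hr, H⟩ := Metric.eventually_nhds_iff.1 hL.bound
  refine ⟨r, hr, L, hL0, fun x y hx hy => ?_⟩
  have := H (y := (x, y)) (by
    rw [Prod.dist_eq, Real.dist_eq, Real.dist_eq]; exact max_lt hx hy)
  simpa [Prod.norm_def] using this

section Pressure

variable {X : Type*} [MeasurableSpace X] {m : Measure X} {f : X → ℝ} {D : X → Sp d →L[ℝ] Sp d}
  {s δ c : ℝ}

theorem measurable_abs_det_rpow (hD : Measurable D) (s ε : ℝ) :
    Measurable fun x => |(1 + ε • D x).det| ^ s := by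
  have h1 : Continuous fun A : Sp d →L[ℝ] Sp d => |(1 + ε • A).det| := by
    have : Continuous fun A : Sp d →L[ℝ] Sp d => 1 + ε • A := by fun_prop
    exact (ContinuousLinearMap.continuous_det.comp this).abs
  exact (h1.measurable.comp hD).pow_const s

theorem integrable_mul_abs_det_rpow (hf : Integrable f m) (hD : Measurable D) {ε : ℝ}
    (h : ∀ x, |(|(1 + ε • D x).det| ^ s - 1)| ≤ c) :
    Integrable (fun x => f x * |(1 + ε • D x).det| ^ s) m := by
  refine hf.mul_bdd (c := c + 1) (measurable_abs_det_rpow hD s ε).aestronglyMeasurable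
    (Eventually.of_forall fun x => ?_)
  rw [Real.norm_eq_abs]
  have h1 := abs_add_le (|(1 + ε • D x).det| ^ s - 1) 1
  rw [sub_add_cancel, abs_one] at h1
  linarith [h x]

theorem abs_integral_mul_abs_det_rpow_sub_le (hf : Integrable f m) (hf0 : ∀ x, 0 ≤ f x)
    (hD : Measurable D) {ε : ℝ} (h : ∀ x, |(|(1 + ε • D x).det| ^ s - 1)| ≤ c) :
    |∫ x, f x * |(1 + ε • D x).det| ^ s ∂m - ∫ x, f x ∂m| ≤ c * ∫ x, f x ∂m := by
  rw [← integral_sub (integrable_mul_abs_det_rpow hf hD h) hf, ← integral_const_mul]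
  refine abs_integral_le_integral_abs.trans (integral_mono_of_nonneg
    (Eventually.of_forall fun x => abs_nonneg _) (hf.const_mul c)
    (Eventually.of_forall fun x => ?_))
  have e : f x * |(1 + ε • D x).det| ^ s - f x = f x * (|(1 + ε • D x).det| ^ s - 1) := by ring
  simp only [e, abs_mul, abs_of_nonneg (hf0 x)]
  rw [mul_comm]
  exact mul_le_mul_of_nonneg_right (h x) (hf0 x)

theorem hasDerivAt_integral_mul_abs_det_rpow (hf : Integrable f m) (hD : Measurable D)
    (hδ : 0 < δ) (h : ∀ ε : ℝ, |ε| < δ → ∀ x, |(|(1 + ε • D x).det| ^ s - 1)| ≤ c * |ε|) :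
    Integrable (fun x => f x * (s * traceSp (D x))) m ∧
    HasDerivAt (fun ε : ℝ => ∫ x, f x * |(1 + ε • D x).det| ^ s ∂m)
      (∫ x, f x * (s * traceSp (D x)) ∂m) 0 := by
  have e0 : ∀ x, |(1 + (0 : ℝ) • D x).det| ^ s = 1 := fun x => by
    have := h 0 (by simpa using hδ) x
    rw [abs_zero, mul_zero] at this
    linarith [abs_eq_zero.1 (le_antisymm this (abs_nonneg _))]
  refine hasDerivAt_integral_of_abs_sub_le (bound := fun x => |f x| * c) hδ (fun ε _ => ?_) ?_
    (Eventually.of_forall fun x ε hε => ?_) (hf.abs.mul_const c)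
    (Eventually.of_forall fun x => ?_)
  · exact hf.1.mul (measurable_abs_det_rpow hD s ε).aestronglyMeasurable
  · simpa only [e0, mul_one] using hf
  · rw [e0, ← mul_sub, abs_mul, mul_assoc]
    exact mul_le_mul_of_nonneg_left (h ε hε x) (abs_nonneg _)
  · exact (hasDerivAt_abs_det_rpow s (D x)).const_mul (f x)

end Pressure

section Kinetic

variable {X : Type*} [MeasurableSpace X] {m : Measure X} [IsProbabilityMeasure m] {p B : ℝ}
  {f g : X → Sp d}

/-- The increment `g` stands for ∂_t ξ + ∇ξ v, which does not vanish with v. This is the origin of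
the summand 1 next to the energy, and thus of the need for a lower bound on V. -/
theorem abs_integral_norm_add_smul_rpow_sub_le (hp : 1 ≤ p) (hB : 0 ≤ B)
    (hf : MemLp f (ENNReal.ofReal p) m) (hg : MemLp g (ENNReal.ofReal p) m)
    (hfg : ∀ x, ‖g x‖ ≤ B * (1 + ‖f x‖)) {ε : ℝ} (hε : |ε| ≤ 1) :
    |∫ x, ‖f x + ε • g x‖ ^ p ∂m - ∫ x, ‖f x‖ ^ p ∂m| ≤
      p * ((1 + B) ^ p * 2 ^ p) * (1 + ∫ x, ‖f x‖ ^ p ∂m) * |ε| := by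
  have hp0 : 0 < p := by linarith
  have hfi := integrable_norm_rpow_of_memLp hp0 hf
  have hfgi := integrable_norm_rpow_of_memLp hp0 (hf.add (hg.const_smul ε))
  simp only [Pi.add_apply, Pi.smul_apply] at hfgi
  rw [← integral_sub hfgi hfi]
  have hb : ∀ x, |‖f x + ε • g x‖ ^ p - ‖f x‖ ^ p| ≤
      p * ((1 + B) ^ p * 2 ^ p) * (1 + ‖f x‖ ^ p) * |ε| := by
    intro x
    refine (abs_norm_add_smul_rpow_sub_le hp (f x) (g x) hε).trans ?_
    refine mul_le_mul_of_nonneg_right ?_ (abs_nonneg ε)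
    have h1 : ‖f x‖ + ‖g x‖ ≤ (1 + B) * (1 + ‖f x‖) := by linarith [hfg x]
    have h2 : (‖f x‖ + ‖g x‖) ^ p ≤ (1 + B) ^ p * (2 ^ p * (1 + ‖f x‖ ^ p)) := by
      calc _ ≤ ((1 + B) * (1 + ‖f x‖)) ^ p := by gcongr
        _ = (1 + B) ^ p * (1 + ‖f x‖) ^ p := Real.mul_rpow (by positivity) (by positivity)
        _ ≤ _ := by
          gcongr
          simpa using add_rpow_le_two_rpow hp0 zero_le_one (norm_nonneg (f x))
    calc p * (‖f x‖ + ‖g x‖) ^ p ≤ p * ((1 + B) ^ p * (2 ^ p * (1 + ‖f x‖ ^ p))) := by gcongr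
      _ = _ := by ring
  have hbi : Integrable (fun x => p * ((1 + B) ^ p * 2 ^ p) * (1 + ‖f x‖ ^ p) * |ε|) m :=
    (((integrable_const 1).add hfi).const_mul _).mul_const _
  refine (abs_integral_le_integral_abs.trans (integral_mono_of_nonneg
    (Eventually.of_forall fun x => abs_nonneg _) hbi (Eventually.of_forall hb))).trans ?_
  rw [integral_mul_const, integral_const_mul, integral_add (integrable_const 1) hfi]
  simp

end Kinetic

variable {p q α β V₀ : ℝ} {κ : ProbabilityTheory.Kernel ℝ (Sp d)}
  [ProbabilityTheory.IsMarkovKernel κ] {u : ℝ → Sp d → ℝ} {v : ℝ → Sp d → Sp d} {F V : ℝ → ℝ}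

/-- The `L_q` functional of the density `u t` moved by `x ↦ x + ε ξ(t, x)`. -/
noncomputable def perturbedPressure (q : ℝ) (u : ℝ → Sp d → ℝ) (ξ : ℝ × Sp d → Sp d)
    (ε t : ℝ) : ℝ := ∫ x, u t x ^ q * |(1 + ε • spaceFDeriv ξ (t, x)).det| ^ (1 - q)

/-- The kinetic energy of the curve `κ` moved by `x ↦ x + ε ξ(t, x)`. -/
noncomputable def perturbedKinetic (p : ℝ) (κ : ℝ → Measure (Sp d)) (v : ℝ → Sp d → Sp d)
    (ξ : ℝ × Sp d → Sp d) (ε t : ℝ) : ℝ :=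
  ∫ x, ‖v t x + ε • fderiv ℝ ξ (t, x) (1, v t x)‖ ^ p ∂(κ t)

theorem measurable_perturbedPressure (hum : Measurable (Function.uncurry u))
    (hξ : ContDiff ℝ 1 ξ) (ε : ℝ) : Measurable (perturbedPressure q u ξ ε) := by
  have h : Measurable fun z : ℝ × Sp d =>
      u z.1 z.2 ^ q * |(1 + ε • spaceFDeriv ξ z).det| ^ (1 - q) :=
    (hum.pow_const q).mul (measurable_abs_det_rpow (continuous_spaceFDeriv hξ).measurable _ _)
  exact (h.stronglyMeasurable.integral_prod_right' (ν := (volume : Measure (Sp d)))).measurable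

theorem measurable_perturbedKinetic (hv : Measurable (Function.uncurry v))
    (hξ : ContDiff ℝ 1 ξ) (ε : ℝ) : Measurable (perturbedKinetic p κ v ξ ε) := by
  have h : Measurable fun z : ℝ × Sp d =>
      ‖v z.1 z.2 + ε • fderiv ℝ ξ z (1, v z.1 z.2)‖ ^ p :=
    (hv.add ((measurable_fderiv_velocity hξ hv).const_smul ε)).norm.pow_const p
  exact (h.stronglyMeasurable.integral_kernel_prod_right' (κ := κ)).measurable

/-- The derivative at `0` of `perturbedPressure ^ α * perturbedKinetic ^ β`. -/
noncomputable def variationDensity (p q α β : ℝ) (κ : ℝ → Measure (Sp d)) (u : ℝ → Sp d → ℝ)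
    (v : ℝ → Sp d → Sp d) (F V : ℝ → ℝ) (ξ : ℝ × Sp d → Sp d) (t : ℝ) : ℝ :=
  (∫ x, u t x ^ q * ((1 - q) * spaceDiv ξ (t, x))) * α * F t ^ (α - 1) * V t ^ β +
    F t ^ α * ((∫ x, p * (‖v t x‖ ^ (p - 2) * inner ℝ (v t x)
      (fderiv ℝ ξ (t, x) (1, v t x))) ∂(κ t)) * β * V t ^ (β - 1))

/-- The powers may be differentiated for all exponents, including those below 1, because F and V are
positive at a regular time. -/
theorem IsRegularTime.hasDerivAt (hp : 1 < p)
    (hξ : ContDiff ℝ 1 ξ) (hc : HasCompactSupport ξ) {t : ℝ}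
    (h : IsRegularTime p q κ u v F V t) :
    HasDerivAt (fun ε => perturbedPressure q u ξ ε t ^ α * perturbedKinetic p κ v ξ ε t ^ β)
      (variationDensity p q α β κ u v F V ξ t) 0 := by
  obtain ⟨δ, hδ, c, hc0, H⟩ := exists_abs_det_perturbation_le hξ hc (1 - q)
  have hDm : Measurable fun x : Sp d => spaceFDeriv ξ (t, x) :=
    ((continuous_spaceFDeriv hξ).comp (Continuous.prodMk_right t)).measurable
  have h1 := (hasDerivAt_integral_mul_abs_det_rpow h.integrable hDm hδ
    fun ε hε x => (H ε hε (t, x)).2).2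
  have h2 := (hasDerivAt_integral_norm_add_smul_rpow hp h.memLp (memLp_perturbed_velocity hξ hc (measurable_prodMk_left (x := t)) h.memLp)).2
  have e1 : perturbedPressure q u ξ 0 t = F t := by
    rw [h.pressure, perturbedPressure]
    refine integral_congr_ae (Eventually.of_forall fun x => ?_)
    have := (H 0 (by simpa using hδ) (t, x)).2
    rw [abs_zero, mul_zero] at this
    have := abs_eq_zero.1 (le_antisymm this (abs_nonneg _))
    simp only [sub_eq_zero.1 this, mul_one]
  have e2 : perturbedKinetic p κ v ξ 0 t = V t := by
    rw [h.kinetic, perturbedKinetic]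
    simp
  have h3 := HasDerivAt.rpow_const (p := α) (f := fun ε => perturbedPressure q u ξ ε t) h1
    (Or.inl (by rw [e1]; exact h.pressure_pos.ne'))
  have h4 := HasDerivAt.rpow_const (p := β) (f := fun ε => perturbedKinetic p κ v ξ ε t) h2
    (Or.inl (by rw [e2]; exact h.kinetic_pos.ne'))
  have h5 := h3.mul h4
  rw [e1, e2] at h5
  exact h5

theorem perturbedPressure_zero (u : ℝ → Sp d → ℝ) (ξ : ℝ × Sp d → Sp d) (t : ℝ) :
    perturbedPressure q u ξ 0 t = ∫ x, u t x ^ q := by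
  have : ∀ x, (1 + (0 : ℝ) • spaceFDeriv ξ (t, x)) = 1 := fun x => by ext; simp
  simp only [perturbedPressure, this, det_one_sp, abs_one, Real.one_rpow, mul_one]

/-- The errors of both factors are at most M|ε| relative to F and V. For the kinetic factor the
absolute error is a multiple of 1 + V, which V ≥ V₀ turns into a multiple of V; at times where Dξ
vanishes there is no error. The bound is therefore a multiple of the integrand of the action. -/
theorem exists_variation_bound (hp : 1 < p) (hu : ∀ t x, 0 ≤ u t x)
    (hξ : ContDiff ℝ 1 ξ) (hc : HasCompactSupport ξ) (hV₀ : 0 < V₀) (α β : ℝ) :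
    ∃ δ > 0, ∃ c, 0 ≤ c ∧ ∀ t, IsRegularTime p q κ u v F V t →
      ((∀ x, fderiv ℝ ξ (t, x) = 0) ∨ V₀ ≤ V t) → ∀ ε : ℝ, |ε| < δ →
      |perturbedPressure q u ξ ε t ^ α * perturbedKinetic p κ v ξ ε t ^ β - F t ^ α * V t ^ β| ≤
        c * (F t ^ α * V t ^ β) * |ε| := by
  obtain ⟨δ, hδ, c, hc0, H⟩ := exists_abs_det_perturbation_le hξ hc (1 - q)
  obtain ⟨B, hB, hz⟩ := exists_velocity_bound hξ hc
  obtain ⟨r, hr, L, hL, HL⟩ := exists_abs_rpow_mul_rpow_sub_one_le α β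
  have hp0 : 0 < p := by linarith
  -- The last factor comes from 1 + V ≤ (1 / V₀ + 1) V.
  set c' : ℝ := p * ((1 + B) ^ p * 2 ^ p) * (1 / V₀ + 1)
  have hc' : 0 ≤ c' := by positivity
  set M := max c c'
  have hM : 0 ≤ M := hc0.trans (le_max_left _ _)
  refine ⟨min (min δ 1) (r / (M + 1)), by positivity, L * M, by positivity,
    fun t h halt ε hε => ?_⟩
  obtain ⟨hε1, hε2⟩ := lt_min_iff.1 hε
  obtain ⟨hε1, hε3⟩ := lt_min_iff.1 hε1
  rw [lt_div_iff₀ (by positivity)] at hε2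
  have hF := h.pressure_pos
  have hV := h.kinetic_pos
  have hDm : Measurable fun x : Sp d => spaceFDeriv ξ (t, x) :=
    ((continuous_spaceFDeriv hξ).comp (Continuous.prodMk_right t)).measurable
  have hA : |perturbedPressure q u ξ ε t - F t| ≤ M * |ε| * F t := by
    rw [h.pressure]
    refine (abs_integral_mul_abs_det_rpow_sub_le h.integrable
      (fun x => Real.rpow_nonneg (hu t x) q) hDm fun x => (H ε hε1 (t, x)).2).trans ?_
    have := h.pressure_pos
    rw [h.pressure] at this
    gcongr
    exact le_max_left _ _
  have hW : |perturbedKinetic p κ v ξ ε t - V t| ≤ M * |ε| * V t := by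
    rcases halt with h0 | hVt
    · have : perturbedKinetic p κ v ξ ε t = V t := by
        rw [h.kinetic, perturbedKinetic]
        simp [h0]
      rw [this, sub_self, abs_zero]
      positivity
    · have h1 := abs_integral_norm_add_smul_rpow_sub_le hp.le hB h.memLp (memLp_perturbed_velocity hξ hc (measurable_prodMk_left (x := t)) h.memLp) (fun x => hz t x (v t x)) hε3.le
      rw [← h.kinetic] at h1
      refine h1.trans ?_
      have h2 : 1 + V t ≤ (1 / V₀ + 1) * V t := by
        have : 1 ≤ V t / V₀ := (one_le_div hV₀).2 hVt
        calc 1 + V t ≤ V t / V₀ + V t := by linarith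
          _ = _ := by ring
      calc _ ≤ p * ((1 + B) ^ p * 2 ^ p) * ((1 / V₀ + 1) * V t) * |ε| := by gcongr
        _ = c' * |ε| * V t := by simp only [c']; ring
        _ ≤ M * |ε| * V t := by gcongr; exact le_max_right _ _
  have hA' : |perturbedPressure q u ξ ε t / F t - 1| ≤ M * |ε| := by
    rw [div_sub_one hF.ne', abs_div, abs_of_pos hF, div_le_iff₀ hF]
    exact hA
  have hW' : |perturbedKinetic p κ v ξ ε t / V t - 1| ≤ M * |ε| := by
    rw [div_sub_one hV.ne', abs_div, abs_of_pos hV, div_le_iff₀ hV]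
    exact hW
  have hsmall : M * |ε| < r := by nlinarith [abs_nonneg ε]
  have h6 := (HL _ _ (hA'.trans_lt hsmall) (hW'.trans_lt hsmall)).trans
    (mul_le_mul_of_nonneg_left (max_le hA' hW') hL)
  have hA0 : 0 ≤ perturbedPressure q u ξ ε t := integral_nonneg fun x =>
    mul_nonneg (Real.rpow_nonneg (hu t x) q) (Real.rpow_nonneg (abs_nonneg _) _)
  have hW0 : 0 ≤ perturbedKinetic p κ v ξ ε t := integral_nonneg fun x => by positivity
  rw [Real.div_rpow hA0 hF.le, Real.div_rpow hW0 hV.le] at h6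
  have hFα : 0 < F t ^ α := Real.rpow_pos_of_pos hF α
  have hVβ : 0 < V t ^ β := Real.rpow_pos_of_pos hV β
  rw [div_mul_div_comm, div_sub_one (by positivity), abs_div, abs_of_pos (mul_pos hFα hVβ),
    div_le_iff₀ (by positivity)] at h6
  refine h6.trans (le_of_eq ?_)
  ring

/-- The derivative at 0 of a function of ε with a local minimum there; the uniform relative bound
and the finite action supply the integrable majorant. -/
theorem integral_variationDensity_eq_zero (hp : 1 < p) (hum : Measurable (Function.uncurry u))
    (hu : ∀ t x, 0 ≤ u t x) (hv : Measurable (Function.uncurry v))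
    (hreg : ∀ᵐ t ∂(volume.restrict (Icc (0 : ℝ) 1)), IsRegularTime p q κ u v F V t)
    (hint : IntegrableOn (fun t => F t ^ α * V t ^ β) (Icc 0 1))
    (hξ : ContDiff ℝ 1 ξ) (hc : HasCompactSupport ξ) (hV₀ : 0 < V₀)
    (hV : ∀ᵐ t ∂(volume.restrict (Icc (0 : ℝ) 1)), (∀ x, fderiv ℝ ξ (t, x) = 0) ∨ V₀ ≤ V t)
    {δ : ℝ} (hδ : 0 < δ) (hmin : ∀ ε : ℝ, |ε| < δ →
      ∫⁻ t in Icc (0 : ℝ) 1, ENNReal.ofReal (F t ^ α * V t ^ β) ≤ ∫⁻ t in Icc (0 : ℝ) 1,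
        ENNReal.ofReal (perturbedPressure q u ξ ε t ^ α * perturbedKinetic p κ v ξ ε t ^ β)) :
    ∫ t in Icc (0 : ℝ) 1, variationDensity p q α β κ u v F V ξ t = 0 := by
  obtain ⟨δ', hδ', c, hc0, H⟩ := exists_variation_bound (q := q) (κ := κ) (v := v) (F := F)
    (V := V) hp hu hξ hc hV₀ α β
  set G : ℝ → ℝ → ℝ := fun ε t =>
    perturbedPressure q u ξ ε t ^ α * perturbedKinetic p κ v ξ ε t ^ β
  have hGm : ∀ ε, Measurable (G ε) := fun ε =>
    ((measurable_perturbedPressure hum hξ ε).pow_const α).mul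
      ((measurable_perturbedKinetic hv hξ ε).pow_const β)
  have hG0 : ∀ᵐ t ∂(volume.restrict (Icc (0 : ℝ) 1)), G 0 t = F t ^ α * V t ^ β := by
    filter_upwards [hreg] with t ht
    simp only [G]
    rw [perturbedPressure_zero, ← ht.pressure, perturbedKinetic]
    simp [ht.kinetic]
  have hGnn : ∀ ε t, 0 ≤ G ε t := fun ε t => mul_nonneg
    (Real.rpow_nonneg (integral_nonneg fun x =>
      mul_nonneg (Real.rpow_nonneg (hu t x) q) (Real.rpow_nonneg (abs_nonneg _) _)) _)
    (Real.rpow_nonneg (integral_nonneg fun x => by positivity) _)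
  have hbound : ∀ᵐ t ∂(volume.restrict (Icc (0 : ℝ) 1)), ∀ ε : ℝ, |ε| < δ' →
      |G ε t - G 0 t| ≤ c * (F t ^ α * V t ^ β) * |ε| := by
    filter_upwards [hreg, hV, hG0] with t h1 h2 h3 ε hε
    rw [h3]
    exact H t h1 h2 ε hε
  have hG0i : Integrable (G 0) (volume.restrict (Icc (0 : ℝ) 1)) :=
    hint.congr (hG0.mono fun t ht => ht.symm)
  have hder := (hasDerivAt_integral_of_abs_sub_le (F := G)
    (F' := variationDensity p q α β κ u v F V ξ) hδ' (fun ε _ => (hGm ε).aestronglyMeasurable)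
    hG0i hbound (hint.const_mul c) (by
      filter_upwards [hreg] with t ht
      exact ht.hasDerivAt hp hξ hc)).2
  have hloc : IsLocalMin (fun ε => ∫ t in Icc (0 : ℝ) 1, G ε t) 0 := by
    have hball : ∀ᶠ ε : ℝ in 𝓝 0, |ε| < min δ δ' := by
      have := Metric.ball_mem_nhds (0 : ℝ) (lt_min hδ hδ')
      filter_upwards [this] with ε hε
      simpa [Real.dist_eq] using hε
    filter_upwards [hball] with ε hε
    obtain ⟨h1, h2⟩ := lt_min_iff.1 hε
    have hGi : Integrable (G ε) (volume.restrict (Icc (0 : ℝ) 1)) := by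
      have : Integrable (fun t => G ε t - G 0 t) (volume.restrict (Icc (0 : ℝ) 1)) := by
        refine ((hint.const_mul c).mul_const |ε|).mono'
          ((hGm ε).sub (hGm 0)).aestronglyMeasurable ?_
        filter_upwards [hbound] with t ht
        exact ht ε h2
      exact (this.add hG0i).congr (Eventually.of_forall fun t => by simp)
    have h3 := hmin ε h1
    have h4 : ∫⁻ t in Icc (0 : ℝ) 1, ENNReal.ofReal (F t ^ α * V t ^ β) =
        ∫⁻ t in Icc (0 : ℝ) 1, ENNReal.ofReal (G 0 t) := by
      refine lintegral_congr_ae ?_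
      filter_upwards [hG0] with t ht
      rw [ht]
    rw [h4, ← ofReal_integral_eq_lintegral_ofReal hG0i (Eventually.of_forall (hGnn 0)),
      ← ofReal_integral_eq_lintegral_ofReal hGi (Eventually.of_forall (hGnn ε)),
      ENNReal.ofReal_le_ofReal_iff (integral_nonneg (hGnn ε))] at h3
    exact h3
  exact hloc.hasDerivAt_eq_zero hder

end Variation

/-! ### Integration over space-time strips. -/

section Strip

variable {p q : ℝ} {κ : ProbabilityTheory.Kernel ℝ (Sp d)}
  [ProbabilityTheory.IsMarkovKernel κ] {u : ℝ → Sp d → ℝ} {v : ℝ → Sp d → Sp d} {F V W : ℝ → ℝ}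
  {T : Set ℝ}

theorem restrict_strip (T : Set ℝ) : (volume : Measure (ℝ × Sp d)).restrict (T ×ˢ univ) =
    (volume.restrict T).prod volume := by
  rw [Measure.volume_eq_prod, ← Measure.prod_restrict, Measure.restrict_univ]

theorem aemeasurable_fst_strip (hW : AEMeasurable W (volume.restrict T)) :
    AEMeasurable (fun z : ℝ × Sp d => W z.1)
      ((volume : Measure (ℝ × Sp d)).restrict (T ×ˢ univ)) := by
  rw [restrict_strip]
  exact hW.comp_quasiMeasurePreserving Measure.quasiMeasurePreserving_fst

theorem integrableOn_strip {E : Type*} [NormedAddCommGroup E] {f : ℝ × Sp d → E} {g : ℝ → ℝ}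
    (hf : AEStronglyMeasurable f ((volume : Measure (ℝ × Sp d)).restrict (T ×ˢ univ)))
    (hg : IntegrableOn g T) (h : ∀ᵐ t ∂(volume.restrict T),
      Integrable (fun x => f (t, x)) ∧ ∫ x, ‖f (t, x)‖ ≤ g t) :
    IntegrableOn f (T ×ˢ univ) := by
  rw [IntegrableOn, restrict_strip] at *
  refine (integrable_prod_iff hf).2 ⟨h.mono fun t ht => ht.1, ?_⟩
  refine hg.mono' hf.norm.integral_prod_right' (h.mono fun t ht => ?_)
  rw [Real.norm_of_nonneg (integral_nonneg fun x => norm_nonneg _)]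
  exact ht.2

theorem integrableOn_strip_mul_rpow {m : ℝ → Measure (Sp d)}
    (hum : Measurable (Function.uncurry u)) (hu : ∀ t x, 0 ≤ u t x)
    (hreg : ∀ᵐ t ∂(volume.restrict T), IsRegularTime p q m u v F V t)
    (hW : AEMeasurable W (volume.restrict T)) (hi : IntegrableOn (fun t => |W t| * F t) T) :
    IntegrableOn (fun z : ℝ × Sp d => W z.1 * u z.1 z.2 ^ q) (T ×ˢ univ) := by
  refine integrableOn_strip ((aemeasurable_fst_strip hW).mul
    (hum.pow_const q).aemeasurable).aestronglyMeasurable hi ?_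
  filter_upwards [hreg] with t ht
  refine ⟨ht.integrable.const_mul _, le_of_eq ?_⟩
  rw [ht.pressure, ← integral_const_mul]
  refine integral_congr_ae (Eventually.of_forall fun x => ?_)
  simp only [norm_mul, Real.norm_eq_abs, abs_of_nonneg (Real.rpow_nonneg (hu t x) q)]

theorem integrableOn_strip_mul_density (hp : 0 < p) (hum : Measurable (Function.uncurry u))
    (hu : ∀ t x, 0 ≤ u t x) (hv : Measurable (Function.uncurry v))
    (hreg : ∀ᵐ t ∂(volume.restrict T), IsRegularTime p q κ u v F V t)
    (hW : AEMeasurable W (volume.restrict T))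
    (hi : IntegrableOn (fun t => |W t| * (1 + V t)) T) :
    IntegrableOn (fun z : ℝ × Sp d => W z.1 * u z.1 z.2 * (1 + ‖v z.1 z.2‖ ^ p)) (T ×ˢ univ) := by
  refine integrableOn_strip (((aemeasurable_fst_strip hW).mul hum.aemeasurable).mul
    ((hv.norm.pow_const p).const_add 1).aemeasurable).aestronglyMeasurable hi ?_
  filter_upwards [hreg] with t ht
  have h1 := integrable_norm_rpow_of_memLp hp ht.memLp
  have h2 := (integrable_const (1 : ℝ)).add h1
  have h3 := (ht.integrable_iff hum.of_uncurry_left (hu t)).1 h2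
  simp only [Pi.add_apply, smul_eq_mul] at h3
  have h4 := ht.integral_eq hum.of_uncurry_left (hu t) fun x => 1 + ‖v t x‖ ^ p
  rw [integral_add (integrable_const _) h1, ← ht.kinetic] at h4
  simp only [integral_const, probReal_univ, smul_eq_mul, mul_one] at h4
  refine ⟨by simpa only [mul_assoc] using h3.const_mul (W t), le_of_eq ?_⟩
  rw [h4, ← integral_const_mul]
  refine integral_congr_ae (Eventually.of_forall fun x => ?_)
  have : 0 ≤ 1 + ‖v t x‖ ^ p := by positivity
  simp only [norm_mul, Real.norm_eq_abs, abs_of_nonneg (hu t x), abs_of_nonneg this, mul_assoc]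

theorem locallyIntegrableOn_of_strip {E : Type*} [NormedAddCommGroup E] {f : ℝ × Sp d → E}
    {S : Set (Sp d)} (h : ∀ a b : ℝ, 0 < a → a < b → b < 1 → IntegrableOn f (Icc a b ×ˢ univ)) :
    LocallyIntegrableOn f (Ioo (0 : ℝ) 1 ×ˢ S) := by
  rintro ⟨t, x⟩ ⟨ht, -⟩
  simp only at ht
  refine ⟨Icc (t / 2) ((1 + t) / 2) ×ˢ univ, mem_nhdsWithin_of_mem_nhds ?_,
    h _ _ (by linarith [ht.1]) (by linarith [ht.2]) (by linarith [ht.2])⟩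
  exact prod_mem_nhds (Icc_mem_nhds (by linarith [ht.1]) (by linarith [ht.2])) univ_mem

theorem exists_Icc_of_isCompact {K : Set ℝ} (hK : IsCompact K) (h : K ⊆ Ioo 0 1) :
    ∃ a b : ℝ, 0 < a ∧ a < b ∧ b < 1 ∧ K ⊆ Icc a b := by
  rcases K.eq_empty_or_nonempty with rfl | hne
  · exact ⟨1 / 3, 1 / 2, by norm_num, by norm_num, by norm_num, empty_subset _⟩
  obtain ⟨s, hs, hs'⟩ := hK.exists_isLeast hne
  obtain ⟨r, hr, hr'⟩ := hK.exists_isGreatest hne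
  refine ⟨min s (1 / 3), max r (1 / 2), lt_min (h hs).1 (by norm_num),
    (min_le_right _ _).trans_lt ((by norm_num : (1 / 3 : ℝ) < 1 / 2).trans_le (le_max_right _ _)),
    max_lt (h hr).2 (by norm_num), fun t ht => ⟨(min_le_left _ _).trans (hs' ht),
      (hr' ht).trans (le_max_left _ _)⟩⟩

theorem fderiv_eq_zero_of_notMem_tsupport {E G : Type*} [NormedAddCommGroup E] [NormedSpace ℝ E]
    [NormedAddCommGroup G] [NormedSpace ℝ G] {f : E → G} {x : E} (h : x ∉ tsupport f) :
    fderiv ℝ f x = 0 := by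
  by_contra hne
  exact h (support_fderiv_subset ℝ hne)

theorem rpow_le_one_add_rpow {a r s : ℝ} (ha : 0 ≤ a) (hr : 0 ≤ r) (hrs : r ≤ s) :
    a ^ r ≤ 1 + a ^ s := by
  rcases le_total a 1 with h | h
  · linarith [Real.rpow_le_one ha h hr, Real.rpow_nonneg ha s]
  · linarith [Real.rpow_le_rpow_of_exponent_le h hrs]

/-- At a = 0 both sides vanish because p > 1, whatever value the power p - 2 takes there. -/
theorem norm_rpow_sub_two_mul {E : Type*} [NormedAddCommGroup E] (hp : 1 < p) (a : E) :
    ‖a‖ ^ (p - 2) * ‖a‖ = ‖a‖ ^ (p - 1) := by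
  rcases eq_or_ne a 0 with rfl | h
  · rw [norm_zero, mul_zero, Real.zero_rpow (by linarith)]
  · rw [← Real.rpow_add_one (norm_ne_zero_iff.2 h)]
    ring_nf

end Strip

/-! ### Integrability of the terms of the system. -/

section WeakSolution

variable {p q α β C N : ℝ} {Ω : Set (Sp d)} {κ : ProbabilityTheory.Kernel ℝ (Sp d)}
  [ProbabilityTheory.IsMarkovKernel κ] {u : ℝ → Sp d → ℝ} {v : ℝ → Sp d → Sp d} {F V : ℝ → ℝ}

theorem ae_restrict_Icc_of_Icc {P : ℝ → Prop} {a b : ℝ} (ha : 0 ≤ a) (hb : b ≤ 1)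
    (h : ∀ᵐ t ∂(volume.restrict (Icc (0 : ℝ) 1)), P t) : ∀ᵐ t ∂(volume.restrict (Icc a b)), P t :=
  ae_restrict_of_ae_restrict_of_subset (Icc_subset_Icc ha hb) h

/-- After integration in space |H| u^q becomes |H| F = |α(1-q)| F^α V^β, so finite action suffices
on all of [0,1]. -/
theorem integrableOn_pressure {m : ℝ → Measure (Sp d)}
    (hum : Measurable (Function.uncurry u)) (hu : ∀ t x, 0 ≤ u t x)
    (hreg : ∀ᵐ t ∂(volume.restrict (Icc (0 : ℝ) 1)), IsRegularTime p q m u v F V t)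
    (hF : AEMeasurable F (volume.restrict (Icc (0 : ℝ) 1)))
    (hVm : AEMeasurable V (volume.restrict (Icc (0 : ℝ) 1)))
    (hint : IntegrableOn (fun t => F t ^ α * V t ^ β) (Icc 0 1)) :
    IntegrableOn (fun z : ℝ × Sp d => coeffH q α β F V z.1 * u z.1 z.2 ^ q)
      (Icc (0 : ℝ) 1 ×ˢ univ) := by
  refine integrableOn_strip_mul_rpow hum hu hreg
    (((hF.pow_const (α - 1)).const_mul (α * (1 - q))).mul (hVm.pow_const β)) ?_
  refine (hint.const_mul |α * (1 - q)|).congr (hreg.mono fun t ht => ?_)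
  have h1 := ht.pressure_pos
  have h2 := ht.kinetic_pos
  simp only [coeffH]
  have h3 : 0 ≤ F t ^ (α - 1) * V t ^ β := by positivity
  rw [mul_assoc (α * (1 - q)), abs_mul (α * (1 - q)) (F t ^ (α - 1) * V t ^ β), abs_of_nonneg h3,
    Real.rpow_sub_one h1.ne']
  field_simp

/-- After integration in space this is K (1 + V) ≤ pβ (1/V₀ + 1) F^α V^β. The weight 1 + |v|^p
dominates both |v|^(p-1) and |v|^p, hence the momentum and the flux. -/
theorem integrableOn_kinetic (hp : 1 < p) (hβ : 0 < β)
    (hum : Measurable (Function.uncurry u)) (hu : ∀ t x, 0 ≤ u t x)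
    (hv : Measurable (Function.uncurry v))
    (hreg : ∀ᵐ t ∂(volume.restrict (Icc (0 : ℝ) 1)), IsRegularTime p q κ u v F V t)
    (hF : AEMeasurable F (volume.restrict (Icc (0 : ℝ) 1)))
    (hVm : AEMeasurable V (volume.restrict (Icc (0 : ℝ) 1)))
    (hint : IntegrableOn (fun t => F t ^ α * V t ^ β) (Icc 0 1))
    {a b V₀ : ℝ} (ha : 0 ≤ a) (hb : b ≤ 1) (hV₀ : 0 < V₀)
    (hV : ∀ᵐ t ∂(volume.restrict (Icc a b)), V₀ ≤ V t) :
    IntegrableOn (fun z : ℝ × Sp d => coeffK p α β F V z.1 * u z.1 z.2 * (1 + ‖v z.1 z.2‖ ^ p))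
      (Icc a b ×ˢ univ) := by
  have hsub : Icc a b ⊆ Icc (0 : ℝ) 1 := Icc_subset_Icc ha hb
  have hK : AEMeasurable (coeffK p α β F V) (volume.restrict (Icc a b)) :=
    (((hF.pow_const α).const_mul (p * β)).mul (hVm.pow_const (β - 1))).mono_measure
      (Measure.restrict_mono_set _ hsub)
  refine integrableOn_strip_mul_density (by linarith) hum hu hv
    (ae_restrict_Icc_of_Icc ha hb hreg) hK ?_
  refine ((hint.mono_set hsub).const_mul (p * β * (1 / V₀ + 1))).mono'
    (hK.abs.mul ((hVm.mono_measure (Measure.restrict_mono_set _ hsub)).const_add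
      1)).aestronglyMeasurable ?_
  filter_upwards [ae_restrict_Icc_of_Icc ha hb hreg, hV] with t ht hVt
  have h1 := ht.pressure_pos
  have h2 := ht.kinetic_pos
  have h3 : 1 + V t ≤ (1 / V₀ + 1) * V t := by
    have : 1 ≤ V t / V₀ := (one_le_div hV₀).2 hVt
    calc 1 + V t ≤ V t / V₀ + V t := by linarith
      _ = _ := by ring
  have h4 : 0 ≤ coeffK p α β F V t := by unfold coeffK; positivity
  rw [Real.norm_of_nonneg (by positivity), abs_of_nonneg h4]
  calc _ ≤ coeffK p α β F V t * ((1 / V₀ + 1) * V t) := by gcongr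
    _ = _ := by
      rw [coeffK, Real.rpow_sub_one h2.ne']
      field_simp

theorem integrableOn_density (hp : 1 < p) (hN : 0 ≤ N)
    (hum : Measurable (Function.uncurry u)) (hu : ∀ t x, 0 ≤ u t x)
    (hv : Measurable (Function.uncurry v))
    (hE : ∀ᵐ t ∂(volume.restrict (Icc (0 : ℝ) 1)), energy p κ v t ≤ ENNReal.ofReal N)
    (hreg : ∀ᵐ t ∂(volume.restrict (Icc (0 : ℝ) 1)), IsRegularTime p q κ u v F V t)
    (hVm : AEMeasurable V (volume.restrict (Icc (0 : ℝ) 1))) :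
    IntegrableOn (fun z : ℝ × Sp d => u z.1 z.2 * (1 + ‖v z.1 z.2‖ ^ p))
      (Icc (0 : ℝ) 1 ×ˢ univ) := by
  have hp0 : 0 < p := by linarith
  have := integrableOn_strip_mul_density (W := fun _ => 1) hp0 hum hu hv hreg aemeasurable_const (by
    refine (integrable_const (1 + N)).mono' ?_ ?_
    · exact (aemeasurable_const.mul (hVm.const_add 1)).aestronglyMeasurable
    · filter_upwards [hreg, hE] with t ht h
      rw [energy_eq_ofReal hp0 ht.memLp, ← ht.kinetic, ENNReal.ofReal_le_ofReal_iff hN] at h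
      have := ht.kinetic_pos
      rw [Real.norm_of_nonneg (by positivity), abs_one, one_mul]
      linarith)
  simpa only [one_mul] using this

end WeakSolution

/-! ### From the vanishing first variation to the momentum equation. -/

section Momentum

variable {p q α β : ℝ} {Ω : Set (Sp d)} {κ : ProbabilityTheory.Kernel ℝ (Sp d)}
  [ProbabilityTheory.IsMarkovKernel κ] {u : ℝ → Sp d → ℝ} {v : ℝ → Sp d → Sp d} {F V : ℝ → ℝ}
  {ξ : ℝ × Sp d → Sp d}

theorem continuous_spaceDiv (hξ : ContDiff ℝ 1 ξ) : Continuous (spaceDiv ξ) := by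
  have := hξ.continuous_fderiv one_ne_zero
  unfold spaceDiv
  fun_prop

theorem spaceDiv_eq_zero {z : ℝ × Sp d} (h : fderiv ℝ ξ z = 0) : spaceDiv ξ z = 0 := by
  simp [spaceDiv, h]

theorem exists_abs_spaceDiv_le (hξ : ContDiff ℝ 1 ξ) (hc : HasCompactSupport ξ) :
    ∃ c, ∀ z, ‖spaceDiv ξ z‖ ≤ c :=
  HasCompactSupport.exists_bound_of_continuous
    (HasCompactSupport.intro hc.isCompact fun _ hz =>
      spaceDiv_eq_zero (fderiv_eq_zero_of_notMem_tsupport hz)) (continuous_spaceDiv hξ)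

theorem IsRegularTime.integral_variation (hp : 1 < p) (hum : Measurable (Function.uncurry u))
    (hu : ∀ t x, 0 ≤ u t x) (hξ : ContDiff ℝ 1 ξ) (hc : HasCompactSupport ξ) {t : ℝ}
    (h : IsRegularTime p q κ u v F V t) :
    ∫ x, (coeffH q α β F V t * u t x ^ q * spaceDiv ξ (t, x) +
      coeffK p α β F V t * u t x * ‖v t x‖ ^ (p - 2) *
        inner ℝ (v t x) (fderiv ℝ ξ (t, x) (1, v t x))) =
      variationDensity p q α β κ u v F V ξ t := by
  obtain ⟨δ, hδ, c, hc0, H⟩ := exists_abs_det_perturbation_le hξ hc (1 - q)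
  have hDm : Measurable fun x : Sp d => spaceFDeriv ξ (t, x) :=
    ((continuous_spaceFDeriv hξ).comp (Continuous.prodMk_right t)).measurable
  have h1 := (hasDerivAt_integral_mul_abs_det_rpow h.integrable hDm hδ
    fun ε hε x => (H ε hε (t, x)).2).1
  simp only [traceSp_spaceFDeriv] at h1
  have h2 := (hasDerivAt_integral_norm_add_smul_rpow hp h.memLp (memLp_perturbed_velocity
    hξ hc (measurable_prodMk_left (x := t)) h.memLp)).1
  have h3 := (h.integrable_iff hum.of_uncurry_left (hu t)).1 h2
  rw [variationDensity, h.integral_eq hum.of_uncurry_left (hu t)]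
  have e1 : ∀ x, coeffH q α β F V t * u t x ^ q * spaceDiv ξ (t, x) +
      coeffK p α β F V t * u t x * ‖v t x‖ ^ (p - 2) *
        inner ℝ (v t x) (fderiv ℝ ξ (t, x) (1, v t x)) =
      α * F t ^ (α - 1) * V t ^ β * (u t x ^ q * ((1 - q) * spaceDiv ξ (t, x))) +
      F t ^ α * β * V t ^ (β - 1) * (u t x • (p * (‖v t x‖ ^ (p - 2) *
        inner ℝ (v t x) (fderiv ℝ ξ (t, x) (1, v t x))))) := fun x => by
    rw [coeffH, coeffK, smul_eq_mul]
    ring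
  simp only [e1]
  rw [integral_add (h1.const_mul _) (h3.const_mul _), integral_const_mul, integral_const_mul]
  ring

theorem variationDensity_eq_zero {m : ℝ → Measure (Sp d)} {t : ℝ} (h : ∀ x, fderiv ℝ ξ (t, x) = 0) :
    variationDensity p q α β m u v F V ξ t = 0 := by
  simp [variationDensity, spaceDiv, h]

theorem integral_momentum_eq_zero (hp : 1 < p) (hβ : 0 < β)
    (hum : Measurable (Function.uncurry u)) (hu : ∀ t x, 0 ≤ u t x)
    (hv : Measurable (Function.uncurry v))
    (hreg : ∀ᵐ t ∂(volume.restrict (Icc (0 : ℝ) 1)), IsRegularTime p q κ u v F V t)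
    (hF : AEMeasurable F (volume.restrict (Icc (0 : ℝ) 1)))
    (hVm : AEMeasurable V (volume.restrict (Icc (0 : ℝ) 1)))
    (hint : IntegrableOn (fun t => F t ^ α * V t ^ β) (Icc 0 1))
    (hξ : ContDiff ℝ 1 ξ) (hc : HasCompactSupport ξ)
    (hs : tsupport ξ ⊆ Ioo (0 : ℝ) 1 ×ˢ interior Ω)
    {a b V₀ : ℝ} (ha : 0 ≤ a) (hb : b ≤ 1) (hV₀ : 0 < V₀)
    (hV : ∀ᵐ t ∂(volume.restrict (Icc a b)), V₀ ≤ V t) (hs' : tsupport ξ ⊆ Icc a b ×ˢ univ)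
    (hvar : ∫ t in Icc (0 : ℝ) 1, variationDensity p q α β κ u v F V ξ t = 0) :
    ∫ z in Ioo (0 : ℝ) 1 ×ˢ interior Ω,
      (coeffH q α β F V z.1 * u z.1 z.2 ^ q * spaceDiv ξ z
        + coeffK p α β F V z.1 * u z.1 z.2 * ‖v z.1 z.2‖ ^ (p - 2)
          * inner ℝ (fderiv ℝ ξ z (0, v z.1 z.2)) (v z.1 z.2)
        + coeffK p α β F V z.1 * u z.1 z.2 * ‖v z.1 z.2‖ ^ (p - 2)
          * inner ℝ (fderiv ℝ ξ z (1, 0)) (v z.1 z.2)) = 0 := by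
  have hsub : Icc a b ⊆ Icc (0 : ℝ) 1 := Icc_subset_Icc ha hb
  set J : ℝ × Sp d → ℝ := fun z => coeffH q α β F V z.1 * u z.1 z.2 ^ q * spaceDiv ξ z +
    coeffK p α β F V z.1 * u z.1 z.2 * ‖v z.1 z.2‖ ^ (p - 2) *
      inner ℝ (v z.1 z.2) (fderiv ℝ ξ z (1, v z.1 z.2)) with hJ
  have e : ∀ z : ℝ × Sp d, coeffH q α β F V z.1 * u z.1 z.2 ^ q * spaceDiv ξ z
        + coeffK p α β F V z.1 * u z.1 z.2 * ‖v z.1 z.2‖ ^ (p - 2)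
          * inner ℝ (fderiv ℝ ξ z (0, v z.1 z.2)) (v z.1 z.2)
        + coeffK p α β F V z.1 * u z.1 z.2 * ‖v z.1 z.2‖ ^ (p - 2)
          * inner ℝ (fderiv ℝ ξ z (1, 0)) (v z.1 z.2) = J z := fun z => by
    have h1 : ((1 : ℝ), v z.1 z.2) = (0, v z.1 z.2) + (1, 0) := by simp
    rw [hJ]
    simp only
    rw [h1, map_add, inner_add_right, real_inner_comm (v z.1 z.2), real_inner_comm (v z.1 z.2)]
    ring
  simp only [e]
  have hJ0 : ∀ z, z ∉ tsupport ξ → J z = 0 := fun z hz => by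
    have := fderiv_eq_zero_of_notMem_tsupport hz
    simp [hJ, spaceDiv_eq_zero this, this]
  have hzero : ∀ t, t ∉ Icc a b → ∀ x, fderiv ℝ ξ (t, x) = 0 := fun t ht x =>
    fderiv_eq_zero_of_notMem_tsupport fun h => ht (hs' h).1
  have hJi : IntegrableOn J (Icc a b ×ˢ univ) := by
    obtain ⟨c, hdiv⟩ := exists_abs_spaceDiv_le hξ hc
    obtain ⟨B, hB, hz⟩ := exists_velocity_bound hξ hc
    refine Integrable.add ?_ ?_
    · exact ((integrableOn_pressure hum hu hreg hF hVm hint).mono_set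
        (prod_mono hsub subset_rfl)).mul_bdd (c := c)
        (continuous_spaceDiv hξ).aestronglyMeasurable (Eventually.of_forall hdiv)
    · have hK : AEMeasurable (coeffK p α β F V) (volume.restrict (Icc a b)) :=
        (((hF.pow_const α).const_mul (p * β)).mul (hVm.pow_const (β - 1))).mono_measure
          (Measure.restrict_mono_set _ hsub)
      refine (((integrableOn_kinetic hp hβ hum hu hv hreg hF hVm hint ha hb hV₀ hV).norm).const_mul
        (2 * B)).mono' ((((aemeasurable_fst_strip hK).mul hum.aemeasurable).mul
          (hv.norm.pow_const (p - 2)).aemeasurable).mul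
          (hv.inner (measurable_fderiv_velocity hξ hv)).aemeasurable).aestronglyMeasurable
        (Eventually.of_forall fun z => ?_)
      set w := v z.1 z.2
      have hw : 0 ≤ ‖w‖ := norm_nonneg w
      have h1 : ‖w‖ ^ (p - 2) * |inner ℝ w (fderiv ℝ ξ z (1, w))| ≤
          2 * B * (1 + ‖w‖ ^ p) := by
        calc ‖w‖ ^ (p - 2) * |inner ℝ w (fderiv ℝ ξ z (1, w))|
            ≤ ‖w‖ ^ (p - 2) * (‖w‖ * (B * (1 + ‖w‖))) := by
              gcongr
              exact (abs_real_inner_le_norm _ _).trans (by gcongr; exact hz z.1 z.2 w)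
          _ = B * (‖w‖ ^ (p - 1) + ‖w‖ ^ p) := by
              have h5 : ‖w‖ ^ p = ‖w‖ ^ (p - 1) * ‖w‖ := by
                rw [← Real.rpow_add_one' hw (by linarith)]; ring_nf
              rw [h5, ← norm_rpow_sub_two_mul hp]
              ring
          _ ≤ B * ((1 + ‖w‖ ^ p) + (1 + ‖w‖ ^ p)) := by
              gcongr
              · exact rpow_le_one_add_rpow hw (by linarith) (by linarith)
              · linarith
          _ = _ := by ring
      have h6 : 0 ≤ 1 + ‖w‖ ^ p := by positivity
      simp only [norm_mul, Real.norm_eq_abs, abs_of_nonneg (hu _ _), abs_of_nonneg h6,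
        abs_of_nonneg (Real.rpow_nonneg hw (p - 2))]
      calc _ = |coeffK p α β F V z.1| * u z.1 z.2 *
            (‖w‖ ^ (p - 2) * |inner ℝ w (fderiv ℝ ξ z (1, w))|) := by ring
        _ ≤ |coeffK p α β F V z.1| * u z.1 z.2 * (2 * B * (1 + ‖w‖ ^ p)) :=
            mul_le_mul_of_nonneg_left h1 (mul_nonneg (abs_nonneg _) (hu _ _))
        _ = _ := by ring
  -- As `J` vanishes off the support of `ξ`, the domain may be exchanged for [a,b] × ℝ^d, where
  -- integrability permits Fubini's theorem.
  rw [setIntegral_eq_integral_of_forall_compl_eq_zero fun z hz => hJ0 z fun h => hz (hs h),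
    ← setIntegral_eq_integral_of_forall_compl_eq_zero (s := Icc a b ×ˢ univ)
      fun z hz => hJ0 z fun h => hz (hs' h)]
  rw [Measure.volume_eq_prod] at hJi ⊢
  rw [setIntegral_prod _ hJi]
  simp only [Measure.restrict_univ]
  have h7 : ∫ t in Icc a b, ∫ x, J (t, x) =
      ∫ t in Icc a b, variationDensity p q α β κ u v F V ξ t := by
    refine integral_congr_ae ?_
    filter_upwards [ae_restrict_Icc_of_Icc ha hb hreg] with t ht
    exact ht.integral_variation hp hum hu hξ hc
  rw [h7, ← hvar, setIntegral_eq_integral_of_forall_compl_eq_zero fun t ht =>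
      variationDensity_eq_zero (hzero t ht), setIntegral_eq_integral_of_forall_compl_eq_zero
      fun t ht => variationDensity_eq_zero (hzero t fun h => ht (hsub h))]

end Momentum

/-! ### The continuity equation and the no-flux condition. -/

section Continuity

variable {p q C N : ℝ} {Ω : Set (Sp d)} {κ : ProbabilityTheory.Kernel ℝ (Sp d)}
  [ProbabilityTheory.IsMarkovKernel κ] {u : ℝ → Sp d → ℝ} {v : ℝ → Sp d → Sp d} {F V : ℝ → ℝ}

/-- The time-dependent continuity equation between 0 and 1, where `φ` vanishes. The measures are
carried by Ω, so restricting the integral to Ω changes nothing and `φ` is free on the boundary. -/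
theorem integral_noFlux_eq_zero (hp : 1 < p) (hN : 0 ≤ N) (h : IsCoupled p C κ)
    (hv : IsVelocityField p κ v)
    (hE : ∀ᵐ t ∂(volume.restrict (Icc (0 : ℝ) 1)), energy p κ v t ≤ ENNReal.ofReal N)
    (hum : Measurable (Function.uncurry u)) (hu : ∀ t x, 0 ≤ u t x)
    (hΩ : MeasurableSet Ω) (hκΩ : ∀ t ∈ Icc (0 : ℝ) 1, κ t Ωᶜ = 0)
    (hreg : ∀ᵐ t ∂(volume.restrict (Icc (0 : ℝ) 1)), IsRegularTime p q κ u v F V t)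
    (hVm : AEMeasurable V (volume.restrict (Icc (0 : ℝ) 1)))
    {φ : ℝ × Sp d → ℝ} (hφ : ContDiff ℝ 1 φ) (hc : HasCompactSupport φ)
    (hs : tsupport φ ⊆ Ioo (0 : ℝ) 1 ×ˢ univ) :
    ∫ z in Ioo (0 : ℝ) 1 ×ˢ Ω,
      u z.1 z.2 * (fderiv ℝ φ z (1, 0) + fderiv ℝ φ z (0, v z.1 z.2)) = 0 := by
  have hp0 : 0 < p := by linarith
  have e : ∀ z : ℝ × Sp d, u z.1 z.2 * (fderiv ℝ φ z (1, 0) + fderiv ℝ φ z (0, v z.1 z.2)) =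
      u z.1 z.2 • fderiv ℝ φ z (1, v z.1 z.2) := fun z => by
    rw [← map_add, smul_eq_mul]
    simp
  simp only [e]
  have hφm : Measurable fun z : ℝ × Sp d => fderiv ℝ φ z (1, v z.1 z.2) := by
    have h3 : Continuous fun q : (ℝ × Sp d →L[ℝ] ℝ) × (ℝ × Sp d) => q.1 q.2 := by fun_prop
    exact h3.measurable.comp ((hφ.continuous_fderiv one_ne_zero).measurable.prodMk
      (measurable_const.prodMk hv.measurable))
  obtain ⟨B, hB⟩ := (hc.fderiv ℝ).exists_bound_of_continuous (hφ.continuous_fderiv one_ne_zero)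
  have hB0 : 0 ≤ B := (norm_nonneg _).trans (hB 0)
  have hi : IntegrableOn (fun z : ℝ × Sp d => u z.1 z.2 • fderiv ℝ φ z (1, v z.1 z.2))
      (Icc (0 : ℝ) 1 ×ˢ univ) := by
    refine ((integrableOn_density hp hN hum hu hv.measurable hE hreg hVm).const_mul
      (2 * B)).mono' (hum.mul hφm).aestronglyMeasurable (Eventually.of_forall fun z => ?_)
    have h1 : ‖fderiv ℝ φ z (1, v z.1 z.2)‖ ≤ B * (1 + ‖v z.1 z.2‖) := by
      refine ((fderiv ℝ φ z).le_opNorm _).trans (mul_le_mul (hB _) ?_ (norm_nonneg _) hB0)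
      rw [Prod.norm_def, norm_one]
      exact max_le (by linarith [norm_nonneg (v z.1 z.2)]) (by linarith)
    have h2 := rpow_le_one_add_rpow (norm_nonneg (v z.1 z.2)) zero_le_one hp.le
    rw [Real.rpow_one] at h2
    have h3 : 0 ≤ ‖v z.1 z.2‖ ^ p := by positivity
    rw [norm_smul, Real.norm_of_nonneg (hu _ _)]
    calc u z.1 z.2 * ‖fderiv ℝ φ z (1, v z.1 z.2)‖
        ≤ u z.1 z.2 * (B * (2 * (1 + ‖v z.1 z.2‖ ^ p))) :=
          mul_le_mul_of_nonneg_left (h1.trans (by gcongr; linarith)) (hu _ _)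
      _ = _ := by ring
  have hi' := hi.mono_set (t := Icc (0 : ℝ) 1 ×ˢ univ) (s := Ioo (0 : ℝ) 1 ×ˢ Ω)
    (prod_mono Ioo_subset_Icc_self (subset_univ _))
  rw [Measure.volume_eq_prod] at hi' ⊢
  rw [setIntegral_prod _ hi']
  have hφ0 : ∀ t, t ∉ Ioo (0 : ℝ) 1 → ∀ x, φ (t, x) = 0 := fun t ht x =>
    image_eq_zero_of_notMem_tsupport fun hz => ht (hs hz).1
  have hce := hv.integral_sub_eq hp hN h hE hφ hc (left_mem_Icc.2 zero_le_one)
    (right_mem_Icc.2 zero_le_one) zero_le_one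
  simp only [hφ0 0 (by simp), hφ0 1 (by simp), integral_zero, sub_self] at hce
  rw [intervalIntegral.integral_of_le zero_le_one, integral_Ioc_eq_integral_Ioo] at hce
  refine Eq.trans ?_ hce.symm
  refine integral_congr_ae ?_
  filter_upwards [ae_restrict_of_ae_restrict_of_subset Ioo_subset_Icc_self hreg,
    ae_restrict_mem measurableSet_Ioo] with t ht hmem
  have h1 : ∀ᵐ x ∂(κ t), x ∈ Ω := hκΩ t (Ioo_subset_Icc_self hmem)
  have h2 : ∫ x, fderiv ℝ φ (t, x) (1, v t x) ∂(κ t) =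
      ∫ x, Ω.indicator (fun x => fderiv ℝ φ (t, x) (1, v t x)) x ∂(κ t) :=
    integral_congr_ae (h1.mono fun x hx =>
      (indicator_of_mem hx fun x => fderiv ℝ φ (t, x) (1, v t x)).symm)
  rw [h2, ht.integral_eq hum.of_uncurry_left (hu t)]
  refine (integral_indicator hΩ).symm.trans ?_
  refine integral_congr_ae (Eventually.of_forall fun x => ?_)
  by_cases hx : x ∈ Ω <;> simp [hx]

end Continuity

/-! ### The end points are attained in the Wasserstein distance. -/

section Limits

variable {p C : ℝ} {μ : ℝ → Measure (Sp d)} {u : ℝ → Sp d → ℝ}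

theorem IsCoupled.tendsto_wDist (hp : 0 < p) (h : IsCoupled p C μ)
    (hu : ∀ᵐ t ∂(volume.restrict (Icc (0 : ℝ) 1)), μ t = densMeasure (u t)) {t₀ : ℝ}
    (ht₀ : t₀ ∈ Icc (0 : ℝ) 1) {l : Filter ℝ} (hl : l ≤ 𝓝 t₀) (hmem : ∀ᶠ t in l, t ∈ Icc (0 : ℝ) 1) :
    Tendsto (fun t => wDist p (densMeasure (u t)) (μ t₀)) (l ⊓ ae volume) (𝓝 0) := by
  have h1 : Tendsto (fun t => ENNReal.ofReal (C * |t - t₀|)) (l ⊓ ae volume) (𝓝 0) := by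
    have : Continuous fun t : ℝ => ENNReal.ofReal (C * |t - t₀|) :=
      ENNReal.continuous_ofReal.comp (by fun_prop)
    have := this.tendsto t₀
    simp only [sub_self, abs_zero, mul_zero, ENNReal.ofReal_zero] at this
    exact this.mono_left (inf_le_left.trans hl)
  refine tendsto_of_tendsto_of_tendsto_of_le_of_le' tendsto_const_nhds h1
    (Eventually.of_forall fun t => zero_le) ?_
  filter_upwards [Eventually.filter_mono inf_le_left hmem, Eventually.filter_mono inf_le_right
    ((ae_restrict_iff' measurableSet_Icc).1 hu)] with t ht ht'
  rw [← ht' ht]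
  exact h.wDist_le hp ht ht₀

end Limits

/-! ### Comparison of the minimiser with its perturbations. -/

section Minimality

variable {p q α β C N : ℝ} {Ω : Set (Sp d)} {κ : ProbabilityTheory.Kernel ℝ (Sp d)}
  [ProbabilityTheory.IsMarkovKernel κ] {u : ℝ → Sp d → ℝ} {v : ℝ → Sp d → Sp d} {F V : ℝ → ℝ}
  {ξ : ℝ × Sp d → Sp d} {μ₀ μ₁ : Measure (Sp d)}

theorem IsRegularTime.Lq_perturbed_le {m : ℝ → Measure (Sp d)} (hq : 0 < q) {c ε t : ℝ}
    (h : IsRegularTime p q m u v F V t) (hum : Measurable (u t)) (hu : ∀ x, 0 ≤ u t x)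
    (hξ : ContDiff ℝ 1 ξ) (hinj : Function.Injective fun x => x + ε • ξ (t, x))
    (hdet : ∀ z, 0 < |(1 + ε • spaceFDeriv ξ z).det| ∧
      |(|(1 + ε • spaceFDeriv ξ z).det| ^ (1 - q) - 1)| ≤ c) :
    Lq q Ω (perturbed m ξ ε t) ≤ ENNReal.ofReal (perturbedPressure q u ξ ε t) := by
  have hDc : Continuous fun x : Sp d => spaceFDeriv ξ (t, x) :=
    (continuous_spaceFDeriv hξ).comp (Continuous.prodMk_right t)
  have hi := integrable_mul_abs_det_rpow h.integrable hDc.measurable fun x => (hdet (t, x)).2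
  rw [perturbed, h.eq, densMeasure]
  refine (Lq_map_le hq Ω hum.ennreal_ofReal (hasFDerivAt_perturbation hξ ε t)
    (by fun_prop) hinj fun x => (hdet (t, x)).1).trans (le_of_eq ?_)
  rw [perturbedPressure, ofReal_integral_eq_lintegral_ofReal hi (Eventually.of_forall fun x =>
    mul_nonneg (Real.rpow_nonneg (hu x) q) (Real.rpow_nonneg (abs_nonneg _) _))]
  refine lintegral_congr fun x => ?_
  rw [ENNReal.ofReal_mul (Real.rpow_nonneg (hu x) q), ENNReal.ofReal_rpow_of_nonneg (hu x) hq.le]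

/-- Three smallness conditions on ε: the perturbation maps Ω into itself, is injective, and has a
nonvanishing Jacobian. The right side dominates the action of the perturbed curve without having to
equal it. -/
theorem exists_action_le (hp : 1 < p) (hq : 1 < q) (hα : 0 < α) (hβ : 0 < β)
    (hΩ : MeasurableSet Ω) (hN : 0 ≤ N) (h : IsCoupled p C κ)
    (hcurve : IsLipschitzCurve p Ω μ₀ μ₁ κ)
    (hmin : ∀ ν : ℝ → Measure (Sp d), IsLipschitzCurve p Ω μ₀ μ₁ ν →
      action p q α β Ω κ ≤ action p q α β Ω ν)
    (hv : IsVelocityField p κ v)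
    (hE : ∀ᵐ t ∂(volume.restrict (Icc (0 : ℝ) 1)), energy p κ v t ≤ ENNReal.ofReal N)
    (hum : Measurable (Function.uncurry u)) (hu : ∀ t x, 0 ≤ u t x)
    (hreg : ∀ᵐ t ∂(volume.restrict (Icc (0 : ℝ) 1)), IsRegularTime p q κ u v F V t)
    (hξ : ContDiff ℝ 1 ξ) (hc : HasCompactSupport ξ)
    (hs : tsupport ξ ⊆ Ioo (0 : ℝ) 1 ×ˢ interior Ω) :
    ∃ δ > 0, ∀ ε : ℝ, |ε| < δ → action p q α β Ω κ ≤ ∫⁻ t in Icc (0 : ℝ) 1,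
      ENNReal.ofReal (perturbedPressure q u ξ ε t ^ α * perturbedKinetic p κ v ξ ε t ^ β) := by
  have hp0 : 0 < p := by linarith
  obtain ⟨δ₁, hδ₁, H₁⟩ := exists_maps_of_tsupport_subset hξ.continuous hc
    (hs.trans (prod_mono (subset_univ _) subset_rfl))
  obtain ⟨δ₂, hδ₂, H₂⟩ := exists_injective_perturbation hξ hc
  obtain ⟨δ₃, hδ₃, c, hc0, H₃⟩ := exists_abs_det_perturbation_le hξ hc (1 - q)
  obtain ⟨L, hL⟩ : ∃ L : ℝ≥0, LipschitzWith L ξ :=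
    ⟨_, (hξ.lipschitzWith_of_hasCompactSupport hc one_ne_zero).choose_spec⟩
  refine ⟨min δ₁ (min δ₂ δ₃), by positivity, fun ε hε => ?_⟩
  obtain ⟨hε₁, hε₂⟩ := lt_min_iff.1 hε
  obtain ⟨hε₂, hε₃⟩ := lt_min_iff.1 hε₂
  obtain ⟨D, hD⟩ := h.exists_perturbed hp0 hL ε
  -- This keeps the end points of the curve fixed.
  have hξ0 : ∀ t, t ∉ Ioo (0 : ℝ) 1 → ∀ x, ξ (t, x) = 0 := fun t ht x =>
    image_eq_zero_of_notMem_tsupport fun hz => ht (hs hz).1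
  have hcurve' : IsLipschitzCurve p Ω μ₀ μ₁ (perturbed κ ξ ε) :=
    hD.isLipschitzCurve hp0 (fun t ht => perturbed_mem_wSpace hp hξ.continuous hc
      (hcurve.mem t ht) hΩ (H₁ ε hε₁ t))
      ((perturbed_eq_self (hξ0 0 (by simp))).trans hcurve.left)
      ((perturbed_eq_self (hξ0 1 (by simp))).trans hcurve.right)
  refine (hmin _ hcurve').trans ((action_perturbed_le hp hβ.le hN h hv hE hξ hc
    (H₂ ε hε₂)).trans (lintegral_mono_ae ?_))
  filter_upwards [hreg] with t ht
  have h1 := ht.Lq_perturbed_le (Ω := Ω) (by linarith) hum.of_uncurry_left (hu t) hξ (H₂ ε hε₂ t)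
    (H₃ ε hε₃)
  have h2 : energy p κ (fun t x => v t x + ε • fderiv ℝ ξ (t, x) (1, v t x)) t =
      ENNReal.ofReal (perturbedKinetic p κ v ξ ε t) :=
    energy_eq_ofReal hp0 (ht.memLp.add ((memLp_perturbed_velocity hξ hc
      (measurable_prodMk_left (x := t)) ht.memLp).const_smul ε))
  have hA0 : 0 ≤ perturbedPressure q u ξ ε t := integral_nonneg fun x =>
    mul_nonneg (Real.rpow_nonneg (hu t x) q) (Real.rpow_nonneg (abs_nonneg _) _)
  have hW0 : 0 ≤ perturbedKinetic p κ v ξ ε t := integral_nonneg fun x => by positivity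
  rw [h2, ENNReal.ofReal_mul (Real.rpow_nonneg hA0 α), ← ENNReal.ofReal_rpow_of_nonneg hA0 hα.le,
    ← ENNReal.ofReal_rpow_of_nonneg hW0 hβ.le]
  gcongr

end Minimality

/-! ### Assembly of the weak formulation for a curve given by a kernel. -/

section Main

variable {p q α β C N : ℝ} {Ω : Set (Sp d)} {κ : ProbabilityTheory.Kernel ℝ (Sp d)}
  [ProbabilityTheory.IsMarkovKernel κ] {u : ℝ → Sp d → ℝ} {v : ℝ → Sp d → Sp d} {F V : ℝ → ℝ}
  {μ₀ μ₁ : Measure (Sp d)}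

theorem norm_momentum_le (hp : 1 < p) {k s : ℝ} (a : Sp d) :
    ‖(k * s * ‖a‖ ^ (p - 2)) • a‖ ≤ ‖k * s * (1 + ‖a‖ ^ p)‖ := by
  have h : 0 ≤ 1 + ‖a‖ ^ p := by positivity
  rw [norm_smul, norm_mul, norm_mul (k * s), mul_assoc, Real.norm_of_nonneg h,
    Real.norm_of_nonneg (Real.rpow_nonneg (norm_nonneg a) _), norm_rpow_sub_two_mul hp]
  gcongr
  exact rpow_le_one_add_rpow (norm_nonneg a) (by linarith) (by linarith)

theorem norm_flux_le (hp : 1 < p) {k s : ℝ} (a : Sp d) (i j : Fin d) :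
    ‖k * s * ‖a‖ ^ (p - 2) * (a i * a j)‖ ≤ ‖k * s * (1 + ‖a‖ ^ p)‖ := by
  have h : 0 ≤ 1 + ‖a‖ ^ p := by positivity
  have h1 : ‖a‖ ^ p = ‖a‖ ^ (p - 2) * (‖a‖ * ‖a‖) := by
    rw [← mul_assoc, norm_rpow_sub_two_mul hp, ← Real.rpow_add_one' (norm_nonneg a) (by linarith)]
    ring_nf
  rw [norm_mul, norm_mul (k * s), norm_mul (k * s), mul_assoc, Real.norm_of_nonneg h,
    Real.norm_of_nonneg (Real.rpow_nonneg (norm_nonneg a) _)]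
  gcongr
  calc ‖a‖ ^ (p - 2) * ‖a i * a j‖ ≤ ‖a‖ ^ (p - 2) * (‖a‖ * ‖a‖) := by
        rw [norm_mul]
        gcongr <;> exact PiLp.norm_apply_le a _
    _ ≤ 1 + ‖a‖ ^ p := by rw [h1]; linarith

theorem isWeakSolution_of_regular (hp : 1 < p) (hβ : 0 < β) (hN : 0 ≤ N) (h : IsCoupled p C κ)
    (hv : IsVelocityField p κ v)
    (hE : ∀ᵐ t ∂(volume.restrict (Icc (0 : ℝ) 1)), energy p κ v t ≤ ENNReal.ofReal N)
    (hum : Measurable (Function.uncurry u)) (hu : ∀ t x, 0 ≤ u t x)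
    (hΩ : MeasurableSet Ω) (hcurve : IsLipschitzCurve p Ω μ₀ μ₁ κ)
    (hreg : ∀ᵐ t ∂(volume.restrict (Icc (0 : ℝ) 1)), IsRegularTime p q κ u v F V t)
    (hF : AEMeasurable F (volume.restrict (Icc (0 : ℝ) 1)))
    (hVm : AEMeasurable V (volume.restrict (Icc (0 : ℝ) 1)))
    (hint : IntegrableOn (fun t => F t ^ α * V t ^ β) (Icc 0 1))
    (hV : ∀ a b : ℝ, 0 < a → a < b → b < 1 → ∃ V₀ : ℝ, 0 < V₀ ∧
      ∀ᵐ t ∂(volume.restrict (Icc a b)), V₀ ≤ V t)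
    (hmin : ∀ ξ : ℝ × Sp d → Sp d, ContDiff ℝ 1 ξ → HasCompactSupport ξ →
      tsupport ξ ⊆ Ioo (0 : ℝ) 1 ×ˢ interior Ω → ∃ δ > 0, ∀ ε : ℝ, |ε| < δ →
        ∫⁻ t in Icc (0 : ℝ) 1, ENNReal.ofReal (F t ^ α * V t ^ β) ≤ ∫⁻ t in Icc (0 : ℝ) 1,
          ENNReal.ofReal (perturbedPressure q u ξ ε t ^ α * perturbedKinetic p κ v ξ ε t ^ β)) :
    IsWeakSolution p q Ω (coeffH q α β F V) (coeffK p α β F V) μ₀ μ₁ u v := by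
  have hp0 : 0 < p := by linarith
  have hvm := hv.measurable
  have hK : AEMeasurable (coeffK p α β F V) (volume.restrict (Icc (0 : ℝ) 1)) :=
    ((hF.pow_const α).const_mul (p * β)).mul (hVm.pow_const (β - 1))
  have hKu : ∀ a b : ℝ, 0 < a → b < 1 → AEMeasurable
      (fun z : ℝ × Sp d => coeffK p α β F V z.1 * u z.1 z.2 * ‖v z.1 z.2‖ ^ (p - 2))
      (volume.restrict (Icc a b ×ˢ univ)) := fun a b ha hb =>
    ((aemeasurable_fst_strip (hK.mono_measure (Measure.restrict_mono_set _
      (Icc_subset_Icc ha.le hb.le)))).mul hum.aemeasurable).mul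
      (hvm.norm.pow_const (p - 2)).aemeasurable
  have hcoord : ∀ i : Fin d, Measurable fun z : ℝ × Sp d => v z.1 z.2 i := fun i =>
    (PiLp.continuous_apply 2 (fun _ : Fin d => ℝ) i).measurable.comp hvm
  have hdens := integrableOn_density hp hN hum hu hvm hE hreg hVm
  have hsub : ∀ {S : Set (Sp d)}, Ioo (0 : ℝ) 1 ×ˢ S ⊆ Icc (0 : ℝ) 1 ×ˢ univ := fun {S} =>
    prod_mono Ioo_subset_Icc_self (subset_univ S)
  have hflux := fun (φ : ℝ × Sp d → ℝ) (hφ : ContDiff ℝ ∞ φ) (hc : HasCompactSupport φ)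
      (hs : tsupport φ ⊆ Ioo (0 : ℝ) 1 ×ˢ univ) => integral_noFlux_eq_zero hp hN h hv hE hum hu hΩ (fun t ht => (hcurve.mem t ht).2.1) hreg hVm
      (hφ.of_le (by simp)) hc hs
  have hlim : ∀ᵐ t ∂(volume.restrict (Icc (0 : ℝ) 1)), κ t = densMeasure (u t) :=
    hreg.mono fun t ht => ht.eq
  refine ⟨?_, fun i j => ?_, ?_, ?_, ?_, fun ξ hξ hc hs => ?_, fun φ hφ hc hs => ?_, hflux, ?_, ?_⟩
  · exact ((integrableOn_pressure hum hu hreg hF hVm hint).mono_set hsub).locallyIntegrableOn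
  · refine locallyIntegrableOn_of_strip fun a b ha hab hb => ?_
    obtain ⟨V₀, hV₀, hVt⟩ := hV a b ha hab hb
    exact Integrable.mono
      (integrableOn_kinetic hp hβ hum hu hvm hreg hF hVm hint ha.le hb.le hV₀ hVt)
      ((hKu a b ha hb).mul ((hcoord i).mul (hcoord j)).aemeasurable).aestronglyMeasurable
      (Eventually.of_forall fun z => norm_flux_le hp _ i j)
  · refine locallyIntegrableOn_of_strip fun a b ha hab hb => ?_
    obtain ⟨V₀, hV₀, hVt⟩ := hV a b ha hab hb
    exact Integrable.mono
      (integrableOn_kinetic hp hβ hum hu hvm hreg hF hVm hint ha.le hb.le hV₀ hVt)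
      ((hKu a b ha hb).smul hvm.aemeasurable).aestronglyMeasurable
      (Eventually.of_forall fun z => norm_momentum_le hp _)
  · refine IntegrableOn.locallyIntegrableOn (IntegrableOn.mono_set ?_ hsub)
    refine Integrable.mono' hdens hum.aestronglyMeasurable (Eventually.of_forall fun z => ?_)
    refine (Real.norm_of_nonneg (hu z.1 z.2)).le.trans ?_
    have : 0 ≤ ‖v z.1 z.2‖ ^ p := by positivity
    nlinarith [hu z.1 z.2]
  · refine IntegrableOn.locallyIntegrableOn (IntegrableOn.mono_set ?_ hsub)
    refine Integrable.mono' hdens (hum.smul hvm).aestronglyMeasurable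
      (Eventually.of_forall fun z => ?_)
    have h2 := rpow_le_one_add_rpow (norm_nonneg (v z.1 z.2)) zero_le_one hp.le
    rw [Real.rpow_one] at h2
    rw [norm_smul]
    exact (mul_le_mul_of_nonneg_right (Real.norm_of_nonneg (hu z.1 z.2)).le (norm_nonneg _)).trans
      (mul_le_mul_of_nonneg_left h2 (hu _ _))
  · have hξ1 : ContDiff ℝ 1 ξ := hξ.of_le (by simp)
    -- The times seen by `ξ` lie in a compact subinterval of ]0,1[, on which V is bounded below.
    obtain ⟨a, b, ha, hab, hb, hK'⟩ := exists_Icc_of_isCompact (hc.isCompact.image continuous_fst)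
      (image_subset_iff.2 fun z hz => (hs hz).1)
    have hs' : tsupport ξ ⊆ Icc a b ×ˢ univ := fun z hz => ⟨hK' ⟨z, hz, rfl⟩, mem_univ _⟩
    obtain ⟨V₀, hV₀, hVt⟩ := hV a b ha hab hb
    obtain ⟨δ, hδ, hle⟩ := hmin ξ hξ1 hc hs
    refine integral_momentum_eq_zero hp hβ hum hu hvm hreg hF hVm hint hξ1 hc hs ha.le hb.le hV₀
      hVt hs' (integral_variationDensity_eq_zero hp hum hu hvm hreg hint hξ1 hc hV₀ ?_ hδ hle)
    refine ae_restrict_of_ae ?_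
    filter_upwards [(ae_restrict_iff' measurableSet_Icc).1 hVt] with t ht
    by_cases hmem : t ∈ Icc a b
    · exact Or.inr (ht hmem)
    · exact Or.inl fun x => fderiv_eq_zero_of_notMem_tsupport fun hz => hmem (hs' hz).1
  · have h0 : ∀ z : ℝ × Sp d, z ∉ tsupport φ →
        u z.1 z.2 * (fderiv ℝ φ z (1, 0) + fderiv ℝ φ z (0, v z.1 z.2)) = 0 := fun z hz => by
      simp [fderiv_eq_zero_of_notMem_tsupport hz]
    refine Eq.trans ?_ (hflux φ hφ hc (hs.trans (prod_mono subset_rfl (subset_univ _))))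
    rw [setIntegral_eq_integral_of_forall_compl_eq_zero fun z hz => h0 z fun hh => hz (hs hh),
      setIntegral_eq_integral_of_forall_compl_eq_zero fun z hz =>
        h0 z fun hh => hz (prod_mono subset_rfl interior_subset (hs hh))]
  · rw [← hcurve.left]
    refine h.tendsto_wDist hp0 hlim (left_mem_Icc.2 zero_le_one) nhdsWithin_le_nhds ?_
    filter_upwards [Ioo_mem_nhdsGT (zero_lt_one (α := ℝ))] with t ht
    exact Ioo_subset_Icc_self ht
  · rw [← hcurve.right]
    refine h.tendsto_wDist hp0 hlim (right_mem_Icc.2 zero_le_one) nhdsWithin_le_nhds ?_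
    filter_upwards [Ioo_mem_nhdsLT (zero_lt_one (α := ℝ))] with t ht
    exact Ioo_subset_Icc_self ht

end Main

/-! ### Replacement of the curve by a kernel, and finiteness of L_q. -/

section Transfer

variable {p q α β : ℝ} {Ω : Set (Sp d)} {μ₀ μ₁ : Measure (Sp d)} {μ ν : ℝ → Measure (Sp d)}
  {u : ℝ → Sp d → ℝ} {v : ℝ → Sp d → Sp d}

theorem IsLipschitzCurve.congr (h : ∀ t ∈ Icc (0 : ℝ) 1, μ t = ν t)
    (hμ : IsLipschitzCurve p Ω μ₀ μ₁ μ) : IsLipschitzCurve p Ω μ₀ μ₁ ν := by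
  refine ⟨fun t ht => h t ht ▸ hμ.mem t ht, ?_, ?_, ?_⟩
  · obtain ⟨C, hC⟩ := hμ.lipschitz
    refine ⟨C, fun s hs t ht => ?_⟩
    rw [← h s hs, ← h t ht]
    exact hC s hs t ht
  · rw [← h 0 (left_mem_Icc.2 zero_le_one), hμ.left]
  · rw [← h 1 (right_mem_Icc.2 zero_le_one), hμ.right]

theorem IsDensity.congr (h : ∀ t ∈ Icc (0 : ℝ) 1, μ t = ν t) (hu : IsDensity μ u) :
    IsDensity ν u := by
  refine ⟨hu.measurable, hu.nonneg, ?_⟩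
  filter_upwards [hu.eq, ae_restrict_mem measurableSet_Icc] with t h1 h2
  rw [← h t h2, h1]

/-- Positive energy rules out the convention 0 · ∞ = 0, so an infinite L_q on a set of times of
positive measure would make the action infinite. -/
theorem ae_Lq_lt_top (hα : 0 < α) (hβ : 0 < β) {κ : ProbabilityTheory.Kernel ℝ (Sp d)}
    [ProbabilityTheory.IsMarkovKernel κ] (hv : Measurable (Function.uncurry v))
    (hfin : ∫⁻ t in Icc (0 : ℝ) 1, Lq q Ω (κ t) ^ α * energy p κ v t ^ β < ⊤)
    (hpos : ∀ᵐ t ∂(volume.restrict (Icc (0 : ℝ) 1)), 0 < energy p κ v t) :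
    ∀ᵐ t ∂(volume.restrict (Icc (0 : ℝ) 1)), Lq q Ω (κ t) < ⊤ := by
  have hm : Measurable fun t => Lq q Ω (κ t) ^ α * energy p κ v t ^ β :=
    ((measurable_Lq q Ω κ).pow_const α).mul ((measurable_energy hv).pow_const β)
  filter_upwards [ae_lt_top hm hfin.ne, hpos] with t h1 h2
  by_contra h3
  rw [not_lt_top_iff] at h3
  rw [h3, ENNReal.top_rpow_of_pos hα, ENNReal.top_mul
    ((ENNReal.rpow_pos_of_nonneg h2 hβ.le).ne')] at h1
  exact lt_irrefl _ h1

theorem absolutelyContinuous_of_Lq_lt_top {m : Measure (Sp d)} (h : Lq q Ω m < ⊤) :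
    m ≪ volume := by
  by_contra hm
  rw [Lq, if_neg hm] at h
  exact lt_irrefl _ h

end Transfer

end WeightedWasserstein

theorem mainTheorem1 {d : ℕ} (p q α β : ℝ) (hp : 1 < p) (hq : 1 < q) (hα : 0 < α) (hβ : 0 < β)
    (Ω : Set (Sp d)) (hΩ_closed : IsClosed Ω) (hΩ_convex : Convex ℝ Ω)
    (μ₀ μ₁ : Measure (Sp d)) (hμ₀ : μ₀ ∈ wSpace p Ω) (hμ₁ : μ₁ ∈ wSpace p Ω) (hne : μ₀ ≠ μ₁)
    (μ : ℝ → Measure (Sp d)) (hμ : IsLipschitzCurve p Ω μ₀ μ₁ μ)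
    (hmin : ∀ ν : ℝ → Measure (Sp d), IsLipschitzCurve p Ω μ₀ μ₁ ν →
      action p q α β Ω μ ≤ action p q α β Ω ν)
    (hfin : action p q α β Ω μ < ⊤)
    (v : ℝ → Sp d → Sp d) (hv : IsTangentField p μ v)
    (hV : ∀ a b : ℝ, 0 < a → a < b → b < 1 → ∃ V₀ : ℝ≥0∞, 0 < V₀ ∧
      ∀ᵐ t ∂(volume.restrict (Icc a b)), V₀ ≤ energy p μ v t) :
    (∃ u : ℝ → Sp d → ℝ, IsDensity μ u) ∧
    ∀ u : ℝ → Sp d → ℝ, IsDensity μ u →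
      IsWeakSolution p q Ω
        (coeffH q α β (fun t => (Lq q Ω (μ t)).toReal) (fun t => (energy p μ v t).toReal))
        (coeffK p α β (fun t => (Lq q Ω (μ t)).toReal) (fun t => (energy p μ v t).toReal))
        μ₀ μ₁ u v := by
  have hp0 : 0 < p := by linarith
  have hq0 : 0 < q := by linarith
  have hΩ := hΩ_closed.measurableSet
  obtain ⟨C, hC⟩ := hμ.exists_isCoupled hp0
  -- The kernel agrees with `μ` on [0,1], and every notion involved sees only these times, so the
  -- argument is carried out for `κ`.
  obtain ⟨κ, _, hκ⟩ := hC.exists_kernel hp0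
  have hμκ : ∀ t ∈ Icc (0 : ℝ) 1, μ t = κ t := fun t ht => (hκ t ht).symm
  have hCκ := hC.congr hμκ
  have hvκ := hv.congr hμκ
  have hvm := hv.velocity.measurable
  have hcurve := hμ.congr hμκ
  have hN : 0 ≤ C ^ p := Real.rpow_nonneg hC.pos.le p
  have hE := hvκ.ae_energy_le hp hCκ
  have hEpos : ∀ᵐ t ∂(volume.restrict (Icc (0 : ℝ) 1)), 0 < energy p κ v t := by
    filter_upwards [ae_energy_pos hV, ae_restrict_mem measurableSet_Icc] with t h1 h2
    rwa [← energy_congr hμκ h2]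
  have hact := action_eq p q α β Ω κ v hvκ
  rw [action_congr hμκ] at hfin
  have hmin' : ∀ ν : ℝ → Measure (Sp d), IsLipschitzCurve p Ω μ₀ μ₁ ν →
      action p q α β Ω κ ≤ action p q α β Ω ν := fun ν hν => by
    rw [← action_congr hμκ]
    exact hmin ν hν
  have hfin' := hfin
  rw [hact] at hfin'
  have hLq := ae_Lq_lt_top hα hβ hvm hfin' hEpos
  refine ⟨?_, fun u hu => ?_⟩
  · obtain ⟨u, hu⟩ := exists_isDensity (κ := κ)
      (hLq.mono fun t ht => absolutelyContinuous_of_Lq_lt_top ht)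
    exact ⟨u, hu.congr hκ⟩
  set F : ℝ → ℝ := fun t => (Lq q Ω (μ t)).toReal
  set V : ℝ → ℝ := fun t => (energy p μ v t).toReal
  have hFκ : ∀ t ∈ Icc (0 : ℝ) 1, F t = (Lq q Ω (κ t)).toReal := fun t ht => by
    simp only [F, hμκ t ht]
  have hVκ : ∀ t ∈ Icc (0 : ℝ) 1, V t = (energy p κ v t).toReal := fun t ht => by
    simp only [V, energy_congr hμκ ht]
  have hF : AEMeasurable F (volume.restrict (Icc (0 : ℝ) 1)) :=
    ((measurable_Lq q Ω κ).ennreal_toReal.aemeasurable).congr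
      ((ae_restrict_iff' measurableSet_Icc).2 (Eventually.of_forall fun t ht => (hFκ t ht).symm))
  have hVm : AEMeasurable V (volume.restrict (Icc (0 : ℝ) 1)) :=
    ((measurable_energy hvm).ennreal_toReal.aemeasurable).congr
      ((ae_restrict_iff' measurableSet_Icc).2 (Eventually.of_forall fun t ht => (hVκ t ht).symm))
  have hreg : ∀ᵐ t ∂(volume.restrict (Icc (0 : ℝ) 1)), IsRegularTime p q κ u v F V t := by
    filter_upwards [hLq, hE, hEpos, (hu.congr hμκ).eq, ae_restrict_mem measurableSet_Icc]
      with t h1 h2 h3 h4 h5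
    have h := isRegularTime_of_lt_top hp0 hq0 hΩ inferInstance (hcurve.mem t h5).2.1
      hu.measurable.of_uncurry_left (hu.nonneg t) hvm h4 h1 (h2.trans_lt ENNReal.ofReal_lt_top) h3
    exact ⟨h.eq, h.integrable, (hFκ t h5).trans h.pressure, (hFκ t h5).symm ▸ h.pressure_pos,
      h.memLp, (hVκ t h5).trans h.kinetic, (hVκ t h5).symm ▸ h.kinetic_pos⟩
  have hdens : (fun t => Lq q Ω (κ t) ^ α * energy p κ v t ^ β)
      =ᵐ[volume.restrict (Icc (0 : ℝ) 1)] fun t => ENNReal.ofReal (F t ^ α * V t ^ β) := by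
    filter_upwards [hLq, hE, hreg, ae_restrict_mem measurableSet_Icc] with t h1 h2 h3 h5
    have hF0 := h3.pressure_pos.le
    have hV0 := h3.kinetic_pos.le
    rw [ENNReal.ofReal_mul (Real.rpow_nonneg hF0 α), ← ENNReal.ofReal_rpow_of_nonneg hF0 hα.le,
      ← ENNReal.ofReal_rpow_of_nonneg hV0 hβ.le, hFκ t h5, hVκ t h5, ENNReal.ofReal_toReal h1.ne,
      ENNReal.ofReal_toReal (h2.trans_lt ENNReal.ofReal_lt_top).ne]
  have hact' := hact.trans (lintegral_congr_ae hdens)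
  have hint : IntegrableOn (fun t => F t ^ α * V t ^ β) (Icc 0 1) := by
    refine ⟨((hF.pow_const α).mul (hVm.pow_const β)).aestronglyMeasurable, ?_⟩
    rw [hasFiniteIntegral_iff_ofReal (Eventually.of_forall fun t => mul_nonneg
      (Real.rpow_nonneg ENNReal.toReal_nonneg _) (Real.rpow_nonneg ENNReal.toReal_nonneg _)),
      ← hact']
    exact hfin
  refine isWeakSolution_of_regular hp hβ hN hCκ hvκ.velocity hE hu.measurable hu.nonneg hΩ hcurve
    hreg hF hVm hint (fun a b ha hab hb => ?_) fun ξ hξ hc hs => ?_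
  · obtain ⟨V₀, hV₀, hle⟩ := hV a b ha hab hb
    -- The bound `V₀` is an extended number and might be ∞, whose real part is 0; truncation at 1
    -- keeps it positive and finite.
    refine ⟨(min V₀ 1).toReal, ENNReal.toReal_pos (lt_min hV₀ one_pos).ne'
      ((min_le_right _ _).trans_lt ENNReal.one_lt_top).ne, ?_⟩
    have hsub : Icc a b ⊆ Icc (0 : ℝ) 1 := Icc_subset_Icc ha.le hb.le
    filter_upwards [hle, ae_restrict_Icc_of_Icc ha.le hb.le hE, ae_restrict_mem measurableSet_Icc]
      with t h1 h2 h3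
    rw [← energy_congr hμκ (hsub h3)] at h2
    exact ENNReal.toReal_mono (h2.trans_lt ENNReal.ofReal_lt_top).ne ((min_le_left _ _).trans h1)
  · rw [← hact']
    exact exists_action_le hp hq hα hβ hΩ hN hCκ hcurve hmin' hvκ.velocity hE hu.measurable
      hu.nonneg hreg hξ hc hs
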